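/- Let $m>0$ and let $v:\mathbb{R}^4\to\mathbb{R}$ be measurable with $v\le 0$ and $|v(x)|\le C(1+|x|)^{-b}$ for some constants $C$ and $b>4$. In the complex Hilbert space $L^2(\mathbb{R}^4)$ let $h_0=-\frac{1}{2m}\Delta$ and $h=-\frac{1}{2m}\Delta+v$, both with domain $H^2(\mathbb{R}^4)$; let $r_0(z)=(h_0-z)^{-1}$, $r(z)=(h-z)^{-1}$, and $$w(z)=I+|v|^{1/2}r(z)|v|^{1/2}.$$ One says that $h$ has a virtual level if $h\ge 0$ and $\sigma_{\mathrm{disc}}\bigl(-\frac{1}{2m}\Delta+(1+\varepsilon)v\bigr)\neq\emptyset$ for every $\varepsilon>0$. One says that $0$ is a resonance of $h$ if $h$ has a virtual level and there is a positive $f\in\dot H^1(\mathbb{R}^4)$ (the completion of $C_0^\infty(\mathbb{R}^4)$ in the norm $\|\nabla f\|_{L^2}$) with $\bigl(-\frac{1}{2m}\Delta+v\bigr)f=0$ in the distributional sense and $f\notin L^2(\mathbb{R}^4)$. Then the integral operator $G$ with kernel $$G(x,y)=\frac{m}{2\pi^2}\,\frac{|v(x)|^{1/2}|v(y)|^{1/2}}{|x-y|^2}$$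 is a bounded operator in $L^2(\mathbb{R}^4)$, and the following hold. (1) There exist compact operators $G_1,G_2$ and constants $\delta>0$, $C_\delta$ such that for all $z<0$ with $|z|$ sufficiently small $r_0(z)$ exists and $$|v|^{1/2}r_0(z)|v|^{1/2}=G+zG_1+z\ln|z|\,G_2+|z|^{1+\delta}G^{(\delta)}(z),\qquad \|G^{(\delta)}(z)\|_{HS}\le C_\delta|z|^{\delta},$$ where $\|\cdot\|_{HS}$ is the Hilbert–Schmidt norm. (2) Suppose that $0$ is a resonance of $h$. Then $1$ is a simple eigenvalue of $G$, it has an eigenfunction $\varphi$ normalized by $\int_{\mathbb{R}^4}|v|^{1/2}\varphi\,dx=\frac{2\pi}{m}$, and there is a constant $\tau\in\mathbb{R}$ (depending only on $v$ and $m$) such that for every sufficiently small $\delta>0$ the following holds: for all $z<0$ with $|z|$ sufficiently small, $r(z)$ exists, $z(\ln|z|-\tau)>0$, and $$w(z)=\bigl(z(\ln|z|-\tau)\bigr)^{-1}\langle\cdot,\varphi\rangle\varphi+\bigl(z(\ln|z|-\tau)\bigr)^{-1+\delta}w^{(\delta)}(z),$$ where the operators $w^{(\delta)}(z)$ are bounded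 in operator norm by a constant independent of $z$. -/

import Mathlib

open MeasureTheory Filter Topology
open scoped ENNReal ContDiff SchwartzMap Laplacian

noncomputable section

namespace TwoBody

/-! ### Unbounded operators in a Hilbert space -/

section Operators

variable {H : Type*} [NormedAddCommGroup H] [InnerProductSpace ℂ H]

/-- `R` is the resolvent `(A - z)⁻¹` of the unbounded operator `A`: a bounded operator which is a
two-sided inverse of `A - z : dom A → H`. -/
def IsResolventAt (A : H →ₗ.[ℂ] H) (z : ℂ) (R : H →L[ℂ] H) : Prop :=
  (∀ ψ : H, ∃ h : R ψ ∈ A.domain, A ⟨R ψ, h⟩ - z • R ψ = ψ) ∧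
    ∀ χ : A.domain, R (A χ - z • (χ : H)) = χ

theorem IsResolventAt.unique {A : H →ₗ.[ℂ] H} {z : ℂ} {R R' : H →L[ℂ] H}
    (hR : IsResolventAt A z R) (hR' : IsResolventAt A z R') : R = R' := by
  ext ψ
  obtain ⟨h, e⟩ := hR'.1 ψ
  have := hR.2 ⟨R' ψ, h⟩
  rw [e] at this
  exact this

/-- The resolvent set of an unbounded operator. -/
def resolventSet (A : H →ₗ.[ℂ] H) : Set ℂ := {z | ∃ R : H →L[ℂ] H, IsResolventAt A z R}

/-- The spectrum of an unbounded operator. -/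
def spectrum (A : H →ₗ.[ℂ] H) : Set ℂ := (resolventSet A)ᶜ

/-- The eigenspace `{ψ ∈ dom A | A ψ = z ψ}`. -/
def eigenspace (A : H →ₗ.[ℂ] H) (z : ℂ) : Submodule ℂ A.domain :=
  LinearMap.ker (A.toFun - z • A.domain.subtype)

/-- The discrete spectrum: isolated points of the spectrum which are eigenvalues of finite
multiplicity. -/
def discreteSpectrum (A : H →ₗ.[ℂ] H) : Set ℂ :=
  {z | z ∈ spectrum A ∧ (∃ U ∈ 𝓝 z, U ∩ spectrum A = {z}) ∧
    eigenspace A z ≠ ⊥ ∧ FiniteDimensional ℂ (eigenspace A z)}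

/-- `A ≥ 0` in the sense of quadratic forms. -/
def IsNonneg (A : H →ₗ.[ℂ] H) : Prop :=
  ∀ ψ : A.domain, 0 ≤ (inner ℂ (ψ : H) (A ψ)).re

open Classical in
/-- The resolvent `(A - z)⁻¹` (with value `0` if `z` is not in the resolvent set). -/
def resolvent (A : H →ₗ.[ℂ] H) (z : ℂ) : H →L[ℂ] H :=
  if h : ∃ R : H →L[ℂ] H, IsResolventAt A z R then h.choose else 0

theorem IsResolventAt.resolvent_eq {A : H →ₗ.[ℂ] H} {z : ℂ} {R : H →L[ℂ] H}
    (hR : IsResolventAt A z R) : resolvent A z = R := by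
  have h : ∃ R : H →L[ℂ] H, IsResolventAt A z R := ⟨R, hR⟩
  rw [resolvent, dif_pos h]
  exact h.choose_spec.unique hR

/-- The Hilbert–Schmidt norm `(∑ ‖T e‖²)^(1/2)`, `e` running through an orthonormal basis
(it is `∞` if `T` is not a Hilbert–Schmidt operator). By `hsNorm_eq` any basis may be used. -/
def hsNorm [CompleteSpace H] (T : H →L[ℂ] H) : ℝ≥0∞ :=
  (∑' e : (exists_hilbertBasis ℂ H).choose, ‖T (e : H)‖ₑ ^ 2) ^ (1 / 2 : ℝ)

theorem enorm_sq_eq_tsum {ι : Type*} (b : HilbertBasis ι ℂ H) (x : H) :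
    ‖x‖ₑ ^ 2 = ∑' i, ‖inner ℂ (b i) x‖ₑ ^ 2 := by
  have h := b.hasSum_inner_mul_inner x x
  have h2 : HasSum (fun i => ‖inner ℂ (b i) x‖ ^ 2) (‖x‖ ^ 2) := by
    have h3 := Complex.hasSum_re h
    have e1 : (inner ℂ x x).re = ‖x‖ ^ 2 := by
      rw [← inner_self_eq_norm_sq (𝕜 := ℂ) x]; rfl
    rw [e1] at h3
    refine h3.congr_fun ?_
    intro i
    rw [← inner_conj_symm x (b i), ← Complex.normSq_eq_conj_mul_self, Complex.ofReal_re,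
      Complex.normSq_eq_norm_sq]
  have key : ∀ y : ℝ, 0 ≤ y → ENNReal.ofReal (y ^ 2) = (ENNReal.ofReal y) ^ 2 := fun y hy =>
    ENNReal.ofReal_pow hy 2
  rw [← ofReal_norm, ← key _ (norm_nonneg _), ← h2.tsum_eq,
    ENNReal.ofReal_tsum_of_nonneg (fun i => by positivity) h2.summable]
  refine tsum_congr fun i => ?_
  rw [key _ (norm_nonneg _), ofReal_norm]

theorem tsum_enorm_sq_eq [CompleteSpace H] {ι κ : Type*} (b : HilbertBasis ι ℂ H) (c : HilbertBasis κ ℂ H)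
    (T : H →L[ℂ] H) :
    ∑' i, ‖T (b i)‖ₑ ^ 2 = ∑' k, ‖ContinuousLinearMap.adjoint T (c k)‖ₑ ^ 2 := by
  simp_rw [enorm_sq_eq_tsum c (T _), enorm_sq_eq_tsum b (ContinuousLinearMap.adjoint T _)]
  rw [ENNReal.tsum_comm]
  refine tsum_congr fun k => tsum_congr fun i => ?_
  rw [ContinuousLinearMap.adjoint_inner_right, ← inner_conj_symm, ← ofReal_norm,
    RCLike.norm_conj, ofReal_norm]

theorem hsNorm_eq [CompleteSpace H] {ι : Type*} (b : HilbertBasis ι ℂ H) (T : H →L[ℂ] H) :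
    hsNorm T = (∑' i, ‖T (b i)‖ₑ ^ 2) ^ (1 / 2 : ℝ) := by
  obtain ⟨c, hc⟩ := (exists_hilbertBasis ℂ H).choose_spec
  rw [hsNorm, tsum_enorm_sq_eq b c T, ← tsum_enorm_sq_eq c c T]
  simp only [hc]

end Operators

/-! ### Schrödinger operators in dimension four -/

/-- The space `ℝ⁴` with its Euclidean norm. -/
abbrev R4 : Type := EuclideanSpace ℝ (Fin 4)

/-- The Hilbert space `L²(ℝ⁴)` of complex valued functions. -/
abbrev L2 : Type := Lp ℂ 2 (volume : Measure R4)

theorem toTemperedDistribution_injective {f g : L2}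
    (h : (f : 𝓢'(R4, ℂ)) = (g : 𝓢'(R4, ℂ))) : f = g := by
  have hk := Lp.ker_toTemperedDistributionCLM_eq_bot (F := ℂ) (μ := (volume : Measure R4)) (p := 2)
  exact LinearMap.ker_eq_bot.1 hk (by simpa using h)

/-- `g = Δψ` in the sense of (tempered) distributions, with `ψ, g ∈ L²`. -/
def IsLaplacian (ψ g : L2) : Prop := (g : 𝓢'(R4, ℂ)) = Δ (ψ : 𝓢'(R4, ℂ))

theorem IsLaplacian.unique {ψ g k : L2} (hg : IsLaplacian ψ g) (hk : IsLaplacian ψ k) : g = k :=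
  toTemperedDistribution_injective (Eq.trans hg (Eq.symm hk))

theorem isLaplacian_iff {ψ g : L2} : IsLaplacian ψ g ↔
    Lp.toTemperedDistributionCLM ℂ (volume : Measure R4) 2 g =
      LineDeriv.laplacianCLM ℂ R4 𝓢'(R4, ℂ)
        (Lp.toTemperedDistributionCLM ℂ (volume : Measure R4) 2 ψ) := by
  rw [TemperedDistribution.laplacianCLM_apply]
  rfl

theorem IsLaplacian.add {ψ χ g k : L2} (hg : IsLaplacian ψ g) (hk : IsLaplacian χ k) :
    IsLaplacian (ψ + χ) (g + k) := by
  rw [isLaplacian_iff] at *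
  rw [map_add, map_add, map_add, hg, hk]

theorem IsLaplacian.smul (c : ℂ) {ψ g : L2} (hg : IsLaplacian ψ g) :
    IsLaplacian (c • ψ) (c • g) := by
  rw [isLaplacian_iff] at *
  rw [map_smul, map_smul, map_smul, hg]

theorem isLaplacian_zero : IsLaplacian 0 0 := by
  rw [isLaplacian_iff, map_zero, map_zero]

/-- `g = vψ` almost everywhere, with `ψ, g ∈ L²`. -/
def IsMul (v : R4 → ℝ) (ψ g : L2) : Prop := ∀ᵐ x, g x = (v x : ℂ) * ψ x

theorem IsMul.unique {v : R4 → ℝ} {ψ g k : L2} (hg : IsMul v ψ g) (hk : IsMul v ψ k) : g = k := by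
  apply Lp.ext
  filter_upwards [hg, hk] with x h1 h2
  rw [h1, h2]

theorem IsMul.add {v : R4 → ℝ} {ψ χ g k : L2} (hg : IsMul v ψ g) (hk : IsMul v χ k) :
    IsMul v (ψ + χ) (g + k) := by
  filter_upwards [hg, hk, Lp.coeFn_add ψ χ, Lp.coeFn_add g k] with x h1 h2 h3 h4
  rw [h3, h4, Pi.add_apply, Pi.add_apply, h1, h2, mul_add]

theorem IsMul.smul {v : R4 → ℝ} (c : ℂ) {ψ g : L2} (hg : IsMul v ψ g) :
    IsMul v (c • ψ) (c • g) := by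
  filter_upwards [hg, Lp.coeFn_smul c ψ, Lp.coeFn_smul c g] with x h1 h2 h3
  rw [h2, h3, Pi.smul_apply, Pi.smul_apply, h1, smul_eq_mul, smul_eq_mul, mul_left_comm]

theorem isMul_zero (v : R4 → ℝ) : IsMul v 0 0 := by
  filter_upwards [Lp.coeFn_zero ℂ 2 (volume : Measure R4)] with x hx
  rw [hx, Pi.zero_apply, mul_zero]

/-- The domain `{ψ ∈ L² | Δψ ∈ L², vψ ∈ L²}`, that is `H²(ℝ⁴) ∩ dom v`. -/
def schrodingerDomain (v : R4 → ℝ) : Submodule ℂ L2 where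
  carrier := {ψ | (∃ g, IsLaplacian ψ g) ∧ ∃ g, IsMul v ψ g}
  add_mem' := by
    rintro ψ χ ⟨⟨g, hg⟩, g', hg'⟩ ⟨⟨k, hk⟩, k', hk'⟩
    exact ⟨⟨_, hg.add hk⟩, _, hg'.add hk'⟩
  zero_mem' := ⟨⟨0, isLaplacian_zero⟩, 0, isMul_zero v⟩
  smul_mem' := by
    rintro c ψ ⟨⟨g, hg⟩, g', hg'⟩
    exact ⟨⟨_, hg.smul c⟩, _, hg'.smul c⟩

/-- The Schrödinger operator `h = -(1 / 2m) Δ + v` in `L²(ℝ⁴)` with domain `H²(ℝ⁴) ∩ dom v`. -/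
def schrodinger (m : ℝ) (v : R4 → ℝ) : L2 →ₗ.[ℂ] L2 where
  domain := schrodingerDomain v
  toFun :=
    { toFun := fun ψ => (-(1 / (2 * m)) : ℂ) • ψ.2.1.choose + ψ.2.2.choose
      map_add' := by
        intro ψ χ
        have e1 := (ψ + χ).2.1.choose_spec.unique (ψ.2.1.choose_spec.add χ.2.1.choose_spec)
        have e2 := (ψ + χ).2.2.choose_spec.unique (ψ.2.2.choose_spec.add χ.2.2.choose_spec)
        rw [e1, e2, smul_add]
        abel
      map_smul' := by
        intro c ψ
        have e1 := (c • ψ).2.1.choose_spec.unique (ψ.2.1.choose_spec.smul c)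
        have e2 := (c • ψ).2.2.choose_spec.unique (ψ.2.2.choose_spec.smul c)
        rw [e1, e2, RingHom.id_apply, smul_add, smul_comm] }

theorem schrodinger_apply {m : ℝ} {v : R4 → ℝ} (ψ : (schrodinger m v).domain) {g k : L2}
    (hg : IsLaplacian ψ g) (hk : IsMul v ψ k) :
    schrodinger m v ψ = (-(1 / (2 * m)) : ℂ) • g + k := by
  rw [hg.unique ψ.2.1.choose_spec, hk.unique ψ.2.2.choose_spec]
  rfl

/-- `h = -(1 / 2m) Δ + v` has a virtual level at the bottom of its spectrum: `h ≥ 0`, and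
`-(1 / 2m) Δ + (1 + ε) v` has discrete spectrum for every `ε > 0`. -/
def HasVirtualLevel (m : ℝ) (v : R4 → ℝ) : Prop :=
  IsNonneg (schrodinger m v) ∧
    ∀ ε : ℝ, 0 < ε → (discreteSpectrum (schrodinger m fun x => (1 + ε) * v x)).Nonempty

/-- `f` belongs to the homogeneous Sobolev space `Ḣ¹(ℝ⁴)`, the completion of `C₀^∞(ℝ⁴)` in the norm
`‖∇f‖`. An element of the completion, a sequence of test functions whose gradients are Cauchy in
`L²`, is identified with its limit in `L^(2d/(d-2)) = L⁴`, which exists by the Sobolev inequality.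
The norm of `fderiv ℝ u x` is `|∇u(x)|`. -/
def MemHomogeneousSobolev (f : R4 → ℝ) : Prop :=
  AEStronglyMeasurable f volume ∧
  ∃ u : ℕ → R4 → ℝ, (∀ n, ContDiff ℝ ∞ (u n) ∧ HasCompactSupport (u n)) ∧
    (∀ ε : ℝ≥0∞, 0 < ε → ∃ N, ∀ j ≥ N, ∀ k ≥ N,
      eLpNorm (fun x => fderiv ℝ (u j) x - fderiv ℝ (u k) x) 2 volume < ε) ∧
    Tendsto (fun n => eLpNorm (fun x => u n x - f x) 4 volume) atTop (𝓝 0)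

/-- `(-(1 / 2m) Δ + v) f = 0` in the distributional sense. -/
def IsZeroSolution (m : ℝ) (v f : R4 → ℝ) : Prop :=
  ∀ η : R4 → ℝ, ContDiff ℝ ∞ η → HasCompactSupport η →
    ∫ x, f x * (-(1 / (2 * m)) * Δ η x + v x * η x) = 0

/-- `0` is a resonance of `h = -(1 / 2m) Δ + v`: `h` has a virtual level, and the corresponding
positive solution `f ∈ Ḣ¹` of `h f = 0` (the resonance state) is not square integrable. -/
def HasResonance (m : ℝ) (v : R4 → ℝ) : Prop :=
  HasVirtualLevel m v ∧
    ∃ f : R4 → ℝ, MemHomogeneousSobolev f ∧ (∀ᵐ x, 0 < f x) ∧ IsZeroSolution m v f ∧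
      ¬ MemLp f 2 volume

open Classical in
/-- Multiplication by a (measurable and essentially bounded) function `g`, as an operator
in `L²(ℝ⁴)`. -/
def mulOp (g : R4 → ℝ) : L2 →L[ℂ] L2 :=
  if h : MemLp (fun x => (g x : ℂ)) ∞ volume then
    (ContinuousLinearMap.mul ℂ ℂ).holderL volume ∞ 2 2 (h.toLp _)
  else 0

theorem coeFn_mulOp {g : R4 → ℝ} (h : MemLp (fun x => (g x : ℂ)) ∞ volume) (ψ : L2) :
    mulOp g ψ =ᵐ[volume] fun x => (g x : ℂ) * ψ x := by
  rw [mulOp, dif_pos h]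
  have := ContinuousLinearMap.coeFn_holder (r := 2) (ContinuousLinearMap.mul ℂ ℂ) (h.toLp _) ψ
  filter_upwards [this, h.coeFn_toLp] with x h1 h2
  have h3 : ((ContinuousLinearMap.mul ℂ ℂ).holderL volume ∞ 2 2 (h.toLp _) ψ : L2) x =
    ((ContinuousLinearMap.mul ℂ ℂ).holder 2 (h.toLp _) ψ : L2) x := rfl
  rw [h3, h1, h2]
  rfl

/-- The operator `|v|^(1/2) T |v|^(1/2)`. -/
def sandwich (v : R4 → ℝ) (T : L2 →L[ℂ] L2) : L2 →L[ℂ] L2 :=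
  mulOp (fun x => √|v x|) ∘L T ∘L mulOp (fun x => √|v x|)

/-- The operator `w(z) = I + |v|^(1/2) r(z) |v|^(1/2)`, where `r(z) = (h - z)⁻¹` is the resolvent
of `h = -(1 / 2m) Δ + v`. -/
def wOp (m : ℝ) (v : R4 → ℝ) (z : ℝ) : L2 →L[ℂ] L2 :=
  ContinuousLinearMap.id ℂ L2 + sandwich v (resolvent (schrodinger m v) (z : ℂ))

/-- `T` is the integral operator in `L²(ℝ⁴)` with kernel `K`. -/
def IsIntegralOperator (K : R4 → R4 → ℝ) (T : L2 →L[ℂ] L2) : Prop :=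
  ∀ ψ : L2, ∀ᵐ x, Integrable (fun y => (K x y : ℂ) * ψ y) volume ∧
    T ψ x = ∫ y, (K x y : ℂ) * ψ y

/-- The kernel `(m / 2π²) |v(x)|^(1/2) |v(y)|^(1/2) / |x - y|²`. -/
def kernelG (m : ℝ) (v : R4 → ℝ) (x y : R4) : ℝ :=
  m / (2 * Real.pi ^ 2) * (√|v x| * √|v y| / ‖x - y‖ ^ 2)

end TwoBody

end

noncomputable section

namespace TwoBody

open Set

/-! ### The profile of the Green function -/

/-! Put `s = |v|^(1/2)` and `κ = -2mz`, so that `h = h₀ - s²`. By the Birman–Schwinger identity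
`w(z)` is the inverse of `1 - s r₀(z) s`, and both claims reduce to the behaviour of `s r₀(z) s` as
`z → 0⁻`.

The kernel of `r₀(z)` is `2m` times the Green function of `κ - Δ`, which in dimension four is
`M(κ|x|²/4) / (4π²|x|²)` with `M = macdonald 0`. Since `s M'' = M`, integrating twice gives `M(σ) =
1 + σ ln σ + cσ + O(σ^(1+θ))` for all `σ ≥ 0` (`exists_macdonald_expansion`). The four terms become
the kernel of `G`, the coefficients of `z ln|z|` and `z`, and a remainder kernel bounded by
`|z|^(1+θ) |x - y|^(2θ)`. As `s` decays faster than `|x|⁻²`, a small `θ` leaves this remainder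
Hilbert–Schmidt (`IsWeight.exists_expansion`).

For the second claim, a positive zero-energy solution `f` satisfies `f = (m/2π²) |·|⁻² ∗ (s² f)`:
write `(κ - Δ) f = (κ + 2m s²) f`, invert, and let `κ → 0` (`IsZeroSolution.ae_eq_riesz`). Hence `s
f` is a positive eigenfunction of `G`, and a Perron–Frobenius argument makes the eigenvalue `1`
simple (`exists_eigenfunction`). The coefficient `G₂` of `z ln|z|` is a multiple of `⟨·, s⟩ s`, and
the normalization of `φ` makes `⟨φ, G₂φ⟩ = -1`.

With `τ = ⟨φ, G₁φ⟩` and `l = z(ln|z| - τ)`, one has `z G₁ + z ln|z| G₂ = l G₂ + z(G₁ + τG₂)`, where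
the last operator has no `φφ` matrix element. To leading order `1 - s r₀(z) s` therefore acts on `φ`
as the number `l`. An explicit approximate inverse with leading term `l⁻¹ ⟨·, φ⟩ φ` and a Neumann
series give the inverse with an error `O(l^(-1+θ))` (`exists_inverse_expansion`). -/

/-- The integral `∫₀^∞ exp (-u - s / u) u^(-j) du`, a Macdonald function of `2√s` up to a power
of `s`. -/
def macdonald (j : ℕ) (s : ℝ) : ℝ := ∫ u in Ioi (0 : ℝ), Real.exp (-u - s / u) / u ^ j

theorem measurable_macdonald_integrand (j : ℕ) (s : ℝ) :
    Measurable fun u : ℝ => Real.exp (-u - s / u) / u ^ j := by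
  fun_prop

theorem integrableOn_macdonald_zero {s : ℝ} (hs : 0 ≤ s) :
    IntegrableOn (fun u : ℝ => Real.exp (-u - s / u) / u ^ 0) (Ioi 0) := by
  refine (integrableOn_exp_neg_Ioi 0).mono' (measurable_macdonald_integrand 0 s).aestronglyMeasurable ?_
  refine (ae_restrict_iff' measurableSet_Ioi).2 (ae_of_all _ fun u hu => ?_)
  have hu' : 0 < u := hu
  rw [pow_zero, div_one, Real.norm_of_nonneg (Real.exp_pos _).le]
  exact Real.exp_le_exp.2 (by have := div_nonneg hs hu'.le; linarith)

/-- From `exp t ≥ t^j / j!` at `t = s / u`: the factor `exp (-s / u)` absorbs the pole `u^(-j)`. -/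
theorem exp_neg_div_pow_le (j : ℕ) {s u : ℝ} (hs : 0 < s) (hu : 0 < u) :
    Real.exp (-u - s / u) / u ^ j ≤ j.factorial / s ^ j * Real.exp (-u) := by
  have h1 := Real.pow_div_factorial_le_exp (s / u) (by positivity) j
  have h2 : Real.exp (-u - s / u) = Real.exp (-u) * (Real.exp (s / u))⁻¹ := by
    rw [← Real.exp_neg, ← Real.exp_add]; ring_nf
  have hf : (0 : ℝ) < j.factorial := by exact_mod_cast j.factorial_pos
  have h3 : (Real.exp (s / u))⁻¹ ≤ ((s / u) ^ j / j.factorial)⁻¹ :=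
    inv_anti₀ (by positivity) h1
  rw [h2, div_le_iff₀ (by positivity)]
  calc Real.exp (-u) * (Real.exp (s / u))⁻¹ ≤ Real.exp (-u) * ((s / u) ^ j / j.factorial)⁻¹ := by
        gcongr
    _ = _ := by rw [div_pow]; field_simp

theorem integrableOn_macdonald (j : ℕ) {s : ℝ} (hs : 0 < s) :
    IntegrableOn (fun u : ℝ => Real.exp (-u - s / u) / u ^ j) (Ioi 0) := by
  refine ((integrableOn_exp_neg_Ioi 0).const_mul (j.factorial / s ^ j)).mono'
    (measurable_macdonald_integrand j s).aestronglyMeasurable ?_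
  refine (ae_restrict_iff' measurableSet_Ioi).2 (ae_of_all _ fun u hu => ?_)
  have hu' : 0 < u := hu
  rw [Real.norm_of_nonneg (by positivity)]
  exact exp_neg_div_pow_le j hs hu

/-- Differentiation under the integral; each derivative costs a factor `-1 / u`. Parameters `t > s /
2` are dominated by the integrand at `s / 2`. -/
theorem hasDerivAt_macdonald (j : ℕ) {s : ℝ} (hs : 0 < s) :
    HasDerivAt (macdonald j) (-macdonald (j + 1) s) s := by
  have key := hasDerivAt_integral_of_dominated_loc_of_deriv_le
    (μ := volume.restrict (Ioi (0 : ℝ))) (s := Ioi (s / 2)) (x₀ := s)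
    (F := fun s u => Real.exp (-u - s / u) / u ^ j)
    (F' := fun s u => -(Real.exp (-u - s / u) / u ^ (j + 1)))
    (bound := fun u => Real.exp (-u - (s / 2) / u) / u ^ (j + 1))
    (Ioi_mem_nhds (by linarith))
    (Eventually.of_forall fun s => (measurable_macdonald_integrand j s).aestronglyMeasurable)
    (integrableOn_macdonald j hs)
    (measurable_macdonald_integrand (j + 1) s).neg.aestronglyMeasurable
    ?_ (integrableOn_macdonald (j + 1) (by linarith)) ?_
  · have := key.2
    rw [integral_neg] at this
    exact this
  · refine (ae_restrict_iff' measurableSet_Ioi).2 (ae_of_all _ fun u hu t ht => ?_)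
    have hu' : 0 < u := hu
    have ht' : s / 2 < t := ht
    rw [norm_neg, Real.norm_of_nonneg (by positivity)]
    gcongr
  · refine (ae_restrict_iff' measurableSet_Ioi).2 (ae_of_all _ fun u hu t ht => ?_)
    have hu' : 0 < u := hu
    have h1 : HasDerivAt (fun t : ℝ => -u - t / u) (-(1 / u)) t := by
      simpa using ((hasDerivAt_id t).div_const u).const_sub (-u)
    refine (h1.exp.div_const (u ^ j)).congr_deriv ?_
    rw [pow_succ]
    field_simp

theorem macdonald_zero_zero : macdonald 0 0 = 1 := by
  simpa only [macdonald, zero_div, sub_zero, pow_zero, div_one] using integral_exp_neg_Ioi_zero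

theorem macdonald_nonneg (j : ℕ) (s : ℝ) : 0 ≤ macdonald j s := by
  refine setIntegral_nonneg measurableSet_Ioi fun u hu => ?_
  have : (0 : ℝ) < u := hu
  positivity

theorem macdonald_zero_le_one {s : ℝ} (hs : 0 ≤ s) : macdonald 0 s ≤ 1 := by
  rw [← macdonald_zero_zero]
  refine setIntegral_mono_on (integrableOn_macdonald_zero hs) (integrableOn_macdonald_zero le_rfl)
    measurableSet_Ioi fun u hu => ?_
  have hu' : (0 : ℝ) < u := hu
  simp only [pow_zero, div_one, zero_div, sub_zero]
  exact Real.exp_le_exp.2 (by have := div_nonneg hs hu'.le; linarith)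

theorem integral_mul_exp_neg : ∫ u in Ioi (0 : ℝ), Real.exp (-u) * u = 1 := by
  have := Real.Gamma_eq_integral (s := 2) (by norm_num)
  rw [Real.Gamma_two] at this
  rw [this]
  refine setIntegral_congr_fun measurableSet_Ioi fun u _ => ?_
  norm_num

theorem integrableOn_mul_exp_neg : IntegrableOn (fun u : ℝ => Real.exp (-u) * u) (Ioi 0) := by
  have := Real.GammaIntegral_convergent (s := 2) (by norm_num)
  refine this.congr_fun (fun u _ => ?_) measurableSet_Ioi
  norm_num

theorem macdonald_zero_le_inv {s : ℝ} (hs : 0 < s) : macdonald 0 s ≤ 1 / s := by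
  have : (1 : ℝ) / s = ∫ u in Ioi (0 : ℝ), (1 / s) * (Real.exp (-u) * u) := by
    rw [integral_const_mul, integral_mul_exp_neg, mul_one]
  rw [this]
  refine setIntegral_mono_on (integrableOn_macdonald_zero hs.le)
    (integrableOn_mul_exp_neg.const_mul _) measurableSet_Ioi fun u hu => ?_
  have hu' : (0 : ℝ) < u := hu
  have h := exp_neg_div_pow_le 1 hs hu'
  rw [div_le_iff₀ (by positivity)] at h
  rw [pow_zero, div_one]
  refine h.trans (le_of_eq ?_)
  simp
  ring

/-- The substitution `u ↦ s / u`, done as a scaling followed by an inversion, exchanges the two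
terms of the exponent. With `hasDerivAt_macdonald` it is the Bessel-type equation `s M'' = M` for `M
= macdonald 0`. -/
theorem macdonald_zero_eq {s : ℝ} (hs : 0 < s) : macdonald 0 s = s * macdonald 2 s := by
  have h1 := integral_comp_mul_left_Ioi (fun u : ℝ => Real.exp (-u - s / u) / u ^ 0) 0 hs
  have h2 := integral_comp_rpow_Ioi (fun y : ℝ => Real.exp (-(s * y) - s / (s * y)) / (s * y) ^ 0)
    (p := -1) (by norm_num)
  rw [h1, mul_zero, smul_eq_mul] at h2
  have h3 : macdonald 2 s = s⁻¹ * macdonald 0 s := by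
    rw [macdonald, macdonald, ← h2]
    refine setIntegral_congr_fun measurableSet_Ioi fun u hu => ?_
    have hu' : (0 : ℝ) < u := hu
    have e1 : u ^ (-1 : ℝ) = u⁻¹ := Real.rpow_neg_one u
    have e2 : u ^ (-1 - 1 : ℝ) = (u ^ 2)⁻¹ := by
      rw [show (-1 - 1 : ℝ) = -((2 : ℕ) : ℝ) by norm_num, Real.rpow_neg hu'.le, Real.rpow_natCast]
    simp only [e1, e2, smul_eq_mul, pow_zero, div_one, abs_neg, abs_one, one_mul]
    rw [div_eq_inv_mul]
    congr 2
    field_simp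
    ring
  rw [h3]
  field_simp

/-- Both sides are separated by `min x 1`. -/
theorem one_sub_exp_neg_le_rpow {x θ : ℝ} (hx : 0 ≤ x) (h0 : 0 < θ) (h1 : θ < 1) :
    1 - Real.exp (-x) ≤ x ^ θ := by
  rcases le_total x 1 with h | h
  · have := Real.add_one_le_exp (-x)
    have h2 := Real.rpow_le_rpow_of_exponent_ge' hx h h0.le h1.le
    rw [Real.rpow_one] at h2
    linarith
  · have := Real.exp_pos (-x)
    have h2 := Real.one_le_rpow h h0.le
    linarith

/-- The previous bound at `x = s / u` under the integral. The constant `∫ exp (-u) u^(-θ) du`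
diverges at `θ = 1`, a trace of the logarithm in the expansion. -/
theorem one_sub_macdonald_zero_le {s θ : ℝ} (hs : 0 ≤ s) (h0 : 0 < θ) (h1 : θ < 1) :
    1 - macdonald 0 s ≤ Real.Gamma (1 - θ) * s ^ θ := by
  have e : 1 - macdonald 0 s = macdonald 0 0 - macdonald 0 s := by rw [macdonald_zero_zero]
  rw [e, macdonald, macdonald,
    ← integral_sub (integrableOn_macdonald_zero le_rfl) (integrableOn_macdonald_zero hs),
    Real.Gamma_eq_integral (by linarith), ← integral_mul_const]
  refine setIntegral_mono_on ((integrableOn_macdonald_zero le_rfl).sub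
    (integrableOn_macdonald_zero hs)) ?_ measurableSet_Ioi fun u hu => ?_
  · exact (Real.GammaIntegral_convergent (by linarith)).mul_const _
  · have hu' : (0 : ℝ) < u := hu
    have h := one_sub_exp_neg_le_rpow (x := s / u) (by positivity) h0 h1
    simp only [pow_zero, div_one, zero_div, sub_zero]
    rw [sub_eq_add_neg (-u), Real.exp_add, ← mul_one_sub, mul_assoc]
    refine mul_le_mul_of_nonneg_left (h.trans (le_of_eq ?_)) (Real.exp_pos _).le
    rw [Real.div_rpow hs hu'.le, show (1 - θ - 1 : ℝ) = -θ by ring, Real.rpow_neg hu'.le]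
    field_simp

theorem continuousWithinAt_macdonald_zero : ContinuousWithinAt (macdonald 0) (Ici 0) 0 := by
  rw [ContinuousWithinAt, macdonald_zero_zero]
  refine tendsto_of_tendsto_of_tendsto_of_le_of_le' (g := fun s => 1 - Real.Gamma (1 - 1 / 2) *
    s ^ (1 / 2 : ℝ)) (h := fun _ => 1) ?_ tendsto_const_nhds ?_ ?_
  · have : Continuous fun s : ℝ => 1 - Real.Gamma (1 - 1 / 2) * s ^ (1 / 2 : ℝ) :=
      continuous_const.sub (continuous_const.mul (Real.continuous_rpow_const (by norm_num)))
    have := this.tendsto 0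
    rw [Real.zero_rpow (by norm_num), mul_zero, sub_zero] at this
    exact this.mono_left nhdsWithin_le_nhds
  · filter_upwards [self_mem_nhdsWithin] with s hs
    have := one_sub_macdonald_zero_le (θ := 1 / 2) (s := s) hs (by norm_num) (by norm_num)
    linarith
  · filter_upwards [self_mem_nhdsWithin] with s hs using macdonald_zero_le_one hs

/-- The expansion of `2√s K₁(2√s)` at `s = 0`, with a remainder controlled for all `s`. -/
theorem exists_macdonald_expansion {θ : ℝ} (h0 : 0 < θ) (h1 : θ < 1) :
    ∃ c C : ℝ, 0 ≤ C ∧ ∀ s, 0 ≤ s →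
      |macdonald 0 s - 1 - s * Real.log s - c * s| ≤ C * s ^ (1 + θ) := by
  set Γ := Real.Gamma (1 - θ) with hΓ
  have hΓ0 : 0 < Γ := Real.Gamma_pos_of_pos (by linarith)
  -- `h + 1 = M' - ln s` up to the constant already subtracted twice: `h` is the derivative of `M(s)
  -- - 1 - s ln s`, and the equation `s M'' = M` turns its own derivative into `(M - 1) / s`, which
  -- lies between `-Γ s^(θ-1)` and `0`.
  set h : ℝ → ℝ := fun s => -macdonald 1 s - Real.log s - 1 with hh
  have dh : ∀ s, 0 < s → HasDerivAt h ((macdonald 0 s - 1) / s) s := by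
    intro s hs
    refine (((hasDerivAt_macdonald 1 hs).neg.sub (Real.hasDerivAt_log hs.ne')).sub_const
      1).congr_deriv ?_
    rw [macdonald_zero_eq hs]
    field_simp
  have dpow : ∀ a s : ℝ, 0 < s → HasDerivAt (fun s : ℝ => s ^ a) (a * s ^ (a - 1)) s :=
    fun a s hs => Real.hasDerivAt_rpow_const (Or.inl hs.ne')
  have anti : AntitoneOn h (Ioi 0) := by
    refine antitoneOn_of_deriv_nonpos (convex_Ioi 0)
      (fun s hs => (dh s hs).continuousAt.continuousWithinAt) ?_ ?_
    · rw [interior_Ioi]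
      exact fun s hs => (dh s hs).differentiableAt.differentiableWithinAt
    · rw [interior_Ioi]
      intro s hs
      rw [(dh s hs).deriv]
      have hs' : (0 : ℝ) < s := hs
      exact div_nonpos_of_nonpos_of_nonneg (by linarith [macdonald_zero_le_one hs'.le]) hs'.le
  have mono : MonotoneOn (fun s => h s + Γ / θ * s ^ θ) (Ioi 0) := by
    have d : ∀ s, 0 < s → HasDerivAt (fun s => h s + Γ / θ * s ^ θ)
        ((macdonald 0 s - 1) / s + Γ / θ * (θ * s ^ (θ - 1))) s :=
      fun s hs => (dh s hs).add ((dpow θ s hs).const_mul _)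
    refine monotoneOn_of_deriv_nonneg (convex_Ioi 0)
      (fun s hs => (d s hs).continuousAt.continuousWithinAt) ?_ ?_
    · rw [interior_Ioi]
      exact fun s hs => (d s hs).differentiableAt.differentiableWithinAt
    · rw [interior_Ioi]
      intro s hs
      have hs' : (0 : ℝ) < s := hs
      rw [(d s hs).deriv]
      have e : (macdonald 0 s - 1) / s + Γ / θ * (θ * s ^ (θ - 1)) =
          (Γ * s ^ θ - (1 - macdonald 0 s)) / s := by
        rw [Real.rpow_sub_one hs'.ne']
        field_simp
        ring
      rw [e]
      exact div_nonneg (by linarith [one_sub_macdonald_zero_le hs'.le h0 h1]) hs'.le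
  have bd : ∀ a b, 0 < a → 0 < b → h a ≤ h b + Γ / θ * b ^ θ := by
    intro a b ha hb
    rcases le_total a b with hab | hab
    · have := mono ha hb hab
      have h2 : 0 ≤ Γ / θ * a ^ θ := by positivity
      simp only at this
      linarith
    · have := anti hb ha hab
      have h2 : 0 ≤ Γ / θ * b ^ θ := by positivity
      linarith
  -- As `h` decreases, its supremum is its limit at `0⁺`. The rate of convergence comes from `bd`;
  -- the numerical value of `c` plays no role.
  set c := sSup (h '' Ioi 0) with hc
  have hbdd : BddAbove (h '' Ioi 0) := by
    refine ⟨h 1 + Γ / θ * 1 ^ θ, ?_⟩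
    rintro _ ⟨a, ha, rfl⟩
    exact bd a 1 ha one_pos
  have c1 : ∀ s, 0 < s → h s ≤ c := fun s hs => le_csSup hbdd ⟨s, hs, rfl⟩
  have c2 : ∀ s, 0 < s → c ≤ h s + Γ / θ * s ^ θ := by
    intro s hs
    refine csSup_le ⟨h 1, 1, mem_Ioi.2 one_pos, rfl⟩ ?_
    rintro _ ⟨a, ha, rfl⟩
    exact bd a s ha hs
  -- The second integration: `k' = h - c` lies between `-(Γ/θ) s^θ` and `0`, and `k 0 = 0`.
  set k : ℝ → ℝ := fun s => macdonald 0 s - 1 - s * Real.log s - c * s with hk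
  have dk : ∀ s, 0 < s → HasDerivAt k (h s - c) s := by
    intro s hs
    refine ((((hasDerivAt_macdonald 0 hs).sub_const 1).sub
      (Real.hasDerivAt_mul_log hs.ne')).sub ((hasDerivAt_id s).const_mul c)).congr_deriv ?_
    simp only [hh]
    ring
  have kcont : ContinuousOn k (Ici 0) := by
    intro s hs
    rcases eq_or_lt_of_le (show (0 : ℝ) ≤ s from hs) with h | h
    · subst h
      refine ((continuousWithinAt_macdonald_zero.sub continuousWithinAt_const).sub ?_).sub ?_
      · exact Real.continuous_mul_log.continuousWithinAt
      · fun_prop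
    · exact (dk s h).continuousAt.continuousWithinAt
  have k0 : k 0 = 0 := by simp [hk, macdonald_zero_zero]
  have kanti : AntitoneOn k (Ici 0) := by
    refine antitoneOn_of_deriv_nonpos (convex_Ici 0) kcont ?_ ?_
    · rw [interior_Ici]
      exact fun s hs => (dk s hs).differentiableAt.differentiableWithinAt
    · rw [interior_Ici]
      intro s hs
      rw [(dk s hs).deriv]
      linarith [c1 s hs]
  set D := Γ / θ / (1 + θ) with hD
  have kmono : MonotoneOn (fun s => k s + D * s ^ (1 + θ)) (Ici 0) := by
    have d : ∀ s, 0 < s → HasDerivAt (fun s => k s + D * s ^ (1 + θ))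
        (h s - c + D * ((1 + θ) * s ^ (1 + θ - 1))) s :=
      fun s hs => (dk s hs).add ((dpow (1 + θ) s hs).const_mul _)
    refine monotoneOn_of_deriv_nonneg (convex_Ici 0) (kcont.add ?_) ?_ ?_
    · exact (continuous_const.mul (Real.continuous_rpow_const (by linarith))).continuousOn
    · rw [interior_Ici]
      exact fun s hs => (d s hs).differentiableAt.differentiableWithinAt
    · rw [interior_Ici]
      intro s hs
      have hs' : (0 : ℝ) < s := hs
      rw [(d s hs).deriv]
      have e : D * ((1 + θ) * s ^ (1 + θ - 1)) = Γ / θ * s ^ θ := by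
        rw [hD, show 1 + θ - 1 = θ by ring]
        field_simp
      rw [e]
      linarith [c2 s hs']
  refine ⟨c, D, by positivity, fun s hs => abs_le.2 ⟨?_, ?_⟩⟩
  · have := kmono (mem_Ici.2 le_rfl) hs hs
    simp only [k0, Real.zero_rpow (show 1 + θ ≠ 0 by linarith), mul_zero, add_zero] at this
    linarith
  · have := kanti (mem_Ici.2 le_rfl) hs hs
    rw [k0] at this
    exact this.trans (by positivity)

end TwoBody

end

noncomputable section

namespace TwoBody

/-! ### Integral operators -/

theorem enorm_ofReal (r : ℝ) : ‖(r : ℂ)‖ₑ = ‖r‖ₑ := by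
  rw [← ofReal_norm, ← ofReal_norm, Complex.norm_real]

theorem L2_enorm_sq (ψ : L2) : ‖ψ‖ₑ ^ 2 = ∫⁻ x, ‖ψ x‖ₑ ^ 2 := by
  rw [Lp.enorm_def, eLpNorm_eq_lintegral_rpow_enorm_toReal (by norm_num) (by norm_num), ← ENNReal.rpow_natCast,
    ← ENNReal.rpow_mul]
  simp

theorem memLp_two_iff {f : R4 → ℂ} (hf : AEStronglyMeasurable f volume) :
    MemLp f 2 volume ↔ ∫⁻ x, ‖f x‖ₑ ^ 2 < ⊤ := by
  rw [MemLp, eLpNorm_lt_top_iff_lintegral_rpow_enorm_lt_top (by norm_num) (by norm_num)]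
  simp [hf]

theorem L2_lintegral_sq_lt_top (ψ : L2) : ∫⁻ x, ‖ψ x‖ₑ ^ 2 < ⊤ := by
  rw [← L2_enorm_sq]
  exact ENNReal.pow_lt_top enorm_lt_top

theorem L2_aemeasurable_enorm (ψ : L2) : AEMeasurable (fun x => ‖ψ x‖ₑ) volume :=
  (Lp.aestronglyMeasurable ψ).enorm

/-- Cauchy–Schwarz for the Lebesgue integral. -/
theorem lintegral_mul_sq_le {α : Type*} [MeasurableSpace α] {μ : Measure α} {f g : α → ℝ≥0∞}
    (hf : AEMeasurable f μ) (hg : AEMeasurable g μ) :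
    (∫⁻ x, f x * g x ∂μ) ^ 2 ≤ (∫⁻ x, f x ^ 2 ∂μ) * ∫⁻ x, g x ^ 2 ∂μ := by
  have h := ENNReal.lintegral_mul_le_Lp_mul_Lq μ Real.HolderConjugate.two_two hf hg
  have h2 := pow_le_pow_left' h 2
  refine h2.trans (le_of_eq ?_)
  rw [mul_pow, ← ENNReal.rpow_natCast, ← ENNReal.rpow_natCast, ← ENNReal.rpow_mul,
    ← ENNReal.rpow_mul]
  simp

/-- The operator with kernel `|K|` is bounded by `M` in `L²`. -/
def AbsBounded (K : R4 → R4 → ℝ) (M : ℝ≥0∞) : Prop :=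
  ∀ f : R4 → ℝ≥0∞, AEMeasurable f volume →
    ∫⁻ x, (∫⁻ y, ‖K x y‖ₑ * f y) ^ 2 ≤ M ^ 2 * ∫⁻ y, f y ^ 2

/-- The Schur test with a weight. -/
theorem AbsBounded.of_schur {K : R4 → R4 → ℝ} (hK : Measurable (Function.uncurry K))
    (hsymm : ∀ x y, K x y = K y x) {p : R4 → ℝ≥0∞} (hp : Measurable p) (hp0 : ∀ x, p x ≠ 0)
    (hp1 : ∀ x, p x ≠ ⊤) {M : ℝ≥0∞} (hM : ∀ x, ∫⁻ y, ‖K x y‖ₑ * p y ≤ M * p x) :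
    AbsBounded K M := by
  intro f hf
  have hKe : Measurable fun q : R4 × R4 => ‖K q.1 q.2‖ₑ := hK.enorm
  have hKx : ∀ x, Measurable fun y => ‖K x y‖ₑ := fun x => hKe.comp measurable_prodMk_left
  have hKy : ∀ y, Measurable fun x => ‖K x y‖ₑ := fun y => hKe.comp measurable_prodMk_right
  have h1 : ∀ x, (∫⁻ y, ‖K x y‖ₑ * f y) ^ 2 ≤
      M * p x * ∫⁻ y, ‖K x y‖ₑ * (f y ^ 2 / p y) := by
    intro x
    -- The splitting `K f = √(K p) · √(K f² / p)` prepares Cauchy–Schwarz; the first factor is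
    -- controlled by `hM`. After Tonelli, symmetry of `K` lets `hM` be used a second time.
    have e : ∀ y, ‖K x y‖ₑ * f y = (‖K x y‖ₑ * p y) ^ (1 / 2 : ℝ) *
        (‖K x y‖ₑ * (f y ^ 2 / p y)) ^ (1 / 2 : ℝ) := by
      intro y
      rw [← ENNReal.mul_rpow_of_nonneg _ _ (by norm_num)]
      have : ‖K x y‖ₑ * p y * (‖K x y‖ₑ * (f y ^ 2 / p y)) = (‖K x y‖ₑ * f y) ^ (2 : ℝ) := by
        rw [ENNReal.rpow_ofNat, mul_pow]
        calc _ = ‖K x y‖ₑ ^ 2 * (p y * (f y ^ 2 / p y)) := by ring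
          _ = _ := by rw [ENNReal.mul_div_cancel (hp0 y) (hp1 y)]
      rw [this, ← ENNReal.rpow_mul]
      norm_num
    simp_rw [e]
    refine (lintegral_mul_sq_le ?_ ?_).trans ?_
    · exact ((hKx x).mul hp).aemeasurable.pow_const _
    · exact ((hKx x).aemeasurable.mul ((hf.pow_const 2).div hp.aemeasurable)).pow_const _
    · have e2 : ∀ a : ℝ≥0∞, (a ^ (1 / 2 : ℝ)) ^ 2 = a := by
        intro a
        rw [← ENNReal.rpow_ofNat, ← ENNReal.rpow_mul]
        norm_num
      simp_rw [e2]
      gcongr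
      exact hM x
  calc ∫⁻ x, (∫⁻ y, ‖K x y‖ₑ * f y) ^ 2
      ≤ ∫⁻ x, ∫⁻ y, M * p x * (‖K x y‖ₑ * (f y ^ 2 / p y)) := by
        refine lintegral_mono fun x => (h1 x).trans (le_of_eq ?_)
        rw [lintegral_const_mul'']
        exact (hKx x).aemeasurable.mul ((hf.pow_const 2).div hp.aemeasurable)
    _ = ∫⁻ y, ∫⁻ x, M * p x * (‖K x y‖ₑ * (f y ^ 2 / p y)) := by
        refine lintegral_lintegral_swap ?_
        refine ((measurable_const.mul (hp.comp measurable_fst)).aemeasurable).mul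
          (hKe.aemeasurable.mul ?_)
        exact ((hf.comp_quasiMeasurePreserving Measure.quasiMeasurePreserving_snd).pow_const 2).div
          (hp.comp measurable_snd).aemeasurable
    _ ≤ ∫⁻ y, M ^ 2 * f y ^ 2 := by
        refine lintegral_mono fun y => ?_
        have e : ∀ x, M * p x * (‖K x y‖ₑ * (f y ^ 2 / p y)) =
            (M * (f y ^ 2 / p y)) * (‖K y x‖ₑ * p x) := by
          intro x; rw [hsymm x y]; ring
        simp_rw [e]
        rw [lintegral_const_mul (M * (f y ^ 2 / p y)) (f := fun x => ‖K y x‖ₑ * p x) ((hKx y).mul hp)]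
        calc _ ≤ M * (f y ^ 2 / p y) * (M * p y) := by gcongr; exact hM y
          _ = M ^ 2 * (p y * (f y ^ 2 / p y)) := by ring
          _ = _ := by rw [ENNReal.mul_div_cancel (hp0 y) (hp1 y)]
    _ = _ := lintegral_const_mul'' _ (hf.pow_const 2)

theorem AbsBounded.of_sq {K : R4 → R4 → ℝ} (hK : Measurable (Function.uncurry K)) {M : ℝ≥0∞}
    (hM : ∫⁻ x, ∫⁻ y, ‖K x y‖ₑ ^ 2 ≤ M ^ 2) : AbsBounded K M := by
  intro f hf
  have hKe : Measurable fun q : R4 × R4 => ‖K q.1 q.2‖ₑ := hK.enorm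
  have hKx : ∀ x, Measurable fun y => ‖K x y‖ₑ := fun x => hKe.comp measurable_prodMk_left
  calc ∫⁻ x, (∫⁻ y, ‖K x y‖ₑ * f y) ^ 2
      ≤ ∫⁻ x, (∫⁻ y, ‖K x y‖ₑ ^ 2) * ∫⁻ y, f y ^ 2 :=
        lintegral_mono fun x => lintegral_mul_sq_le (hKx x).aemeasurable hf
    _ = (∫⁻ x, ∫⁻ y, ‖K x y‖ₑ ^ 2) * ∫⁻ y, f y ^ 2 :=
        lintegral_mul_const _ (hKe.pow_const 2).lintegral_prod_right'
    _ ≤ _ := by gcongr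

/-! ### Operators given by kernels that are bounded in absolute value -/

section Kernel

variable {K : R4 → R4 → ℝ} {M : ℝ≥0∞}

theorem AbsBounded.ae_lintegral_lt_top (hK : Measurable (Function.uncurry K))
    (h : AbsBounded K M) (hM : M ≠ ⊤) (ψ : L2) : ∀ᵐ x, ∫⁻ y, ‖K x y‖ₑ * ‖ψ y‖ₑ < ⊤ := by
  have h1 := h _ (L2_aemeasurable_enorm ψ)
  have h2 : ∫⁻ x, (∫⁻ y, ‖K x y‖ₑ * ‖ψ y‖ₑ) ^ 2 < ⊤ :=
    h1.trans_lt (ENNReal.mul_lt_top (ENNReal.pow_lt_top hM.lt_top) (L2_lintegral_sq_lt_top ψ))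
  have hm : AEMeasurable (fun x => ∫⁻ y, ‖K x y‖ₑ * ‖ψ y‖ₑ) volume := by
    refine AEMeasurable.lintegral_prod_right' (f := fun q : R4 × R4 => ‖K q.1 q.2‖ₑ * ‖ψ q.2‖ₑ) ?_
    exact hK.enorm.aemeasurable.mul ((L2_aemeasurable_enorm ψ).comp_quasiMeasurePreserving
      Measure.quasiMeasurePreserving_snd)
  filter_upwards [ae_lt_top' (hm.pow_const 2) h2.ne] with x hx
  by_contra h3
  rw [not_lt, top_le_iff] at h3
  rw [h3] at hx
  simp at hx

theorem AbsBounded.ae_integrable (hK : Measurable (Function.uncurry K))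
    (h : AbsBounded K M) (hM : M ≠ ⊤) (ψ : L2) :
    ∀ᵐ x, Integrable (fun y => (K x y : ℂ) * ψ y) volume := by
  filter_upwards [h.ae_lintegral_lt_top hK hM ψ] with x hx
  refine ⟨?_, ?_⟩
  · exact (Complex.measurable_ofReal.comp
      (hK.comp measurable_prodMk_left)).aestronglyMeasurable.mul (Lp.aestronglyMeasurable ψ)
  · rw [HasFiniteIntegral]
    simpa only [enorm_mul, enorm_ofReal] using hx

theorem aestronglyMeasurable_kernel_integral (hK : Measurable (Function.uncurry K)) (ψ : L2) :
    AEStronglyMeasurable (fun x => ∫ y, (K x y : ℂ) * ψ y) volume := by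
  refine AEStronglyMeasurable.integral_prod_right' (f := fun q : R4 × R4 => (K q.1 q.2 : ℂ) * ψ q.2) ?_
  exact (Complex.measurable_ofReal.comp hK).aestronglyMeasurable.mul
    ((Lp.aestronglyMeasurable ψ).comp_quasiMeasurePreserving Measure.quasiMeasurePreserving_snd)

theorem AbsBounded.lintegral_integral_sq_le (h : AbsBounded K M) (ψ : L2) :
    ∫⁻ x, ‖∫ y, (K x y : ℂ) * ψ y‖ₑ ^ 2 ≤ M ^ 2 * ‖ψ‖ₑ ^ 2 := by
  rw [L2_enorm_sq]
  refine le_trans ?_ (h _ (L2_aemeasurable_enorm ψ))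
  refine lintegral_mono fun x => pow_le_pow_left' ?_ 2
  refine (enorm_integral_le_lintegral_enorm _).trans (le_of_eq ?_)
  simp only [enorm_mul, enorm_ofReal]

theorem IsIntegralOperator.enorm_apply_le (h : AbsBounded K M) {T : L2 →L[ℂ] L2}
    (hT : IsIntegralOperator K T) (ψ : L2) : ‖T ψ‖ₑ ≤ M * ‖ψ‖ₑ := by
  have h1 : ‖T ψ‖ₑ ^ 2 ≤ (M * ‖ψ‖ₑ) ^ 2 := by
    rw [L2_enorm_sq, mul_pow]
    refine le_trans (le_of_eq ?_) (h.lintegral_integral_sq_le ψ)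
    refine lintegral_congr_ae ?_
    filter_upwards [hT ψ] with x hx
    rw [hx.2]
  exact (ENNReal.pow_le_pow_left_iff (by norm_num)).1 h1

theorem IsIntegralOperator.norm_le {M : ℝ} (hM : 0 ≤ M) (h : AbsBounded K (ENNReal.ofReal M))
    {T : L2 →L[ℂ] L2} (hT : IsIntegralOperator K T) : ‖T‖ ≤ M := by
  refine T.opNorm_le_bound hM fun ψ => ?_
  have := hT.enorm_apply_le h ψ
  rw [← ofReal_norm, ← ofReal_norm, ← ENNReal.ofReal_mul hM] at this
  exact (ENNReal.ofReal_le_ofReal_iff (by positivity)).1 this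

theorem AbsBounded.exists_isIntegralOperator (hK : Measurable (Function.uncurry K))
    (h : AbsBounded K M) (hM : M ≠ ⊤) : ∃ T : L2 →L[ℂ] L2, IsIntegralOperator K T := by
  have hmem : ∀ ψ : L2, MemLp (fun x => ∫ y, (K x y : ℂ) * ψ y) 2 volume := fun ψ =>
    (memLp_two_iff (aestronglyMeasurable_kernel_integral hK ψ)).2
      ((h.lintegral_integral_sq_le ψ).trans_lt
        (ENNReal.mul_lt_top (ENNReal.pow_lt_top hM.lt_top) (ENNReal.pow_lt_top enorm_lt_top)))
  let T₀ : L2 →ₗ[ℂ] L2 :=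
    { toFun := fun ψ => (hmem ψ).toLp _
      map_add' := by
        intro ψ χ
        apply Lp.ext
        filter_upwards [(hmem (ψ + χ)).coeFn_toLp, Lp.coeFn_add ((hmem ψ).toLp _)
          ((hmem χ).toLp _), (hmem ψ).coeFn_toLp, (hmem χ).coeFn_toLp, h.ae_integrable hK hM ψ,
          h.ae_integrable hK hM χ] with x h1 h2 h3 h4 h5 h6
        rw [h1, h2, Pi.add_apply, h3, h4, ← integral_add h5 h6]
        refine integral_congr_ae ?_
        filter_upwards [Lp.coeFn_add ψ χ] with y hy
        rw [hy, Pi.add_apply, mul_add]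
      map_smul' := by
        intro c ψ
        apply Lp.ext
        filter_upwards [(hmem (c • ψ)).coeFn_toLp, Lp.coeFn_smul c ((hmem ψ).toLp _),
          (hmem ψ).coeFn_toLp] with x h1 h2 h3
        rw [h1, RingHom.id_apply, h2, Pi.smul_apply, h3, smul_eq_mul, ← integral_const_mul]
        refine integral_congr_ae ?_
        filter_upwards [Lp.coeFn_smul c ψ] with y hy
        rw [hy, Pi.smul_apply, smul_eq_mul]
        ring }
  have hbd : ∀ ψ, ‖T₀ ψ‖ ≤ M.toReal * ‖ψ‖ := by
    intro ψ
    have h1 : ‖T₀ ψ‖ₑ ^ 2 ≤ (M * ‖ψ‖ₑ) ^ 2 := by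
      rw [L2_enorm_sq, mul_pow]
      refine le_trans (le_of_eq ?_) (h.lintegral_integral_sq_le ψ)
      refine lintegral_congr_ae ?_
      filter_upwards [(hmem ψ).coeFn_toLp] with x hx
      rw [← hx]
      rfl
    have h2 := (ENNReal.pow_le_pow_left_iff (by norm_num)).1 h1
    have h3 := ENNReal.toReal_mono (ENNReal.mul_ne_top hM enorm_ne_top) h2
    rwa [ENNReal.toReal_mul, toReal_enorm, toReal_enorm] at h3
  refine ⟨T₀.mkContinuous M.toReal hbd, fun ψ => ?_⟩
  filter_upwards [h.ae_integrable hK hM ψ, (hmem ψ).coeFn_toLp] with x h1 h2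
  exact ⟨h1, h2⟩

theorem IsIntegralOperator.congr {K' : R4 → R4 → ℝ} {T : L2 →L[ℂ] L2}
    (hT : IsIntegralOperator K T) (h : ∀ᵐ x, ∀ᵐ y, K x y = K' x y) : IsIntegralOperator K' T := by
  intro ψ
  filter_upwards [hT ψ, h] with x hx hxy
  have e : (fun y => (K x y : ℂ) * ψ y) =ᵐ[volume] fun y => (K' x y : ℂ) * ψ y := by
    filter_upwards [hxy] with y hy
    rw [hy]
  exact ⟨hx.1.congr e, hx.2.trans (integral_congr_ae e)⟩

/-- Operator identities can thus be verified on kernels. -/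
theorem IsIntegralOperator.unique {T T' : L2 →L[ℂ] L2}
    (hT : IsIntegralOperator K T) (hT' : IsIntegralOperator K T') : T = T' := by
  ext1 ψ
  apply Lp.ext
  filter_upwards [hT ψ, hT' ψ] with x h1 h2
  rw [h1.2, h2.2]

theorem IsIntegralOperator.add {K' : R4 → R4 → ℝ} {T T' : L2 →L[ℂ] L2}
    (hT : IsIntegralOperator K T) (hT' : IsIntegralOperator K' T') :
    IsIntegralOperator (fun x y => K x y + K' x y) (T + T') := by
  intro ψ
  filter_upwards [hT ψ, hT' ψ, Lp.coeFn_add (T ψ) (T' ψ)] with x h1 h2 h3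
  have e : (fun y => ((K x y + K' x y : ℝ) : ℂ) * ψ y) =
      fun y => (K x y : ℂ) * ψ y + (K' x y : ℂ) * ψ y := by
    ext y
    push_cast
    ring
  rw [e]
  refine ⟨h1.1.add h2.1, ?_⟩
  rw [integral_add h1.1 h2.1, _root_.add_apply, h3, Pi.add_apply, h1.2, h2.2]

theorem IsIntegralOperator.smul (c : ℝ) {T : L2 →L[ℂ] L2}
    (hT : IsIntegralOperator K T) :
    IsIntegralOperator (fun x y => c * K x y) ((c : ℂ) • T) := by
  intro ψ
  filter_upwards [hT ψ, Lp.coeFn_smul (c : ℂ) (T ψ)] with x h1 h3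
  have e : (fun y => ((c * K x y : ℝ) : ℂ) * ψ y) =
      fun y => (c : ℂ) * ((K x y : ℂ) * ψ y) := by
    ext y
    push_cast
    ring
  rw [e]
  refine ⟨h1.1.const_mul _, ?_⟩
  rw [integral_const_mul, _root_.smul_apply, h3, Pi.smul_apply, h1.2, smul_eq_mul]

theorem AbsBounded.integrable_prod (hK : Measurable (Function.uncurry K)) (h : AbsBounded K M)
    (hM : M ≠ ⊤) {a b : R4 → ℂ} (ha : MemLp a 2 volume) (hb : MemLp b 2 volume) :
    Integrable (fun q : R4 × R4 => (K q.1 q.2 : ℂ) * (a q.1 * b q.2)) (volume.prod volume) := by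
  have hm : AEStronglyMeasurable (fun q : R4 × R4 => (K q.1 q.2 : ℂ) * (a q.1 * b q.2))
      (volume.prod volume) :=
    (Complex.measurable_ofReal.comp hK).aestronglyMeasurable.mul
      ((ha.1.comp_quasiMeasurePreserving Measure.quasiMeasurePreserving_fst).mul
        (hb.1.comp_quasiMeasurePreserving Measure.quasiMeasurePreserving_snd))
  refine ⟨hm, ?_⟩
  rw [HasFiniteIntegral, lintegral_prod _ hm.enorm]
  have hb' := hb.1.enorm
  have ha' := ha.1.enorm
  have e : ∀ x, ∫⁻ y, ‖(K x y : ℂ) * (a x * b y)‖ₑ = ‖a x‖ₑ * ∫⁻ y, ‖K x y‖ₑ * ‖b y‖ₑ := by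
    intro x
    have hKx : AEMeasurable (fun y => ‖K x y‖ₑ) volume :=
      (hK.comp measurable_prodMk_left).enorm.aemeasurable
    rw [← lintegral_const_mul'' _ (f := fun y => ‖K x y‖ₑ * ‖b y‖ₑ) (hKx.mul hb')]
    refine lintegral_congr fun y => ?_
    rw [enorm_mul, enorm_mul, enorm_ofReal]
    ring
  simp_rw [e]
  have hm2 : AEMeasurable (fun x => ∫⁻ y, ‖K x y‖ₑ * ‖b y‖ₑ) volume := by
    refine AEMeasurable.lintegral_prod_right' (f := fun q : R4 × R4 => ‖K q.1 q.2‖ₑ * ‖b q.2‖ₑ) ?_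
    exact hK.enorm.aemeasurable.mul (hb'.comp_quasiMeasurePreserving
      Measure.quasiMeasurePreserving_snd)
  have h1 := lintegral_mul_sq_le ha' hm2
  have h2 : (∫⁻ x, ‖a x‖ₑ * ∫⁻ y, ‖K x y‖ₑ * ‖b y‖ₑ) ^ 2 < ⊤ := by
    refine h1.trans_lt (ENNReal.mul_lt_top ((memLp_two_iff ha.1).1 ha) ((h _ hb').trans_lt ?_))
    exact ENNReal.mul_lt_top (ENNReal.pow_lt_top hM.lt_top) ((memLp_two_iff hb.1).1 hb)
  by_contra h3
  rw [not_lt, top_le_iff] at h3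
  rw [h3] at h2
  simp at h2

/-- The pairing is bilinear, without conjugation, so it serves both for self-adjointness and for
moving an operator onto a Schwartz function. -/
theorem AbsBounded.integral_swap (hK : Measurable (Function.uncurry K)) (h : AbsBounded K M)
    (hM : M ≠ ⊤) (hsymm : ∀ x y, K x y = K y x) {a b : R4 → ℂ} (ha : MemLp a 2 volume)
    (hb : MemLp b 2 volume) :
    ∫ x, a x * ∫ y, (K x y : ℂ) * b y = ∫ x, (∫ y, (K x y : ℂ) * a y) * b x := by
  have hi := h.integrable_prod hK hM ha hb
  have := integral_integral_swap (f := fun x y => (K x y : ℂ) * (a x * b y)) hi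
  calc _ = ∫ x, ∫ y, (K x y : ℂ) * (a x * b y) := by
        refine integral_congr_ae (ae_of_all _ fun x => ?_)
        simp only
        rw [← integral_const_mul]
        refine integral_congr_ae (ae_of_all _ fun y => ?_)
        simp only
        ring
    _ = _ := this
    _ = _ := by
        refine integral_congr_ae (ae_of_all _ fun x => ?_)
        simp only
        rw [← integral_mul_const]
        refine integral_congr_ae (ae_of_all _ fun y => ?_)
        simp only
        rw [hsymm y x]
        ring

theorem IsIntegralOperator.inner_apply_comm (hK : Measurable (Function.uncurry K))
    (h : AbsBounded K M) (hM : M ≠ ⊤) (hsymm : ∀ x y, K x y = K y x) {T : L2 →L[ℂ] L2}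
    (hT : IsIntegralOperator K T) (ψ χ : L2) : inner ℂ ψ (T χ) = inner ℂ (T ψ) χ := by
  rw [L2.inner_def, L2.inner_def]
  have hψ : MemLp (fun x => (starRingEnd ℂ) (ψ x)) 2 volume := (Lp.memLp ψ).star
  have := h.integral_swap hK hM hsymm hψ (Lp.memLp χ)
  calc _ = ∫ x, (starRingEnd ℂ) (ψ x) * ∫ y, (K x y : ℂ) * χ y := by
        refine integral_congr_ae ?_
        filter_upwards [hT χ] with x hx
        rw [RCLike.inner_apply', hx.2]
    _ = _ := this
    _ = _ := by
        refine integral_congr_ae ?_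
        filter_upwards [hT ψ] with x hx
        rw [RCLike.inner_apply', hx.2, ← integral_conj]
        congr 2
        ext y
        rw [map_mul, Complex.conj_ofReal]

theorem IsIntegralOperator.isSelfAdjoint (hK : Measurable (Function.uncurry K))
    (h : AbsBounded K M) (hM : M ≠ ⊤) (hsymm : ∀ x y, K x y = K y x) {T : L2 →L[ℂ] L2}
    (hT : IsIntegralOperator K T) : IsSelfAdjoint T := by
  rw [ContinuousLinearMap.isSelfAdjoint_iff_isSymmetric]
  intro ψ χ
  exact (hT.inner_apply_comm hK h hM hsymm ψ χ).symm

/-- For almost every `x` the numbers `T bᵢ (x)` are the inner products of `K(x, ·)` with the basis.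
Bessel's inequality bounds their finite square sums by `‖K(x, ·)‖²`, and this is integrated in `x`.
-/
theorem IsIntegralOperator.hsNorm_le (hK : Measurable (Function.uncurry K)) {N : ℝ≥0∞}
    (hN : ∫⁻ x, ∫⁻ y, ‖K x y‖ₑ ^ 2 ≤ N ^ 2) (hN' : N ≠ ⊤) {T : L2 →L[ℂ] L2}
    (hT : IsIntegralOperator K T) : hsNorm T ≤ N := by
  obtain ⟨b, hb⟩ := (exists_hilbertBasis ℂ L2).choose_spec
  rw [hsNorm_eq b]
  have hKe : Measurable fun q : R4 × R4 => ‖K q.1 q.2‖ₑ := hK.enorm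
  have key : ∑' i, ‖T (b i)‖ₑ ^ 2 ≤ N ^ 2 := by
    rw [ENNReal.tsum_eq_iSup_sum]
    refine iSup_le fun F => ?_
    simp_rw [L2_enorm_sq]
    rw [← lintegral_finsetSum' _ fun i _ => (L2_aemeasurable_enorm _).pow_const 2]
    refine le_trans (lintegral_mono_ae ?_) hN
    have hfin : ∀ᵐ x, ∫⁻ y, ‖K x y‖ₑ ^ 2 < ⊤ := by
      refine ae_lt_top (hKe.pow_const 2).lintegral_prod_right' ?_
      exact (hN.trans_lt (ENNReal.pow_lt_top hN'.lt_top)).ne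
    have hall : ∀ᵐ x, ∀ i ∈ F, T (b i) x = ∫ y, (K x y : ℂ) * (b i : L2) y := by
      refine (Filter.eventually_all_finset F).2 ?_
      intro i _
      filter_upwards [hT (b i)] with x hx using hx.2
    filter_upwards [hfin, hall] with x hx hxi
    have hk : MemLp (fun y => (K x y : ℂ)) 2 volume := by
      refine (memLp_two_iff ?_).2 ?_
      · exact (Complex.measurable_ofReal.comp
          (hK.comp measurable_prodMk_left)).aestronglyMeasurable
      · simpa only [enorm_ofReal] using hx
    set k : L2 := hk.toLp _ with hkdef
    have e1 : ∀ i ∈ F, ‖T (b i) x‖ₑ ^ 2 = ENNReal.ofReal (‖inner ℂ (b i) k‖ ^ 2) := by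
      intro i hi
      have e2 : T (b i) x = inner ℂ k (b i) := by
        rw [hxi i hi, L2.inner_def]
        refine integral_congr_ae ?_
        filter_upwards [hk.coeFn_toLp] with y hy
        rw [RCLike.inner_apply', hkdef, hy, Complex.conj_ofReal]
      rw [e2, norm_inner_symm, ENNReal.ofReal_pow (norm_nonneg _), ofReal_norm]
    rw [Finset.sum_congr rfl e1, ← ENNReal.ofReal_sum_of_nonneg fun i _ => by positivity]
    have e3 : ∫⁻ y, ‖K x y‖ₑ ^ 2 = ENNReal.ofReal (‖k‖ ^ 2) := by
      rw [ENNReal.ofReal_pow (norm_nonneg _), ofReal_norm, L2_enorm_sq]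
      refine lintegral_congr_ae ?_
      filter_upwards [hk.coeFn_toLp] with y hy
      rw [hkdef, hy, enorm_ofReal]
    rw [e3]
    exact ENNReal.ofReal_le_ofReal (b.orthonormal.sum_inner_products_le k)
  calc _ ≤ (N ^ 2) ^ (1 / 2 : ℝ) := ENNReal.rpow_le_rpow key (by norm_num)
    _ = N := by
      rw [← ENNReal.rpow_natCast, ← ENNReal.rpow_mul]
      norm_num

end Kernel

/-! ### Hilbert–Schmidt operators -/

section HilbertSchmidt

variable {H : Type*} [NormedAddCommGroup H] [InnerProductSpace ℂ H] [CompleteSpace H]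

/-- The coordinates of the adjoint at `x` are `⟨T bᵢ, x⟩`, so Parseval and Cauchy–Schwarz bound the
adjoint, which has the same norm as `T`. -/
theorem enorm_le_of_tsum_basis_le {ι : Type*} (b : HilbertBasis ι ℂ H) (T : H →L[ℂ] H) {N : ℝ}
    (hN : 0 ≤ N) (h : ∑' i, ‖T (b i)‖ₑ ^ 2 ≤ ENNReal.ofReal (N ^ 2)) : ‖T‖ ≤ N := by
  have h1 : ∀ x, ‖ContinuousLinearMap.adjoint T x‖ ≤ N * ‖x‖ := by
    intro x
    have h2 : ‖ContinuousLinearMap.adjoint T x‖ₑ ^ 2 ≤ ENNReal.ofReal ((N * ‖x‖) ^ 2) := by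
      rw [enorm_sq_eq_tsum b]
      calc ∑' i, ‖inner ℂ (b i) (ContinuousLinearMap.adjoint T x)‖ₑ ^ 2
          ≤ ∑' i, ‖T (b i)‖ₑ ^ 2 * ‖x‖ₑ ^ 2 := by
            refine ENNReal.tsum_le_tsum fun i => ?_
            rw [ContinuousLinearMap.adjoint_inner_right, ← mul_pow]
            refine pow_le_pow_left' ?_ 2
            rw [← ofReal_norm, ← ofReal_norm, ← ofReal_norm, ← ENNReal.ofReal_mul (norm_nonneg _)]
            exact ENNReal.ofReal_le_ofReal (norm_inner_le_norm _ _)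
        _ = (∑' i, ‖T (b i)‖ₑ ^ 2) * ‖x‖ₑ ^ 2 := ENNReal.tsum_mul_right
        _ ≤ ENNReal.ofReal (N ^ 2) * ‖x‖ₑ ^ 2 := by gcongr
        _ = _ := by
          rw [mul_pow, ENNReal.ofReal_mul (by positivity), ← ofReal_norm,
            ENNReal.ofReal_pow (norm_nonneg x)]
    rw [← ofReal_norm, ← ENNReal.ofReal_pow (norm_nonneg _),
      ENNReal.ofReal_le_ofReal_iff (by positivity)] at h2
    exact le_of_sq_le_sq h2 (by positivity)
  have h3 := (ContinuousLinearMap.adjoint T).opNorm_le_bound hN h1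
  rwa [LinearIsometryEquiv.norm_map] at h3

theorem norm_le_of_hsNorm_le (T : H →L[ℂ] H) {N : ℝ} (hN : 0 ≤ N)
    (h : hsNorm T ≤ ENNReal.ofReal N) : ‖T‖ ≤ N := by
  obtain ⟨b, hb⟩ := (exists_hilbertBasis ℂ H).choose_spec
  refine enorm_le_of_tsum_basis_le b T hN ?_
  rw [hsNorm_eq b] at h
  have h2 := pow_le_pow_left' h 2
  rw [← ENNReal.rpow_natCast, ← ENNReal.rpow_mul, ← ENNReal.ofReal_pow hN] at h2
  simpa using h2

/-- Hilbert–Schmidt operators are compact. -/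
theorem isCompactOperator_of_hsNorm_lt_top (T : H →L[ℂ] H) (h : hsNorm T < ⊤) :
    IsCompactOperator T := by
  obtain ⟨b, hb⟩ := (exists_hilbertBasis ℂ H).choose_spec
  have hsum : ∑' i, ‖T (b i)‖ₑ ^ 2 ≠ ⊤ := by
    rw [hsNorm_eq b] at h
    intro h2
    rw [h2, ENNReal.top_rpow_of_pos (by norm_num)] at h
    exact lt_irrefl _ h
  -- `S F` is `T` after the projection onto finitely many basis vectors; the error has square sum
  -- equal to a tail of the convergent series.
  let S : Finset _ → H →L[ℂ] H := fun F => ∑ i ∈ F, InnerProductSpace.rankOne ℂ (T (b i)) (b i)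
  have hS : ∀ F, IsCompactOperator (S F) := by
    intro F
    have : ∀ i, IsCompactOperator (InnerProductSpace.rankOne ℂ (T (b i)) (b i)) := by
      intro i
      rw [InnerProductSpace.rankOne_def']
      exact (isCompactOperator_of_locallyCompactSpace_rng
        (ContinuousLinearMap.toSpanSingleton ℂ (T (b i)))).comp_clm _
    classical
    induction F using Finset.induction_on with
    | empty =>
      simp only [S, Finset.sum_empty]
      exact isCompactOperator_zero
    | insert i F hi ih =>
      simp only [S, Finset.sum_insert hi]
      exact (this i).add ih
  have htend : Tendsto S atTop (𝓝 T) := by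
    rw [Metric.tendsto_nhds]
    intro ε hε
    have ht := ENNReal.tendsto_tsum_compl_atTop_zero hsum
    have hev := (ENNReal.tendsto_nhds_zero.1 ht) (ENNReal.ofReal ((ε / 2) ^ 2))
      (by rw [gt_iff_lt, ENNReal.ofReal_pos]; positivity)
    filter_upwards [hev] with F hF
    rw [dist_comm, dist_eq_norm]
    refine lt_of_le_of_lt (b := ε / 2) ?_ (by linarith)
    refine enorm_le_of_tsum_basis_le b _ (by positivity) (le_trans (le_of_eq ?_) hF)
    classical
    have e : ∀ i, (T - S F) (b i) = if i ∈ F then 0 else T (b i) := by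
      intro i
      have : S F (b i) = ∑ j ∈ F, (if j = i then T (b j) else 0) := by
        simp only [S, _root_.sum_apply, InnerProductSpace.rankOne_apply]
        refine Finset.sum_congr rfl fun j _ => ?_
        rw [orthonormal_iff_ite.1 b.orthonormal j i]
        split_ifs <;> simp
      rw [_root_.sub_apply, this, Finset.sum_ite_eq']
      split_ifs <;> simp
    rw [← tsum_subtype_eq_of_support_subset (s := {i | i ∉ F})]
    · refine tsum_congr fun i => ?_
      rw [e, if_neg i.2]
    · intro i hi hiF
      apply hi
      simp only [e, if_pos hiF]
      simp
  exact isCompactOperator_of_tendsto htend (Eventually.of_forall hS)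

end HilbertSchmidt

end TwoBody

end

noncomputable section

namespace TwoBody

open Set
open scoped FourierTransform RealInnerProductSpace

/-! ### The Green function of `κ - Δ` -/

theorem measurable_macdonald (j : ℕ) : Measurable (macdonald j) := by
  have h : StronglyMeasurable (Function.uncurry fun s u : ℝ => Real.exp (-u - s / u) / u ^ j) := by
    refine Measurable.stronglyMeasurable ?_
    unfold Function.uncurry
    fun_prop
  exact (h.integral_prod_right (ν := volume.restrict (Ioi (0 : ℝ)))).measurable

/-- The Green function of `κ - Δ` in `ℝ⁴`. -/
def green (κ : ℝ) (x : R4) : ℝ := macdonald 0 (κ * ‖x‖ ^ 2 / 4) / (4 * Real.pi ^ 2 * ‖x‖ ^ 2)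

theorem measurable_green (κ : ℝ) : Measurable (green κ) := by
  refine ((measurable_macdonald 0).comp ?_).div ?_ <;> fun_prop

theorem green_neg (κ : ℝ) (x : R4) : green κ (-x) = green κ x := by
  rw [green, green, norm_neg]

theorem green_sub_comm (κ : ℝ) (x y : R4) : green κ (x - y) = green κ (y - x) := by
  rw [← neg_sub, green_neg]

theorem green_nonneg (κ : ℝ) (x : R4) : 0 ≤ green κ x :=
  div_nonneg (macdonald_nonneg _ _) (by positivity)

theorem green_zero (x : R4) : green 0 x = 1 / (4 * Real.pi ^ 2 * ‖x‖ ^ 2) := by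
  rw [green, zero_mul, zero_div, macdonald_zero_zero]

theorem green_le_green_zero {κ : ℝ} (hκ : 0 ≤ κ) (x : R4) : green κ x ≤ green 0 x := by
  rw [green_zero, green]
  gcongr
  exact macdonald_zero_le_one (by positivity)

/-- Rescaling `u` by `‖x‖²` exhibits the Green function as a superposition of Gaussians in `x`,
whose Fourier transforms are explicit. At the origin `green` takes the default value of a division
by zero. -/
theorem green_eq_integral (κ : ℝ) {x : R4} (hx : x ≠ 0) :
    green κ x = (4 * Real.pi ^ 2)⁻¹ *
      ∫ u in Ioi (0 : ℝ), Real.exp (-(κ / 4) / u) * Real.exp (-u * ‖x‖ ^ 2) := by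
  have hx' : 0 < ‖x‖ ^ 2 := by have := norm_pos_iff.2 hx; positivity
  have h := integral_comp_mul_left_Ioi
    (fun u : ℝ => Real.exp (-u - κ * ‖x‖ ^ 2 / 4 / u) / u ^ 0) 0 hx'
  rw [mul_zero, smul_eq_mul] at h
  have e : ∫ u in Ioi (0 : ℝ), Real.exp (-(κ / 4) / u) * Real.exp (-u * ‖x‖ ^ 2) =
      (‖x‖ ^ 2)⁻¹ * macdonald 0 (κ * ‖x‖ ^ 2 / 4) := by
    rw [macdonald, ← h]
    refine setIntegral_congr_fun measurableSet_Ioi fun u hu => ?_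
    have hu' : (0 : ℝ) < u := hu
    simp only [pow_zero, div_one]
    rw [← Real.exp_add]
    congr 1
    field_simp
    ring
  rw [e, green]
  field_simp

theorem integrableOn_exp_neg_inv {a : ℝ} (ha : 0 < a) :
    IntegrableOn (fun u : ℝ => (u ^ 2)⁻¹ * Real.exp (-a / u)) (Ioi 0) := by
  have h := (integrableOn_Ioi_comp_rpow_iff' (fun y : ℝ => Real.exp (-a * y)) (p := -1)
    (by norm_num)).2 (integrableOn_exp_mul_Ioi (by linarith) 0)
  refine h.congr_fun (fun u hu => ?_) measurableSet_Ioi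
  have hu' : (0 : ℝ) < u := hu
  have e2 : u ^ (-1 - 1 : ℝ) = (u ^ 2)⁻¹ := by
    rw [show (-1 - 1 : ℝ) = -((2 : ℕ) : ℝ) by norm_num, Real.rpow_neg hu'.le, Real.rpow_natCast]
  simp only [e2, Real.rpow_neg_one, smul_eq_mul, div_eq_mul_inv]

theorem integral_exp_neg_inv {a : ℝ} (ha : 0 < a) :
    ∫ u in Ioi (0 : ℝ), (u ^ 2)⁻¹ * Real.exp (-a / u) = 1 / a := by
  have h := integral_comp_rpow_Ioi (fun y : ℝ => Real.exp (-a * y)) (p := -1) (by norm_num)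
  rw [integral_exp_mul_Ioi (by linarith) 0] at h
  rw [show (1 : ℝ) / a = -Real.exp (-a * 0) / -a by simp, ← h]
  refine setIntegral_congr_fun measurableSet_Ioi fun u hu => ?_
  have hu' : (0 : ℝ) < u := hu
  have e2 : u ^ (-1 - 1 : ℝ) = (u ^ 2)⁻¹ := by
    rw [show (-1 - 1 : ℝ) = -((2 : ℕ) : ℝ) by norm_num, Real.rpow_neg hu'.le, Real.rpow_natCast]
  simp only [e2, Real.rpow_neg_one, smul_eq_mul, div_eq_mul_inv, abs_neg, abs_one, one_mul]

theorem integral_gaussian_R4 {u : ℝ} (hu : 0 < u) :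
    ∫ x : R4, Real.exp (-u * ‖x‖ ^ 2) = (Real.pi / u) ^ 2 := by
  rw [GaussianFourier.integral_rexp_neg_mul_sq_norm hu]
  simp only [finrank_euclideanSpace, Fintype.card_fin]
  norm_num

theorem integrable_gaussian_R4 {u : ℝ} (hu : 0 < u) :
    Integrable (fun x : R4 => Real.exp (-u * ‖x‖ ^ 2)) := by
  by_contra h
  have := integral_undef h
  rw [integral_gaussian_R4 hu] at this
  have : 0 < (Real.pi / u) ^ 2 := by positivity
  linarith

/-- Integrating the Gaussian over `x` leaves `π² / u²`, and `exp (-κ / 4u)` with `κ > 0` tames this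
at `u = 0`. It justifies Fubini for the Fourier transform. -/
theorem integrable_green_prod {κ : ℝ} (hκ : 0 < κ) :
    Integrable (fun q : R4 × ℝ => Real.exp (-(κ / 4) / q.2) * Real.exp (-q.2 * ‖q.1‖ ^ 2))
      (volume.prod (volume.restrict (Ioi 0))) := by
  refine (integrable_prod_iff' (Measurable.aestronglyMeasurable (by fun_prop))).2 ⟨?_, ?_⟩
  · refine (ae_restrict_iff' measurableSet_Ioi).2 (ae_of_all _ fun u hu => ?_)
    exact (integrable_gaussian_R4 hu).const_mul (Real.exp (-(κ / 4) / u))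
  · have h : IntegrableOn (fun u : ℝ => Real.pi ^ 2 * ((u ^ 2)⁻¹ * Real.exp (-(κ / 4) / u)))
        (Ioi 0) := (integrableOn_exp_neg_inv (by positivity)).const_mul _
    refine h.congr_fun (fun u hu => ?_) measurableSet_Ioi
    have hu' : (0 : ℝ) < u := hu
    simp only [norm_mul, Real.norm_eq_abs, Real.abs_exp]
    rw [integral_const_mul, integral_gaussian_R4 hu']
    field_simp

theorem ae_ne_zero_R4 : ∀ᵐ x : R4, x ≠ 0 := by
  simp [ae_iff]

theorem integrable_green {κ : ℝ} (hκ : 0 < κ) : Integrable (green κ) := by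
  have h := ((integrable_green_prod hκ).integral_prod_left).const_mul ((4 * Real.pi ^ 2)⁻¹)
  refine h.congr ?_
  filter_upwards [ae_ne_zero_R4] with x hx
  rw [green_eq_integral κ hx]

/-- The transform of each Gaussian is `(π/u)² exp (-π²‖ξ‖²/u)`, so the `u`-integral is `∫ u⁻² exp
(-a/u) du = 1/a` with `a = κ/4 + π²‖ξ‖²`. -/
theorem fourier_green {κ : ℝ} (hκ : 0 < κ) (ξ : R4) :
    𝓕 (fun x : R4 => (green κ x : ℂ)) ξ = ((κ + (2 * Real.pi) ^ 2 * ‖ξ‖ ^ 2)⁻¹ : ℝ) := by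
  rw [Real.fourier_eq]
  have hprod : Integrable (fun q : R4 × ℝ => Real.fourierChar (-⟪q.1, ξ⟫) •
      ((Real.exp (-(κ / 4) / q.2) * Real.exp (-q.2 * ‖q.1‖ ^ 2) : ℝ) : ℂ))
      (volume.prod (volume.restrict (Ioi 0))) := by
    refine ((integrable_green_prod hκ).ofReal (𝕜 := ℂ)).mono ?_ (ae_of_all _ fun q => ?_)
    · refine AEStronglyMeasurable.smul ?_ ((integrable_green_prod hκ).ofReal (𝕜 := ℂ)).aestronglyMeasurable
      have hc : Continuous fun q : R4 × ℝ => -⟪q.1, ξ⟫ :=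
        (continuous_fst.inner continuous_const).neg
      exact (continuous_subtype_val.comp (Real.continuous_fourierChar.comp hc)).aestronglyMeasurable
    · rw [Circle.norm_smul]
      rfl
  have swap := integral_integral_swap (f := fun (x : R4) (u : ℝ) => Real.fourierChar (-⟪x, ξ⟫) •
      ((Real.exp (-(κ / 4) / u) * Real.exp (-u * ‖x‖ ^ 2) : ℝ) : ℂ)) hprod
  calc ∫ x, Real.fourierChar (-⟪x, ξ⟫) • (green κ x : ℂ)
      = ((4 * Real.pi ^ 2)⁻¹ : ℝ) * ∫ x : R4, ∫ u in Ioi (0 : ℝ), Real.fourierChar (-⟪x, ξ⟫) •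
          ((Real.exp (-(κ / 4) / u) * Real.exp (-u * ‖x‖ ^ 2) : ℝ) : ℂ) := by
        rw [← integral_const_mul]
        refine integral_congr_ae ?_
        filter_upwards [ae_ne_zero_R4] with x hx
        simp only [Circle.smul_def, smul_eq_mul]
        rw [integral_const_mul, integral_complex_ofReal, green_eq_integral κ hx, Complex.ofReal_mul]
        ring
    _ = ((4 * Real.pi ^ 2)⁻¹ : ℝ) * ∫ u in Ioi (0 : ℝ), (Real.exp (-(κ / 4) / u) : ℂ) *
          𝓕 (fun x : R4 => Complex.exp (-(u : ℂ) * ‖x‖ ^ 2)) ξ := by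
        rw [swap]
        congr 1
        refine integral_congr_ae (ae_of_all _ fun u => ?_)
        simp only [Real.fourier_eq]
        rw [← integral_const_mul]
        refine integral_congr_ae (ae_of_all _ fun x => ?_)
        simp only [Circle.smul_def, smul_eq_mul]
        push_cast
        ring
    _ = ((4 * Real.pi ^ 2)⁻¹ : ℝ) * ∫ u in Ioi (0 : ℝ), ((Real.pi ^ 2 * ((u ^ 2)⁻¹ *
          Real.exp (-(κ / 4 + Real.pi ^ 2 * ‖ξ‖ ^ 2) / u)) : ℝ) : ℂ) := by
        congr 1
        refine setIntegral_congr_fun measurableSet_Ioi fun u hu => ?_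
        have hu' : (0 : ℝ) < u := hu
        have hu2 : (u : ℂ) ≠ 0 := by exact_mod_cast hu'.ne'
        rw [fourier_gaussian_innerProductSpace (by simpa using hu')]
        simp only [finrank_euclideanSpace, Fintype.card_fin]
        rw [show (((4 : ℕ) : ℂ) / 2) = ((2 : ℕ) : ℂ) by norm_num, Complex.cpow_natCast]
        have : (Real.exp (-(κ / 4 + Real.pi ^ 2 * ‖ξ‖ ^ 2) / u) : ℂ) =
            Real.exp (-(κ / 4) / u) * Complex.exp (-Real.pi ^ 2 * ‖ξ‖ ^ 2 / u) := by
          push_cast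
          rw [← Complex.exp_add]
          ring_nf
        push_cast at this ⊢
        rw [this]
        field_simp
    _ = _ := by
        rw [integral_complex_ofReal, integral_const_mul, integral_exp_neg_inv (by positivity)]
        rw [← Complex.ofReal_mul]
        congr 1
        field_simp
        ring

/-! ### The equation `(κ - Δ) η = ζ` for Schwartz functions -/

/-- The symbol of the inverse of `κ - Δ`. -/
def symbol (κ : ℝ) (ξ : R4) : ℂ := ((κ + (2 * Real.pi) ^ 2 * ‖ξ‖ ^ 2)⁻¹ : ℝ)

/-- A dilation by `2π / √κ` reduces the symbol to `κ⁻¹ (1 + ‖ξ‖²)⁻¹`. -/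
theorem hasTemperateGrowth_symbol {κ : ℝ} (hκ : 0 < κ) : (symbol κ).HasTemperateGrowth := by
  have h1 := Function.hasTemperateGrowth_one_add_norm_sq_rpow R4 (-1)
  have h2 : (fun ξ : R4 => (2 * Real.pi / √κ) • ξ).HasTemperateGrowth := by
    exact ((2 * Real.pi / √κ) • ContinuousLinearMap.id ℝ R4).hasTemperateGrowth
  have h3 : (fun ξ : R4 => (κ⁻¹ * (1 + ‖(2 * Real.pi / √κ) • ξ‖ ^ 2) ^ (-1 : ℝ) : ℝ)).HasTemperateGrowth :=
    (Function.HasTemperateGrowth.const κ⁻¹).mul (h1.comp h2)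
  have h4 := Function.HasTemperateGrowth.comp Function.Complex.hasTemperateGrowth_ofReal h3
  have e : symbol κ = Complex.ofReal ∘
      fun ξ : R4 => (κ⁻¹ * (1 + ‖(2 * Real.pi / √κ) • ξ‖ ^ 2) ^ (-1 : ℝ) : ℝ) := ?_
  · rw [e]
    exact h4
  funext ξ
  simp only [symbol, Function.comp]
  congr 1
  rw [Real.rpow_neg_one, ← mul_inv, norm_smul, mul_pow ‖2 * Real.pi / √κ‖, Real.norm_of_nonneg (by positivity), div_pow,
    Real.sq_sqrt hκ.le]
  congr 1
  field_simp

/-- The solution of `(κ - Δ) η = ζ` in Schwartz space. -/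
def solve (κ : ℝ) (ζ : 𝓢(R4, ℂ)) : 𝓢(R4, ℂ) := SchwartzMap.fourierMultiplierCLM ℂ (symbol κ) ζ

theorem fourier_solve_apply {κ : ℝ} (hκ : 0 < κ) (ζ : 𝓢(R4, ℂ)) (ξ : R4) :
    𝓕 (solve κ ζ) ξ = symbol κ ξ * 𝓕 ζ ξ := by
  rw [solve, SchwartzMap.fourierMultiplierCLM_apply, FourierTransform.fourier_fourierInv_eq,
    SchwartzMap.smulLeftCLM_apply_apply (hasTemperateGrowth_symbol hκ), smul_eq_mul]

theorem fourier_laplacian_apply (η : 𝓢(R4, ℂ)) (ξ : R4) :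
    𝓕 (Δ η) ξ = -((2 * Real.pi) ^ 2 * ‖ξ‖ ^ 2 : ℝ) * 𝓕 η ξ := by
  have h : (fun ξ : R4 => ‖ξ‖ ^ 2).HasTemperateGrowth := Function.hasTemperateGrowth_norm_sq R4
  rw [SchwartzMap.laplacian_eq_fourierMultiplierCLM, SchwartzMap.fourierMultiplierCLM_apply,
    ← SchwartzMap.fourierTransformCLM_apply ℝ, map_smul, SchwartzMap.fourierTransformCLM_apply,
    FourierTransform.fourier_fourierInv_eq, _root_.smul_apply]
  erw [SchwartzMap.smulLeftCLM_apply_apply h]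
  simp only [Complex.real_smul]
  push_cast
  ring

theorem fourierInv_fourier_schwartz (f : 𝓢(R4, ℂ)) : 𝓕⁻ (𝓕 f) = f :=
  FourierTransform.fourierInv_fourier_eq f

theorem schwartz_ext_fourier {f g : 𝓢(R4, ℂ)} (h : ∀ ξ, 𝓕 f ξ = 𝓕 g ξ) : f = g := by
  have : 𝓕 f = 𝓕 g := by ext ξ; exact h ξ
  rw [← fourierInv_fourier_schwartz f, this, fourierInv_fourier_schwartz]

theorem fourier_helmholtz_apply (κ : ℝ) (η : 𝓢(R4, ℂ)) (ξ : R4) :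
    𝓕 ((κ : ℂ) • η - Δ η) ξ = ((κ + (2 * Real.pi) ^ 2 * ‖ξ‖ ^ 2 : ℝ) : ℂ) * 𝓕 η ξ := by
  rw [← SchwartzMap.fourierTransformCLM_apply ℂ, map_sub, map_smul,
    SchwartzMap.fourierTransformCLM_apply, SchwartzMap.fourierTransformCLM_apply,
    _root_.sub_apply, _root_.smul_apply, fourier_laplacian_apply, smul_eq_mul]
  push_cast
  ring

theorem helmholtz_solve {κ : ℝ} (hκ : 0 < κ) (ζ : 𝓢(R4, ℂ)) :
    (κ : ℂ) • solve κ ζ - Δ (solve κ ζ) = ζ := by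
  refine schwartz_ext_fourier fun ξ => ?_
  rw [fourier_helmholtz_apply, fourier_solve_apply hκ, symbol, ← mul_assoc, ← Complex.ofReal_mul,
    mul_inv_cancel₀ (by positivity), Complex.ofReal_one, one_mul]

theorem solve_helmholtz {κ : ℝ} (hκ : 0 < κ) (η : 𝓢(R4, ℂ)) :
    solve κ ((κ : ℂ) • η - Δ η) = η := by
  refine schwartz_ext_fourier fun ξ => ?_
  rw [fourier_solve_apply hκ, fourier_helmholtz_apply, symbol, ← mul_assoc, ← Complex.ofReal_mul,
    inv_mul_cancel₀ (by positivity), Complex.ofReal_one, one_mul]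

/-- The multiplication formula `∫ ĝ F = ∫ g F̂`, applied to `g = green κ` and `F(ξ) = exp (2πi⟨ξ,
x⟩) ζ̂(ξ)`, for which `F̂(y) = ζ(x - y)`. -/
theorem solve_apply {κ : ℝ} (hκ : 0 < κ) (ζ : 𝓢(R4, ℂ)) (x : R4) :
    solve κ ζ x = ∫ y, (green κ (x - y) : ℂ) * ζ y := by
  have h1 : solve κ ζ x = ∫ ξ, Real.fourierChar ⟪ξ, x⟫ • (symbol κ ξ * 𝓕 ζ ξ) := by
    conv_lhs => rw [← fourierInv_fourier_schwartz (solve κ ζ)]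
    rw [SchwartzMap.fourierInv_coe, Real.fourierInv_eq]
    simp_rw [fourier_solve_apply hκ]
  have hint : Integrable fun ξ : R4 => Real.fourierChar ⟪ξ, x⟫ • 𝓕 ζ ξ := by
    refine (𝓕 ζ).integrable.mono ?_ (ae_of_all _ fun q => ?_)
    · refine AEStronglyMeasurable.smul ?_ (𝓕 ζ).integrable.aestronglyMeasurable
      have hc : Continuous fun ξ : R4 => ⟪ξ, x⟫ := continuous_id.inner continuous_const
      exact (continuous_subtype_val.comp (Real.continuous_fourierChar.comp hc)).aestronglyMeasurable
    · rw [Circle.norm_smul]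
  have flip := VectorFourier.integral_fourierIntegral_smul_eq_flip (L := innerₗ R4) (μ := volume)
    (ν := volume) Real.continuous_fourierChar continuous_inner (integrable_green hκ).ofReal hint
  have h2 : ∀ y, VectorFourier.fourierIntegral Real.fourierChar volume (innerₗ R4).flip
      (fun ξ : R4 => Real.fourierChar ⟪ξ, x⟫ • 𝓕 ζ ξ) y = ζ (x - y) := by
    intro y
    have h3 : ζ (x - y) = 𝓕⁻ (𝓕 ζ) (x - y) := by rw [fourierInv_fourier_schwartz]
    rw [h3, SchwartzMap.fourierInv_coe, Real.fourierInv_eq, VectorFourier.fourierIntegral]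
    refine integral_congr_ae (ae_of_all _ fun ξ => ?_)
    simp only
    rw [smul_smul, ← AddChar.map_add_eq_mul, inner_sub_right, LinearMap.flip_apply, innerₗ_apply_apply,
      real_inner_comm y ξ]
    congr 2
    ring
  simp_rw [h2] at flip
  rw [h1]
  calc _ = ∫ ξ, VectorFourier.fourierIntegral Real.fourierChar volume (innerₗ R4)
        (fun x => (green κ x : ℂ)) ξ • (Real.fourierChar ⟪ξ, x⟫ • 𝓕 ζ ξ) := by
        refine integral_congr_ae (ae_of_all _ fun ξ => ?_)
        have := fourier_green hκ ξ
        have e : VectorFourier.fourierIntegral Real.fourierChar volume (innerₗ R4)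
          (fun x => (green κ x : ℂ)) ξ = symbol κ ξ := this
        simp only
        rw [e, smul_comm, smul_eq_mul]
    _ = ∫ y, (green κ y : ℂ) • ζ (x - y) := flip
    _ = _ := by
        rw [← integral_sub_left_eq_self _ volume x]
        refine integral_congr_ae (ae_of_all _ fun y => ?_)
        simp

end TwoBody

end

noncomputable section

namespace TwoBody

/-! ### The free resolvent -/

/-- The kernel of the resolvent of `-(1 / 2m) Δ` at `-κ / 2m`. -/
def freeKernel (m κ : ℝ) (x y : R4) : ℝ := 2 * m * green κ (x - y)

theorem measurable_freeKernel (m κ : ℝ) : Measurable (Function.uncurry (freeKernel m κ)) :=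
  ((measurable_green κ).comp (measurable_fst.sub measurable_snd)).const_mul _

theorem freeKernel_comm (m κ : ℝ) (x y : R4) : freeKernel m κ x y = freeKernel m κ y x := by
  rw [freeKernel, freeKernel, green_sub_comm]

/-- Schur's test with constant weight, that is, convolution with an integrable function. -/
theorem absBounded_freeKernel (m : ℝ) {κ : ℝ} (hκ : 0 < κ) :
    ∃ M : ℝ≥0∞, M ≠ ⊤ ∧ AbsBounded (freeKernel m κ) M := by
  refine ⟨∫⁻ y, ‖2 * m * green κ y‖ₑ, ((integrable_green hκ).const_mul _).2.ne, ?_⟩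
  refine AbsBounded.of_schur (measurable_freeKernel m κ) (freeKernel_comm m κ)
    (p := fun _ => 1) measurable_const (by simp) (by simp) fun x => ?_
  simp only [mul_one, freeKernel]
  rw [lintegral_sub_left_eq_self (fun y => ‖2 * m * green κ y‖ₑ) x]

theorem toTemperedDistribution_apply' (f : L2) (η : 𝓢(R4, ℂ)) :
    (f : 𝓢'(R4, ℂ)) η = ∫ x, η x * f x := by
  simp [Lp.toTemperedDistribution_apply]

theorem integrable_schwartz_mul (f : L2) (η : 𝓢(R4, ℂ)) : Integrable fun x => η x * f x :=
  (η.memLp 2 volume).integrable_mul (Lp.memLp f)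

theorem isLaplacian_iff_integral {ψ g : L2} : IsLaplacian ψ g ↔
    ∀ η : 𝓢(R4, ℂ), ∫ x, η x * g x = ∫ x, (Δ η) x * ψ x := by
  constructor
  · intro h η
    have := congrArg (fun F : 𝓢'(R4, ℂ) => F η) h
    simp only [TemperedDistribution.laplacian_apply_apply] at this
    rwa [toTemperedDistribution_apply', toTemperedDistribution_apply'] at this
  · intro h
    ext η
    rw [TemperedDistribution.laplacian_apply_apply, toTemperedDistribution_apply',
      toTemperedDistribution_apply']
    exact h η

theorem L2_ext_schwartz {f g : L2} (h : ∀ η : 𝓢(R4, ℂ), ∫ x, η x * f x = ∫ x, η x * g x) :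
    f = g := by
  refine toTemperedDistribution_injective ?_
  ext η
  rw [toTemperedDistribution_apply', toTemperedDistribution_apply']
  exact h η

theorem integral_freeKernel_mul (m : ℝ) {κ : ℝ} (hκ : 0 < κ) (ζ : 𝓢(R4, ℂ)) (x : R4) :
    ∫ y, (freeKernel m κ x y : ℂ) * ζ y = 2 * m * solve κ ζ x := by
  rw [solve_apply hκ, ← integral_const_mul]
  refine integral_congr_ae (ae_of_all _ fun y => ?_)
  simp only [freeKernel]
  push_cast
  ring

/-- Moves the resolvent onto the test function, where it is the exact inverse `solve κ`. Both
resolvent identities below are checked in this dual form. -/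
theorem integral_mul_freeResolvent {m κ : ℝ} (hκ : 0 < κ) {R : L2 →L[ℂ] L2}
    (hR : IsIntegralOperator (freeKernel m κ) R) (ζ : 𝓢(R4, ℂ)) (ψ : L2) :
    ∫ x, ζ x * R ψ x = 2 * m * ∫ x, solve κ ζ x * ψ x := by
  obtain ⟨M, hM, hb⟩ := absBounded_freeKernel m hκ
  have h := hb.integral_swap (measurable_freeKernel m κ) hM (freeKernel_comm m κ)
    (ζ.memLp 2 volume) (Lp.memLp ψ)
  simp_rw [integral_freeKernel_mul m hκ, mul_assoc, integral_const_mul] at h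
  rw [mul_assoc, ← h]
  refine integral_congr_ae ?_
  filter_upwards [hR ψ] with x hx
  rw [hx.2]

theorem isMul_zero_left (ψ : L2) : IsMul 0 ψ 0 := by
  filter_upwards [Lp.coeFn_zero ℂ 2 (volume : Measure R4)] with x hx
  rw [hx]
  simp

theorem integral_helmholtz_mul (κ : ℝ) (η : 𝓢(R4, ℂ)) (f : L2) :
    ∫ x, ((κ : ℂ) • η - Δ η) x * f x = κ * (∫ x, η x * f x) - ∫ x, (Δ η) x * f x := by
  rw [← integral_const_mul, ← integral_sub ((integrable_schwartz_mul f η).const_mul _)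
    (integrable_schwartz_mul f _)]
  refine integral_congr_ae (ae_of_all _ fun x => ?_)
  simp only [_root_.sub_apply, _root_.smul_apply, smul_eq_mul]
  ring

theorem integral_mul_lincomb (a b : ℂ) (η : 𝓢(R4, ℂ)) (f g : L2) :
    ∫ x, η x * (a • f + b • g : L2) x = a * (∫ x, η x * f x) + b * ∫ x, η x * g x := by
  rw [← integral_const_mul, ← integral_const_mul, ← integral_add
    ((integrable_schwartz_mul f η).const_mul _) ((integrable_schwartz_mul g η).const_mul _)]
  refine integral_congr_ae ?_
  filter_upwards [Lp.coeFn_add (a • f) (b • g), Lp.coeFn_smul a f, Lp.coeFn_smul b g] with x h1 h2 h3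
  rw [h1, Pi.add_apply, h2, h3, Pi.smul_apply, Pi.smul_apply, smul_eq_mul, smul_eq_mul]
  ring

theorem isResolventAt_free {m z : ℝ} (hm : 0 < m) (hz : z < 0) {R : L2 →L[ℂ] L2}
    (hR : IsIntegralOperator (freeKernel m (-2 * m * z)) R) :
    IsResolventAt (schrodinger m 0) (z : ℂ) R := by
  -- Chosen so that `-(1 / 2m) Δ - z = (κ - Δ) / 2m`.
  set κ := -2 * m * z with hκdef
  have hκ : 0 < κ := by
    have := mul_pos hm (neg_pos.2 hz)
    linarith
  have hm' : (m : ℂ) ≠ 0 := by exact_mod_cast hm.ne'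
  have hκc : (κ : ℂ) = -2 * m * z := by
    rw [hκdef]
    push_cast
    ring
  constructor
  · intro ψ
    have hlap : IsLaplacian (R ψ) ((κ : ℂ) • R ψ + (-(2 * m) : ℂ) • ψ) := by
      refine isLaplacian_iff_integral.2 fun η => ?_
      have h1 := integral_helmholtz_mul κ η (R ψ)
      rw [integral_mul_freeResolvent hκ hR, solve_helmholtz hκ] at h1
      rw [integral_mul_lincomb]
      linear_combination -h1
    have hdom : R ψ ∈ (schrodinger m 0).domain := ⟨⟨_, hlap⟩, 0, isMul_zero_left _⟩
    refine ⟨hdom, ?_⟩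
    rw [schrodinger_apply ⟨R ψ, hdom⟩ hlap (isMul_zero_left _), add_zero, smul_add, smul_smul,
      smul_smul, hκc]
    have e1 : (-(1 / (2 * m)) : ℂ) * (-2 * m * z) = z := by field_simp
    have e2 : (-(1 / (2 * m)) : ℂ) * (-(2 * m)) = 1 := by field_simp
    rw [e1, e2, one_smul]
    abel
  · rintro ⟨χ, ⟨g, hg⟩, hk⟩
    rw [schrodinger_apply ⟨χ, ⟨g, hg⟩, hk⟩ hg (isMul_zero_left _), add_zero, sub_eq_add_neg, ← neg_smul]
    refine L2_ext_schwartz fun ζ => ?_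
    rw [integral_mul_freeResolvent hκ hR, integral_mul_lincomb,
      isLaplacian_iff_integral.1 hg (solve κ ζ)]
    have h1 := integral_helmholtz_mul κ (solve κ ζ) χ
    rw [helmholtz_solve hκ, hκc] at h1
    rw [h1]
    field_simp
    ring

theorem exists_freeResolvent {m z : ℝ} (hm : 0 < m) (hz : z < 0) :
    ∃ R : L2 →L[ℂ] L2, IsIntegralOperator (freeKernel m (-2 * m * z)) R ∧
      IsResolventAt (schrodinger m 0) (z : ℂ) R ∧ IsSelfAdjoint R := by
  have hκ : 0 < -2 * m * z := by
    have := mul_pos hm (neg_pos.2 hz)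
    linarith
  obtain ⟨M, hM, hb⟩ := absBounded_freeKernel m hκ
  obtain ⟨R, hR⟩ := hb.exists_isIntegralOperator (measurable_freeKernel m _) hM
  exact ⟨R, hR, isResolventAt_free hm hz hR,
    hR.isSelfAdjoint (measurable_freeKernel m _) hb hM (freeKernel_comm m _)⟩

/-! ### The Birman–Schwinger principle -/

section BirmanSchwinger

variable {m : ℝ} {v : R4 → ℝ} {z : ℂ} {S R A' : L2 →L[ℂ] L2}

/-- `v = -S²` is bounded, so the potential does not change the domain. -/
theorem mem_domain_iff (hS : ∀ ψ, IsMul v ψ (-S (S ψ))) (χ : L2) :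
    χ ∈ (schrodinger m v).domain ↔ χ ∈ (schrodinger m 0).domain :=
  ⟨fun h => ⟨h.1, 0, isMul_zero_left _⟩, fun h => ⟨h.1, _, hS χ⟩⟩

theorem schrodinger_eq_sub (hS : ∀ ψ, IsMul v ψ (-S (S ψ))) {χ : L2}
    (h : χ ∈ (schrodinger m v).domain) (h' : χ ∈ (schrodinger m 0).domain) :
    schrodinger m v ⟨χ, h⟩ = schrodinger m 0 ⟨χ, h'⟩ - S (S χ) := by
  obtain ⟨g, hg⟩ := h.1
  rw [schrodinger_apply ⟨χ, h⟩ hg (hS χ), schrodinger_apply ⟨χ, h'⟩ hg (isMul_zero_left _), add_zero,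
    sub_eq_add_neg]

/-- Here `A'` is the inverse of `1 - S R S`, and `h = h₀ - S²`. The formula is the resolvent
identity `r = r₀ + r₀ S² r` solved for `r`. -/
theorem isResolventAt_birmanSchwinger (hS : ∀ ψ, IsMul v ψ (-S (S ψ)))
    (hR : IsResolventAt (schrodinger m 0) z R)
    (hA : ∀ ψ, A' ψ - S (R (S (A' ψ))) = ψ) (hA' : ∀ ψ, A' (ψ - S (R (S ψ))) = ψ) :
    IsResolventAt (schrodinger m v) z (R + R ∘L S ∘L A' ∘L S ∘L R) := by
  constructor
  · intro ψ
    have e : (R + R ∘L S ∘L A' ∘L S ∘L R) ψ = R (ψ + S (A' (S (R ψ)))) := by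
      simp
    rw [e]
    obtain ⟨h, hz⟩ := hR.1 (ψ + S (A' (S (R ψ))))
    have h' := (mem_domain_iff (m := m) hS _).2 h
    refine ⟨h', ?_⟩
    rw [schrodinger_eq_sub hS h' h, sub_right_comm, hz, map_add, map_add]
    have := congrArg S (hA (S (R ψ)))
    rw [map_sub, sub_eq_iff_eq_add] at this
    rw [map_add S, ← this]
    abel
  · rintro ⟨χ, h⟩
    have h' := (mem_domain_iff (m := m) hS _).1 h
    rw [schrodinger_eq_sub hS h h', sub_right_comm]
    have h2 := hR.2 ⟨χ, h'⟩
    set ρ := schrodinger m 0 ⟨χ, h'⟩ - z • χ with hρ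
    simp only at h2
    have h3 := hA' (S χ)
    simp only [_root_.add_apply, ContinuousLinearMap.comp_apply, map_sub] at h3 ⊢
    have h4 := congrArg (fun u => R (S u)) h3
    simp only [map_sub] at h4
    rw [h2, sub_eq_iff_eq_add.1 h4]
    abel

/-- With `K = S R S`, the relations `A' = 1 + K A' = 1 + A' K` give `1 + K + K A' K = A'`. Thus
`w(z)` is itself the inverse of `1 - K`. -/
theorem one_add_birmanSchwinger
    (hA : ∀ ψ, A' ψ - S (R (S (A' ψ))) = ψ) (hA' : ∀ ψ, A' (ψ - S (R (S ψ))) = ψ) :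
    ContinuousLinearMap.id ℂ L2 + S ∘L (R + R ∘L S ∘L A' ∘L S ∘L R) ∘L S = A' := by
  ext1 ψ
  have h1 := hA ψ
  have h2 := hA' ψ
  rw [map_sub, sub_eq_iff_eq_add] at h2
  rw [h2, map_add, map_add, map_add] at h1
  simp only [_root_.add_apply, ContinuousLinearMap.comp_apply, ContinuousLinearMap.id_apply, map_add]
  rw [h2, ← sub_eq_zero]
  rw [← sub_eq_zero] at h1
  rw [← neg_eq_zero, ← h1]
  abel

end BirmanSchwinger

/-! ### Decaying weights -/

/-- `s` is a nonnegative measurable function with `s ≤ A (1 + |x|)^(-β)`, `β > 2`; this is what is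
used about `|v|^(1/2)`. -/
structure IsWeight (s : R4 → ℝ) (A β : ℝ) : Prop where
  measurable : Measurable s
  nonneg : ∀ x, 0 ≤ s x
  le : ∀ x, s x ≤ A * (1 + ‖x‖) ^ (-β)
  two_lt : 2 < β
  const_nonneg : 0 ≤ A

/-- The comparison weight `(1 + |x|)^(-β)`. -/
def bracket (β : ℝ) (x : R4) : ℝ := (1 + ‖x‖) ^ (-β)

theorem measurable_bracket (β : ℝ) : Measurable (bracket β) := by
  unfold bracket
  fun_prop

theorem bracket_pos (β : ℝ) (x : R4) : 0 < bracket β x := by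
  unfold bracket
  positivity

theorem bracket_le_one {β : ℝ} (hβ : 0 ≤ β) (x : R4) : bracket β x ≤ 1 :=
  Real.rpow_le_one_of_one_le_of_nonpos (by have := norm_nonneg x; linarith) (by linarith)

theorem bracket_sq (β : ℝ) (x : R4) : bracket β x ^ 2 = bracket (2 * β) x := by
  unfold bracket
  rw [← Real.rpow_natCast, ← Real.rpow_mul (by positivity)]
  congr 1
  push_cast
  ring

theorem integrable_bracket {β : ℝ} (hβ : 4 < β) : Integrable (bracket β) := by
  refine integrable_one_add_norm ?_
  simpa using hβ

theorem lintegral_bracket_lt_top {β : ℝ} (hβ : 4 < β) :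
    ∫⁻ x, ENNReal.ofReal (bracket β x) < ⊤ := by
  have := (integrable_bracket hβ).lintegral_lt_top
  exact this

theorem integrableOn_inv_norm_sq (r : ℝ) :
    IntegrableOn (fun x : R4 => (‖x‖ ^ 2)⁻¹) (Metric.ball 0 r) := by
  have h : LocallyIntegrable (fun x : R4 => (‖x‖ ^ 2)⁻¹) := by
    refine locallyIntegrable_of_norm_le_rpow (C := 1) (α := 2) (by simp) (by simp; norm_num)
      (ae_of_all _ fun x => ?_) (Measurable.aestronglyMeasurable (by fun_prop))
    rw [one_mul, Real.norm_of_nonneg (by positivity), Real.rpow_neg (norm_nonneg x),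
      Real.rpow_ofNat]
  exact (h.integrableOn_isCompact (isCompact_closedBall 0 r)).mono_set Metric.ball_subset_closedBall

theorem lintegral_ball_inv_norm_sq_lt_top (r : ℝ) :
    ∫⁻ x in Metric.ball (0 : R4) r, ENNReal.ofReal (‖x‖ ^ 2)⁻¹ < ⊤ :=
  (integrableOn_inv_norm_sq r).lintegral_lt_top

/-- Absolute continuity of the integral. This smallness makes the near-diagonal part of `G` small in
norm. -/
theorem exists_lintegral_ball_inv_norm_sq_le {ε : ℝ≥0∞} (hε : 0 < ε) :
    ∃ r : ℝ, 0 < r ∧ ∫⁻ x in Metric.ball (0 : R4) r, ENNReal.ofReal (‖x‖ ^ 2)⁻¹ ≤ ε := by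
  have hf := (lintegral_ball_inv_norm_sq_lt_top 1).ne
  have ht : Tendsto (fun r : ℝ => (volume.restrict (Metric.ball (0 : R4) 1)) (Metric.ball (0 : R4) r))
      (𝓝[>] 0) (𝓝 0) := by
    refine tendsto_of_tendsto_of_tendsto_of_le_of_le' tendsto_const_nhds
      (h := fun r : ℝ => ENNReal.ofReal (r ^ 4) * volume (Metric.ball (0 : R4) 1)) ?_
      (Eventually.of_forall fun r => zero_le) ?_
    · have h1 : Tendsto (fun r : ℝ => ENNReal.ofReal (r ^ 4)) (𝓝[>] 0) (𝓝 0) := by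
        have : Continuous fun r : ℝ => ENNReal.ofReal (r ^ 4) :=
          ENNReal.continuous_ofReal.comp (continuous_pow 4)
        have := this.tendsto 0
        simp only [ne_eq, OfNat.ofNat_ne_zero, not_false_eq_true, zero_pow, ENNReal.ofReal_zero] at this
        exact this.mono_left nhdsWithin_le_nhds
      have := ENNReal.Tendsto.mul_const h1 (Or.inr (measure_ball_lt_top (μ := volume)
        (x := (0 : R4)) (r := 1)).ne)
      rwa [zero_mul] at this
    · filter_upwards [self_mem_nhdsWithin] with r hr
      refine (Measure.restrict_apply_le _ _).trans (le_of_eq ?_)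
      rw [Measure.addHaar_ball volume 0 (le_of_lt hr)]
      simp
  have h2 := tendsto_setLIntegral_zero hf ht
  have h3 := (ENNReal.tendsto_nhds_zero.1 h2) ε hε
  obtain ⟨r, hr, hr0, hr1⟩ := (h3.and (Ioo_mem_nhdsGT (zero_lt_one' ℝ))).exists
  refine ⟨r, hr0, ?_⟩
  rwa [Measure.restrict_restrict measurableSet_ball,
    Set.inter_eq_left.2 (Metric.ball_subset_ball hr1.le)] at hr

/-- For `‖x - y‖ < 1` the weight is at most one and the singularity is integrable; elsewhere the
singularity is at most one and the squared weight is integrable because `2β > 4`. -/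
theorem exists_lintegral_inv_sq_bracket_le {β : ℝ} (hβ : 2 < β) :
    ∃ B : ℝ≥0∞, B ≠ ⊤ ∧ ∀ x : R4,
      ∫⁻ y, ENNReal.ofReal (‖x - y‖ ^ 2)⁻¹ * ENNReal.ofReal (bracket β y ^ 2) ≤ B := by
  refine ⟨(∫⁻ x in Metric.ball (0 : R4) 1, ENNReal.ofReal (‖x‖ ^ 2)⁻¹) +
    ∫⁻ y, ENNReal.ofReal (bracket (2 * β) y), ?_, fun x => ?_⟩
  · exact (ENNReal.add_lt_top.2 ⟨lintegral_ball_inv_norm_sq_lt_top 1,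
      lintegral_bracket_lt_top (by linarith)⟩).ne
  · rw [← lintegral_indicator measurableSet_ball, ← lintegral_sub_left_eq_self
        ((Metric.ball (0 : R4) 1).indicator fun x => ENNReal.ofReal (‖x‖ ^ 2)⁻¹) x,
      ← lintegral_add_left]
    · refine lintegral_mono fun y => ?_
      rw [bracket_sq]
      by_cases h : x - y ∈ Metric.ball (0 : R4) 1
      · rw [Set.indicator_of_mem h]
        refine le_add_right ?_
        calc _ ≤ ENNReal.ofReal (‖x - y‖ ^ 2)⁻¹ * 1 := by
              gcongr
              rw [← ENNReal.ofReal_one]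
              exact ENNReal.ofReal_le_ofReal (bracket_le_one (by linarith) _)
          _ = _ := mul_one _
      · refine le_add_left ?_
        rw [mem_ball_zero_iff, not_lt] at h
        calc _ ≤ 1 * ENNReal.ofReal (bracket (2 * β) y) := by
              gcongr
              rw [← ENNReal.ofReal_one]
              exact ENNReal.ofReal_le_ofReal (inv_le_one_of_one_le₀ (one_le_pow₀ h))
          _ = _ := one_mul _
    · have h : Measurable ((Metric.ball (0 : R4) 1).indicator fun x => ENNReal.ofReal (‖x‖ ^ 2)⁻¹) :=
        Measurable.indicator (by fun_prop) measurableSet_ball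
      exact h.comp (measurable_const.sub measurable_id)

/-- The kernel `s(x) k(x - y) s(y)`. -/
def weightKernel (s k : R4 → ℝ) (x y : R4) : ℝ := s x * k (x - y) * s y

/-! ### Schur and Hilbert–Schmidt bounds for weighted convolution kernels -/

section Weight

variable {s : R4 → ℝ} {A β : ℝ} {k : R4 → ℝ}

theorem IsWeight.le_bracket (hs : IsWeight s A β) (x : R4) : s x ≤ A * bracket β x := hs.le x

theorem IsWeight.le_const (hs : IsWeight s A β) (x : R4) : s x ≤ A :=
  (hs.le_bracket x).trans (mul_le_of_le_one_right hs.const_nonneg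
    (bracket_le_one (by linarith [hs.two_lt]) x))

theorem measurable_weightKernel (hs : Measurable s) (hk : Measurable k) :
    Measurable (Function.uncurry (weightKernel s k)) :=
  ((hs.comp measurable_fst).mul (hk.comp (measurable_fst.sub measurable_snd))).mul
    (hs.comp measurable_snd)

theorem weightKernel_comm (hk : ∀ z, k (-z) = k z) (x y : R4) :
    weightKernel s k x y = weightKernel s k y x := by
  rw [weightKernel, weightKernel, ← hk (x - y), neg_sub]
  ring

/-- The Schur test for the kernels `s(x) k(x - y) s(y)`. -/
theorem IsWeight.absBounded (hs : IsWeight s A β) (hk : Measurable k) (hk' : ∀ z, k (-z) = k z)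
    {B : ℝ≥0∞} (hB : ∀ x, ∫⁻ y, ‖k (x - y)‖ₑ * ENNReal.ofReal (bracket β y ^ 2) ≤ B) :
    AbsBounded (weightKernel s k) (ENNReal.ofReal (A ^ 2) * B) := by
  -- The decay `bracket β` itself is the Schur weight: one copy from `s y` and one from the weight
  -- give the square in `hB`, while the copy from `s x` is returned on the right.
  refine AbsBounded.of_schur (measurable_weightKernel hs.measurable hk) (weightKernel_comm hk')
    (p := fun x => ENNReal.ofReal (bracket β x)) (measurable_bracket β).ennreal_ofReal
    (fun x => by simpa using bracket_pos β x) (fun x => ENNReal.ofReal_ne_top) fun x => ?_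
  calc ∫⁻ y, ‖weightKernel s k x y‖ₑ * ENNReal.ofReal (bracket β y)
      ≤ ∫⁻ y, ENNReal.ofReal (A ^ 2 * bracket β x) *
        (‖k (x - y)‖ₑ * ENNReal.ofReal (bracket β y ^ 2)) := by
        refine lintegral_mono fun y => ?_
        rw [← ofReal_norm, ← ofReal_norm, ← ENNReal.ofReal_mul (norm_nonneg _),
          ← ENNReal.ofReal_mul (norm_nonneg _), ← ENNReal.ofReal_mul
          (mul_nonneg (sq_nonneg _) (bracket_pos β x).le)]
        refine ENNReal.ofReal_le_ofReal ?_
        rw [weightKernel, norm_mul, norm_mul, Real.norm_of_nonneg (hs.nonneg x),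
          Real.norm_of_nonneg (hs.nonneg y)]
        have h1 := hs.le_bracket x
        have h2 := hs.le_bracket y
        have h3 := hs.nonneg x
        have h4 := hs.nonneg y
        have h5 := (bracket_pos β y).le
        have h6 := norm_nonneg (k (x - y))
        have h7 : 0 ≤ A * bracket β x := h3.trans h1
        calc s x * ‖k (x - y)‖ * s y * bracket β y
            ≤ (A * bracket β x) * ‖k (x - y)‖ * (A * bracket β y) * bracket β y := by gcongr
          _ = _ := by ring
    _ = ENNReal.ofReal (A ^ 2 * bracket β x) *
        ∫⁻ y, ‖k (x - y)‖ₑ * ENNReal.ofReal (bracket β y ^ 2) := by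
        refine lintegral_const_mul _ ?_
        exact ((hk.comp (measurable_const.sub measurable_id)).enorm).mul
          ((measurable_bracket β).pow_const 2).ennreal_ofReal
    _ ≤ ENNReal.ofReal (A ^ 2 * bracket β x) * B := by gcongr; exact hB x
    _ = _ := by
        rw [ENNReal.ofReal_mul (sq_nonneg A)]
        ring

/-- Since `‖x - y‖ ≤ (1 + ‖x‖)(1 + ‖y‖)`, the growth is shared by the two weights, which keep a
decay `β - a > 2`, square integrable on `ℝ⁴`. The constant `N` does not depend on `k`, so a small
`C` passes directly to the Hilbert–Schmidt bound. -/
theorem IsWeight.exists_hs_bound (hs : IsWeight s A β) {a : ℝ} (ha : 0 ≤ a) (ha' : a < β - 2) :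
    ∃ N : ℝ, 0 ≤ N ∧ ∀ (k : R4 → ℝ) (C : ℝ), 0 ≤ C → (∀ z, |k z| ≤ C * ‖z‖ ^ a) →
      ∫⁻ x, ∫⁻ y, ‖weightKernel s k x y‖ₑ ^ 2 ≤ ENNReal.ofReal (C * N) ^ 2 := by
  set I := ∫⁻ x, ENNReal.ofReal (bracket (2 * β - 2 * a) x) with hI
  have hI' : I ≠ ⊤ := (lintegral_bracket_lt_top (by linarith)).ne
  refine ⟨A ^ 2 * I.toReal, by positivity, fun k C hC hk => ?_⟩
  have hle : ∀ x y, ‖weightKernel s k x y‖ₑ ^ 2 ≤ ENNReal.ofReal ((C * A ^ 2) ^ 2) *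
      ENNReal.ofReal (bracket (2 * β - 2 * a) x) * ENNReal.ofReal (bracket (2 * β - 2 * a) y) := by
    intro x y
    rw [← ofReal_norm, ← ENNReal.ofReal_pow (norm_nonneg _), ← ENNReal.ofReal_mul (sq_nonneg _),
      ← ENNReal.ofReal_mul (mul_nonneg (sq_nonneg _) (bracket_pos _ _).le)]
    refine ENNReal.ofReal_le_ofReal ?_
    have hx := hs.le_bracket x
    have hy := hs.le_bracket y
    have hx0 := hs.nonneg x
    have hy0 := hs.nonneg y
    have hxy : ‖x - y‖ ^ a ≤ (1 + ‖x‖) ^ a * (1 + ‖y‖) ^ a := by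
      rw [← Real.mul_rpow (by positivity) (by positivity)]
      refine Real.rpow_le_rpow (norm_nonneg _) ?_ ha
      have := norm_sub_le x y
      nlinarith [norm_nonneg x, norm_nonneg y]
    have e : ∀ x : R4, bracket β x * (1 + ‖x‖) ^ a = bracket (β - a) x := by
      intro x
      rw [bracket, bracket, ← Real.rpow_add (by positivity)]
      ring_nf
    have hA := hs.const_nonneg
    have b1 := (bracket_pos β x).le
    have hmain : ‖weightKernel s k x y‖ ≤ C * A ^ 2 * (bracket (β - a) x * bracket (β - a) y) := by
      rw [weightKernel, norm_mul, norm_mul, Real.norm_of_nonneg hx0, Real.norm_of_nonneg hy0,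
        Real.norm_eq_abs]
      have hk1 : |k (x - y)| ≤ C * ((1 + ‖x‖) ^ a * (1 + ‖y‖) ^ a) :=
        (hk _).trans (mul_le_mul_of_nonneg_left hxy hC)
      calc s x * |k (x - y)| * s y
          ≤ (A * bracket β x) * (C * ((1 + ‖x‖) ^ a * (1 + ‖y‖) ^ a)) * (A * bracket β y) := by
            gcongr
        _ = C * A ^ 2 * ((bracket β x * (1 + ‖x‖) ^ a) * (bracket β y * (1 + ‖y‖) ^ a)) := by ring
        _ = _ := by rw [e, e]
    calc ‖weightKernel s k x y‖ ^ 2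
        ≤ (C * A ^ 2 * (bracket (β - a) x * bracket (β - a) y)) ^ 2 := by gcongr
      _ = (C * A ^ 2) ^ 2 * bracket (β - a) x ^ 2 * bracket (β - a) y ^ 2 := by ring
      _ = _ := by rw [bracket_sq, bracket_sq, mul_sub]
  have hm : Measurable fun y => ENNReal.ofReal (bracket (2 * β - 2 * a) y) :=
    (measurable_bracket _).ennreal_ofReal
  calc _ ≤ ∫⁻ x, ∫⁻ y, ENNReal.ofReal ((C * A ^ 2) ^ 2) *
        ENNReal.ofReal (bracket (2 * β - 2 * a) x) * ENNReal.ofReal (bracket (2 * β - 2 * a) y) :=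
        lintegral_mono fun x => lintegral_mono fun y => hle x y
    _ = ENNReal.ofReal ((C * A ^ 2) ^ 2) * I * I := by
        simp_rw [lintegral_const_mul _ hm]
        rw [lintegral_mul_const _ (hm.const_mul _), lintegral_const_mul _ hm]
    _ = _ := by
        rw [← ENNReal.ofReal_toReal hI', ← ENNReal.ofReal_mul (sq_nonneg _),
          ← ENNReal.ofReal_mul (by positivity), ← ENNReal.ofReal_pow (by positivity),
          ENNReal.toReal_ofReal ENNReal.toReal_nonneg]
        congr 1
        ring

/-- The squared singularity `‖z‖⁻²` is still locally integrable in dimension four. -/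
theorem IsWeight.exists_hs_bound_inv (hs : IsWeight s A β) :
    ∃ N : ℝ≥0∞, N ≠ ⊤ ∧ ∀ (k : R4 → ℝ), Measurable k → (∀ z, |k z| ≤ ‖z‖⁻¹) →
      ∫⁻ x, ∫⁻ y, ‖weightKernel s k x y‖ₑ ^ 2 ≤ N ^ 2 := by
  obtain ⟨B, hB, hB'⟩ := exists_lintegral_inv_sq_bracket_le hs.two_lt
  set I := ∫⁻ x, ENNReal.ofReal (bracket (2 * β) x) with hI
  have hI' : I ≠ ⊤ := (lintegral_bracket_lt_top (by linarith [hs.two_lt])).ne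
  set Q := ENNReal.ofReal (A ^ 4) * I * B with hQ
  have hQ' : Q ≠ ⊤ := ENNReal.mul_ne_top (ENNReal.mul_ne_top ENNReal.ofReal_ne_top hI') hB
  refine ⟨Q ^ (1 / 2 : ℝ), ENNReal.rpow_ne_top_of_nonneg (by norm_num) hQ', fun k hk hk' => ?_⟩
  have e2 : (Q ^ (1 / 2 : ℝ)) ^ 2 = Q := by
    rw [← ENNReal.rpow_ofNat, ← ENNReal.rpow_mul]
    norm_num
  rw [e2]
  have hle : ∀ x y, ‖weightKernel s k x y‖ₑ ^ 2 ≤ ENNReal.ofReal (A ^ 4) *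
      ENNReal.ofReal (bracket (2 * β) x) *
      (ENNReal.ofReal (‖x - y‖ ^ 2)⁻¹ * ENNReal.ofReal (bracket β y ^ 2)) := by
    intro x y
    rw [← ofReal_norm, ← ENNReal.ofReal_pow (norm_nonneg _), ← ENNReal.ofReal_mul (by positivity),
      ← ENNReal.ofReal_mul (by positivity),
      ← ENNReal.ofReal_mul (mul_nonneg (by positivity) (bracket_pos _ _).le)]
    refine ENNReal.ofReal_le_ofReal ?_
    have hx := hs.le_bracket x
    have hy := hs.le_bracket y
    have hx0 := hs.nonneg x
    have hy0 := hs.nonneg y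
    rw [weightKernel, norm_mul, norm_mul, Real.norm_of_nonneg hx0, Real.norm_of_nonneg hy0,
      Real.norm_eq_abs, ← bracket_sq]
    have h := hk' (x - y)
    have hA := hs.const_nonneg
    have b1 := (bracket_pos β x).le
    calc (s x * |k (x - y)| * s y) ^ 2
        ≤ ((A * bracket β x) * ‖x - y‖⁻¹ * (A * bracket β y)) ^ 2 := by gcongr
      _ = _ := by rw [← inv_pow]; ring
  have hm : ∀ x : R4, Measurable fun y =>
      ENNReal.ofReal (‖x - y‖ ^ 2)⁻¹ * ENNReal.ofReal (bracket β y ^ 2) := fun x =>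
    Measurable.mul (by fun_prop) ((measurable_bracket β).pow_const 2).ennreal_ofReal
  calc _ ≤ ∫⁻ x, ∫⁻ y, ENNReal.ofReal (A ^ 4) * ENNReal.ofReal (bracket (2 * β) x) *
      (ENNReal.ofReal (‖x - y‖ ^ 2)⁻¹ * ENNReal.ofReal (bracket β y ^ 2)) :=
        lintegral_mono fun x => lintegral_mono fun y => hle x y
    _ ≤ ∫⁻ x, ENNReal.ofReal (A ^ 4) * ENNReal.ofReal (bracket (2 * β) x) * B := by
        refine lintegral_mono fun x => ?_
        rw [lintegral_const_mul _ (hm x)]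
        gcongr
        exact hB' x
    _ = Q := by
        rw [lintegral_mul_const _ ((measurable_bracket _).ennreal_ofReal.const_mul _),
          lintegral_const_mul _ (measurable_bracket _).ennreal_ofReal]

theorem exists_compact_selfAdjoint {K : R4 → R4 → ℝ} (hK : Measurable (Function.uncurry K))
    (hsymm : ∀ x y, K x y = K y x) {N : ℝ≥0∞} (hN : N ≠ ⊤)
    (h : ∫⁻ x, ∫⁻ y, ‖K x y‖ₑ ^ 2 ≤ N ^ 2) :
    ∃ T : L2 →L[ℂ] L2, IsIntegralOperator K T ∧ IsCompactOperator T ∧ IsSelfAdjoint T := by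
  have hb := AbsBounded.of_sq hK h
  obtain ⟨T, hT⟩ := hb.exists_isIntegralOperator hK hN
  exact ⟨T, hT, isCompactOperator_of_hsNorm_lt_top T ((hT.hsNorm_le hK h hN).trans_lt hN.lt_top),
    hT.isSelfAdjoint hK hb hN hsymm⟩

theorem IsWeight.exists_const (hs : IsWeight s A β) :
    ∃ T : L2 →L[ℂ] L2, IsIntegralOperator (weightKernel s fun _ => 1) T ∧ IsCompactOperator T ∧
      IsSelfAdjoint T := by
  obtain ⟨N, _, h⟩ := hs.exists_hs_bound le_rfl (by linarith [hs.two_lt])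
  exact exists_compact_selfAdjoint (measurable_weightKernel hs.measurable measurable_const)
    (weightKernel_comm fun _ => rfl) ENNReal.ofReal_ne_top
    (h (fun _ => 1) 1 zero_le_one (by simp))

theorem IsIntegralOperator.weight_add {k₁ k₂ k₃ : R4 → ℝ} {T₁ T₂ : L2 →L[ℂ] L2}
    (h₁ : IsIntegralOperator (weightKernel s k₁) T₁)
    (h₂ : IsIntegralOperator (weightKernel s k₂) T₂)
    (h : ∀ z, z ≠ 0 → k₁ z + k₂ z = k₃ z) : IsIntegralOperator (weightKernel s k₃) (T₁ + T₂) := by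
  refine (h₁.add h₂).congr (ae_of_all _ fun x => ?_)
  have : ∀ᵐ y : R4, y ≠ x := by simp [ae_iff]
  filter_upwards [this] with y hy
  rw [weightKernel, weightKernel, weightKernel, ← h _ (sub_ne_zero.2 hy.symm)]
  ring

theorem IsIntegralOperator.weight_smul (c : ℝ) {T : L2 →L[ℂ] L2}
    (h : IsIntegralOperator (weightKernel s k) T) :
    IsIntegralOperator (weightKernel s fun z => c * k z) ((c : ℂ) • T) := by
  refine (h.smul c).congr (ae_of_all _ fun x => ae_of_all _ fun y => ?_)
  rw [weightKernel, weightKernel]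
  ring

/-- The kernel is cut at `‖z‖ = 1`: outside, the logarithm is below `‖z‖^a / a` with `a < β - 2`;
inside, it is below `‖z‖⁻¹`. -/
theorem IsWeight.exists_log (hs : IsWeight s A β) :
    ∃ T : L2 →L[ℂ] L2, IsIntegralOperator (weightKernel s fun z => Real.log ‖z‖) T ∧
      IsCompactOperator T ∧ IsSelfAdjoint T := by
  set a := (β - 2) / 2 with ha
  have ha0 : 0 < a := by have := hs.two_lt; linarith
  obtain ⟨N₁, _, h₁⟩ := hs.exists_hs_bound ha0.le (by linarith)
  obtain ⟨N₂, hN₂, h₂⟩ := hs.exists_hs_bound_inv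
  set k₁ : R4 → ℝ := fun z => if 1 ≤ ‖z‖ then Real.log ‖z‖ else 0 with hk₁
  set k₂ : R4 → ℝ := fun z => if 1 ≤ ‖z‖ then 0 else Real.log ‖z‖ with hk₂
  have hset : MeasurableSet {z : R4 | 1 ≤ ‖z‖} := measurableSet_le measurable_const measurable_norm
  have hlog : Measurable fun z : R4 => Real.log ‖z‖ := Real.measurable_log.comp measurable_norm
  have m₁ : Measurable k₁ := Measurable.ite hset hlog measurable_const
  have m₂ : Measurable k₂ := Measurable.ite hset measurable_const hlog
  have b₁ : ∀ z, |k₁ z| ≤ 1 / a * ‖z‖ ^ a := by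
    intro z
    simp only [hk₁]
    split_ifs with h
    · rw [abs_of_nonneg (Real.log_nonneg h)]
      refine (Real.log_le_rpow_div (norm_nonneg z) ha0).trans (le_of_eq ?_)
      ring
    · rw [abs_zero]
      positivity
  have b₂ : ∀ z, |k₂ z| ≤ ‖z‖⁻¹ := by
    intro z
    simp only [hk₂]
    split_ifs with h
    · rw [abs_zero]
      positivity
    · rw [not_le] at h
      rcases eq_or_lt_of_le (norm_nonneg z) with h0 | h0
      · rw [← h0]
        simp
      · rw [abs_of_nonpos (Real.log_nonpos h0.le h.le), ← Real.log_inv]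
        refine (Real.log_le_sub_one_of_pos (by positivity)).trans (by linarith)
  obtain ⟨T₁, i₁, c₁, a₁⟩ := exists_compact_selfAdjoint (measurable_weightKernel hs.measurable m₁)
    (weightKernel_comm fun z => by simp only [hk₁, norm_neg]) ENNReal.ofReal_ne_top
    (h₁ k₁ (1 / a) (by positivity) b₁)
  obtain ⟨T₂, i₂, c₂, a₂⟩ := exists_compact_selfAdjoint (measurable_weightKernel hs.measurable m₂)
    (weightKernel_comm fun z => by simp only [hk₂, norm_neg]) hN₂ (h₂ k₂ m₂ b₂)
  refine ⟨T₁ + T₂, i₁.weight_add i₂ fun z _ => ?_, c₁.add c₂, a₁.add a₂⟩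
  simp only [hk₁, hk₂]
  split_ifs <;> simp

/-- The operator with kernel `s(x) |x - y|⁻² s(y)` is compact. -/
theorem IsWeight.exists_riesz (hs : IsWeight s A β) :
    ∃ T : L2 →L[ℂ] L2, IsIntegralOperator (weightKernel s fun z => (‖z‖ ^ 2)⁻¹) T ∧
      IsCompactOperator T ∧ IsSelfAdjoint T ∧
      ∃ M : ℝ≥0∞, M ≠ ⊤ ∧ AbsBounded (weightKernel s fun z => (‖z‖ ^ 2)⁻¹) M := by
  have hmeas : Measurable fun z : R4 => (‖z‖ ^ 2)⁻¹ := by fun_prop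
  have heven : ∀ z : R4, (‖-z‖ ^ 2)⁻¹ = (‖z‖ ^ 2)⁻¹ := fun z => by rw [norm_neg]
  have henorm : ∀ z : R4, ‖(‖z‖ ^ 2)⁻¹‖ₑ = ENNReal.ofReal (‖z‖ ^ 2)⁻¹ := fun z =>
    Real.enorm_of_nonneg (by positivity)
  obtain ⟨B, hB, hB'⟩ := exists_lintegral_inv_sq_bracket_le hs.two_lt
  have hb : AbsBounded (weightKernel s fun z => (‖z‖ ^ 2)⁻¹) (ENNReal.ofReal (A ^ 2) * B) := by
    refine hs.absBounded hmeas heven fun x => ?_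
    simp_rw [henorm]
    exact hB' x
  have hM : ENNReal.ofReal (A ^ 2) * B ≠ ⊤ := ENNReal.mul_ne_top ENNReal.ofReal_ne_top hB
  have hK := measurable_weightKernel hs.measurable hmeas
  obtain ⟨T, hT⟩ := hb.exists_isIntegralOperator hK hM
  refine ⟨T, hT, ?_, hT.isSelfAdjoint hK hb hM (weightKernel_comm heven), _, hM, hb⟩
  -- The square of `‖z‖⁻²` is not locally integrable, so a Hilbert–Schmidt bound for the whole
  -- kernel is not available. Cutting at a small radius leaves a Hilbert–Schmidt far part and a near
  -- part of small norm by Schur's test; `T` is then a norm limit of compact operators.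
  have approx : ∀ n : ℕ, ∃ F : L2 →L[ℂ] L2, IsCompactOperator F ∧
      ‖T - F‖ ≤ A ^ 2 * (1 / ((n : ℝ) + 1)) := by
    intro n
    obtain ⟨r, hr, hr'⟩ := exists_lintegral_ball_inv_norm_sq_le
      (ε := ENNReal.ofReal (1 / ((n : ℝ) + 1))) (by rw [ENNReal.ofReal_pos]; positivity)
    have hset : MeasurableSet {z : R4 | ‖z‖ < r} := measurableSet_lt measurable_norm measurable_const
    set k₁ : R4 → ℝ := fun z => if ‖z‖ < r then (‖z‖ ^ 2)⁻¹ else 0 with hk₁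
    set k₂ : R4 → ℝ := fun z => if ‖z‖ < r then 0 else (‖z‖ ^ 2)⁻¹ with hk₂
    have m₁ : Measurable k₁ := Measurable.ite hset hmeas measurable_const
    have m₂ : Measurable k₂ := Measurable.ite hset measurable_const hmeas
    have e₁ : ∀ z, k₁ (-z) = k₁ z := fun z => by simp only [hk₁, norm_neg]
    have e₂ : ∀ z, k₂ (-z) = k₂ z := fun z => by simp only [hk₂, norm_neg]
    have near : AbsBounded (weightKernel s k₁) (ENNReal.ofReal (A ^ 2 * (1 / ((n : ℝ) + 1)))) := by
      rw [ENNReal.ofReal_mul (sq_nonneg A)]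
      refine hs.absBounded m₁ e₁ fun x => le_trans ?_ hr'
      rw [← lintegral_indicator measurableSet_ball, ← lintegral_sub_left_eq_self
        ((Metric.ball (0 : R4) r).indicator fun x => ENNReal.ofReal (‖x‖ ^ 2)⁻¹) x]
      refine lintegral_mono fun y => ?_
      by_cases h : x - y ∈ Metric.ball (0 : R4) r
      · rw [Set.indicator_of_mem h]
        rw [mem_ball_zero_iff] at h
        simp only [hk₁, if_pos h, henorm]
        refine mul_le_of_le_one_right' ?_
        rw [← ENNReal.ofReal_one]
        refine ENNReal.ofReal_le_ofReal (pow_le_one₀ (bracket_pos β y).le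
          (bracket_le_one (by linarith [hs.two_lt]) _))
      · rw [Set.indicator_of_notMem h]
        rw [mem_ball_zero_iff] at h
        simp only [hk₁, if_neg h]
        simp
    obtain ⟨N₂, _, h₂⟩ := hs.exists_hs_bound le_rfl (by linarith [hs.two_lt])
    obtain ⟨T₂, i₂, c₂, _⟩ := exists_compact_selfAdjoint (measurable_weightKernel hs.measurable m₂)
      (weightKernel_comm e₂) ENNReal.ofReal_ne_top (h₂ k₂ (r ^ 2)⁻¹ (by positivity) (by
        intro z
        rw [Real.rpow_zero, mul_one]
        simp only [hk₂]
        split_ifs with h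
        · rw [abs_zero]
          positivity
        · rw [not_lt] at h
          rw [abs_of_nonneg (by positivity)]
          gcongr))
    obtain ⟨T₁, i₁⟩ := near.exists_isIntegralOperator (measurable_weightKernel hs.measurable m₁)
      ENNReal.ofReal_ne_top
    have e : T = T₁ + T₂ := hT.unique (i₁.weight_add i₂ fun z _ => by
      simp only [hk₁, hk₂]
      split_ifs <;> simp)
    refine ⟨T₂, c₂, ?_⟩
    rw [e, add_sub_cancel_right]
    exact i₁.norm_le (by positivity) near
  choose F hF hF' using approx
  refine isCompactOperator_of_tendsto (l := atTop) (F := F) ?_ (Eventually.of_forall hF)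
  rw [tendsto_iff_norm_sub_tendsto_zero]
  have h1 : Tendsto (fun n : ℕ => A ^ 2 * (1 / ((n : ℝ) + 1))) atTop (𝓝 0) := by
    simpa using tendsto_one_div_add_atTop_nhds_zero_nat.const_mul (A ^ 2)
  refine squeeze_zero (fun _ => norm_nonneg _) (fun n => ?_) h1
  rw [norm_sub_rev]
  exact hF' n

end Weight

/-! ### The expansion of `|v|^(1/2) r₀(z) |v|^(1/2)` -/

section Expansion

variable {s : R4 → ℝ} {A β m : ℝ}

theorem IsIntegralOperator.weight_sub {k₁ k₂ k₃ : R4 → ℝ} {T₁ T₂ : L2 →L[ℂ] L2}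
    (h₁ : IsIntegralOperator (weightKernel s k₁) T₁)
    (h₂ : IsIntegralOperator (weightKernel s k₂) T₂)
    (h : ∀ z, z ≠ 0 → k₁ z - k₂ z = k₃ z) : IsIntegralOperator (weightKernel s k₃) (T₁ - T₂) := by
  have h3 := h₁.weight_add (k₃ := k₃) (h₂.weight_smul (-1)) fun z hz => by rw [← h z hz]; ring
  have e : T₁ + ((-1 : ℝ) : ℂ) • T₂ = T₁ - T₂ := by simp [sub_eq_add_neg]
  rwa [e] at h3

theorem isIntegralOperator_sandwich {κ : ℝ} {S R : L2 →L[ℂ] L2}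
    (hS : ∀ ψ, ∀ᵐ x, S ψ x = (s x : ℂ) * ψ x) (hR : IsIntegralOperator (freeKernel m κ) R) :
    IsIntegralOperator (weightKernel s fun z => 2 * m * green κ z) (S ∘L R ∘L S) := by
  intro ψ
  filter_upwards [hS (R (S ψ)), hR (S ψ)] with x h1 h2
  have e : (fun y => (s x : ℂ) * ((freeKernel m κ x y : ℂ) * S ψ y)) =ᵐ[volume]
      fun y => (weightKernel s (fun z => 2 * m * green κ z) x y : ℂ) * ψ y := by
    filter_upwards [hS ψ] with y hy
    rw [hy, weightKernel, freeKernel]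
    push_cast
    ring
  refine ⟨(h2.1.const_mul _).congr e, ?_⟩
  rw [ContinuousLinearMap.comp_apply, ContinuousLinearMap.comp_apply, h1, h2.2, ← integral_const_mul]
  exact integral_congr_ae e

/-- The coefficient of `z ln|z|` in the expansion of the kernel. -/
def logCoeff (m : ℝ) : ℝ := -(m ^ 2 / (4 * Real.pi ^ 2))

/-- The expansion of `macdonald 0` is inserted at `σ = (m/2)|z|‖x‖²`, and `ln σ` is split into `ln
(m/2) + ln|z| + 2 ln‖x‖`. The constants and `2 ln‖x‖` go to the coefficient of `z`, and `ln|z|` to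
that of `z ln|z|`. -/
theorem IsWeight.exists_expansion (hs : IsWeight s A β) (hm : 0 < m) :
    ∃ c θ C : ℝ, 0 < θ ∧ 0 ≤ C ∧ ∀ (S G T₀ T₁ : L2 →L[ℂ] L2),
      (∀ ψ, ∀ᵐ x, S ψ x = (s x : ℂ) * ψ x) →
      IsIntegralOperator (weightKernel s fun z => m / (2 * Real.pi ^ 2) * (‖z‖ ^ 2)⁻¹) G →
      IsIntegralOperator (weightKernel s fun _ => 1) T₀ →
      IsIntegralOperator (weightKernel s fun z => Real.log ‖z‖) T₁ →
      ∀ z : ℝ, z < 0 → ∀ R : L2 →L[ℂ] L2, IsIntegralOperator (freeKernel m (-2 * m * z)) R →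
        hsNorm (S ∘L R ∘L S - (G +
          (z : ℂ) • (((logCoeff m * c : ℝ) : ℂ) • T₀ + ((logCoeff m * 2 : ℝ) : ℂ) • T₁) +
          ((z * Real.log |z| : ℝ) : ℂ) • ((logCoeff m : ℂ) • T₀))) ≤
        ENNReal.ofReal (C * |z| ^ (1 + θ)) := by
  -- `θ < 1` is needed for the expansion of `macdonald 0`, and `2θ < β - 2` for the remainder, which
  -- grows like `‖x - y‖^(2θ)`, to be Hilbert–Schmidt.
  set θ := min (1 / 2) ((β - 2) / 4) with hθ
  have hθ0 : 0 < θ := lt_min (by norm_num) (by linarith [hs.two_lt])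
  have hθ1 : θ < 1 := (min_le_left _ _).trans_lt (by norm_num)
  have hθ2 : 2 * θ < β - 2 := by
    have : θ ≤ (β - 2) / 4 := min_le_right _ _
    linarith [hs.two_lt]
  obtain ⟨c, C, hC, hexp⟩ := exists_macdonald_expansion hθ0 hθ1
  obtain ⟨N, hN, hbound⟩ := hs.exists_hs_bound (a := 2 * θ) (by positivity) hθ2
  set D := m / (2 * Real.pi ^ 2) * C * (m / 2) ^ (1 + θ) with hD
  have hD0 : 0 ≤ D := by positivity
  refine ⟨Real.log (m / 2) + c, θ, D * N, hθ0, by positivity, ?_⟩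
  intro S G T₀ T₁ hS hG hT₀ hT₁ z hz R hR
  have ht : 0 < -z := neg_pos.2 hz
  rw [abs_of_neg hz]
  set e : R4 → ℝ := fun x => m / (2 * Real.pi ^ 2) * (‖x‖ ^ 2)⁻¹ *
    (macdonald 0 (m / 2 * -z * ‖x‖ ^ 2) - 1 - (m / 2 * -z * ‖x‖ ^ 2) *
      Real.log (m / 2 * -z * ‖x‖ ^ 2) - c * (m / 2 * -z * ‖x‖ ^ 2)) with he
  have hσ : Measurable fun x : R4 => m / 2 * -z * ‖x‖ ^ 2 := by fun_prop
  have hem : Measurable e := by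
    refine Measurable.mul (by fun_prop) ?_
    exact ((((measurable_macdonald 0).comp hσ).sub_const 1).sub
      (hσ.mul (Real.measurable_log.comp hσ))).sub (hσ.const_mul c)
  have hebound : ∀ x, |e x| ≤ D * (-z) ^ (1 + θ) * ‖x‖ ^ (2 * θ) := by
    intro x
    -- At the origin the inverse has default value zero, and so has `e`.
    rcases eq_or_lt_of_le (norm_nonneg x) with h0 | h0
    · have : e x = 0 := by
        simp only [he, ← h0]
        norm_num
      rw [this, abs_zero]
      positivity
    · have h1 := hexp (m / 2 * -z * ‖x‖ ^ 2) (by positivity)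
      have h2 : (m / 2 * -z * ‖x‖ ^ 2) ^ (1 + θ) =
          (m / 2) ^ (1 + θ) * (-z) ^ (1 + θ) * (‖x‖ ^ 2 * ‖x‖ ^ (2 * θ)) := by
        rw [Real.mul_rpow (by positivity) (by positivity), Real.mul_rpow (by positivity) ht.le]
        congr 1
        rw [← Real.rpow_natCast, ← Real.rpow_mul h0.le, ← Real.rpow_add h0]
        congr 1
        push_cast
        ring
      simp only [he]
      rw [abs_mul, abs_of_nonneg (by positivity)]
      calc _ ≤ m / (2 * Real.pi ^ 2) * (‖x‖ ^ 2)⁻¹ *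
            (C * (m / 2 * -z * ‖x‖ ^ 2) ^ (1 + θ)) := by gcongr
        _ = _ := by
          rw [h2, hD]
          field_simp
  have hB := isIntegralOperator_sandwich hS hR
  have hsum := (hG.weight_add (k₃ := fun x => m / (2 * Real.pi ^ 2) * (‖x‖ ^ 2)⁻¹ +
      z * (logCoeff m * (Real.log (m / 2) + c) + logCoeff m * 2 * Real.log ‖x‖))
    ((((hT₀.weight_smul (logCoeff m * (Real.log (m / 2) + c))).weight_add
      (hT₁.weight_smul (logCoeff m * 2)) (k₃ := fun x => logCoeff m * (Real.log (m / 2) + c) +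
        logCoeff m * 2 * Real.log ‖x‖) fun x _ => by ring).weight_smul z)) fun x _ => rfl).weight_add
      ((hT₀.weight_smul (logCoeff m)).weight_smul (z * Real.log (-z)))
      (k₃ := fun x => m / (2 * Real.pi ^ 2) * (‖x‖ ^ 2)⁻¹ +
      z * (logCoeff m * (Real.log (m / 2) + c) + logCoeff m * 2 * Real.log ‖x‖) +
      z * Real.log (-z) * logCoeff m) fun x _ => by ring
  have hE := hB.weight_sub hsum (k₃ := e) fun x hx => by
    have h0 := norm_pos_iff.2 hx
    simp only [he, green]
    rw [show -2 * m * z * ‖x‖ ^ 2 / 4 = m / 2 * -z * ‖x‖ ^ 2 by ring,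
      Real.log_mul (by positivity) (by positivity), Real.log_mul (by positivity) ht.ne', Real.log_pow,
      logCoeff]
    field_simp
    push_cast
    ring
  refine hE.hsNorm_le (measurable_weightKernel hs.measurable hem) ?_ ENNReal.ofReal_ne_top
  have := hbound e (D * (-z) ^ (1 + θ)) (by positivity) hebound
  rwa [show D * N * (-z) ^ (1 + θ) = D * (-z) ^ (1 + θ) * N by ring]

end Expansion

/-! ### Functions in `L⁴` -/

theorem memLp_of_homogeneousSobolev {f : R4 → ℝ} (hf : MemHomogeneousSobolev f) :
    MemLp f 4 volume := by
  obtain ⟨hm, u, hu, -, hlim⟩ := hf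
  obtain ⟨n, hn⟩ := (hlim.eventually (gt_mem_nhds (zero_lt_one' ℝ≥0∞))).exists
  have hun : MemLp (u n) 4 volume := (hu n).1.continuous.memLp_of_hasCompactSupport (hu n).2
  have hd : MemLp (fun x => u n x - f x) 4 volume :=
    ⟨hun.1.sub hm, hn.trans ENNReal.one_lt_top⟩
  have h := hun.sub hd
  refine (memLp_congr_ae (ae_of_all _ fun x => ?_)).1 h
  simp

theorem integrable_pow_four {f : R4 → ℝ} (hf : MemLp f 4 volume) :
    Integrable fun x => |f x| ^ 4 := by
  have h := hf.integrable_norm_rpow (by norm_num) (by norm_num)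
  refine h.congr (ae_of_all _ fun x => ?_)
  simp only [ENNReal.toReal_ofNat, Real.norm_eq_abs]
  exact Real.rpow_natCast |f x| 4

theorem mul_le_rpow_add_pow_four {a b : ℝ} (ha : 0 ≤ a) (hb : 0 ≤ b) :
    a * b ≤ a ^ (4 / 3 : ℝ) + b ^ 4 := by
  have h := Real.young_inequality_of_nonneg ha hb (p := 4 / 3) (q := 4)
    (Real.holderConjugate_iff.2 ⟨by norm_num, by norm_num⟩)
  have e : b ^ (4 : ℝ) = b ^ 4 := Real.rpow_natCast b 4
  rw [e] at h
  have h1 : 0 ≤ a ^ (4 / 3 : ℝ) := Real.rpow_nonneg ha _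
  have h2 : 0 ≤ b ^ 4 := by positivity
  linarith

/-- Young's inequality with exponents `4/3` and `4` replaces Hölder: its additive bound suffices for
estimates that are uniform in a parameter. -/
theorem integrable_mul_abs_of_rpow {f g : R4 → ℝ} (hf : MemLp f 4 volume)
    (hg : AEStronglyMeasurable g volume) (hg0 : ∀ x, 0 ≤ g x)
    (hgi : Integrable fun x => g x ^ (4 / 3 : ℝ)) :
    Integrable (fun x => g x * |f x|) ∧
      ∫ x, g x * |f x| ≤ (∫ x, g x ^ (4 / 3 : ℝ)) + ∫ x, |f x| ^ 4 := by
  have hle : ∀ x, g x * |f x| ≤ g x ^ (4 / 3 : ℝ) + |f x| ^ 4 := fun x =>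
    mul_le_rpow_add_pow_four (hg0 x) (abs_nonneg _)
  have hi := hgi.add (integrable_pow_four hf)
  have hI : Integrable (fun x => g x * |f x|) := by
    refine hi.mono' (hg.mul hf.1.norm) (ae_of_all _ fun x => ?_)
    rw [Real.norm_of_nonneg (mul_nonneg (hg0 x) (abs_nonneg _))]
    exact hle x
  refine ⟨hI, ?_⟩
  rw [← integral_add hgi (integrable_pow_four hf)]
  exact integral_mono hI hi hle

theorem bracket_rpow (β γ : ℝ) (x : R4) : bracket β x ^ γ = bracket (β * γ) x := by
  unfold bracket
  rw [← Real.rpow_mul (by positivity), neg_mul]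

/-- The threshold `3` is where `bracket β` enters `L^(4/3)`, the dual of `L⁴`. -/
theorem integrable_bracket_mul_abs {f : R4 → ℝ} (hf : MemLp f 4 volume) {β : ℝ} (hβ : 3 < β) :
    Integrable fun x => bracket β x * |f x| := by
  refine (integrable_mul_abs_of_rpow hf (measurable_bracket β).aestronglyMeasurable
    (fun x => (bracket_pos β x).le) ?_).1
  simp only [bracket_rpow]
  exact integrable_bracket (by linarith)

/-! ### Extension of the weak equation to Schwartz functions -/

theorem abs_laplacian_le (g : R4 → ℝ) (x : R4) :
    |Δ g x| ≤ 4 * ‖iteratedFDeriv ℝ 2 g x‖ := by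
  rw [InnerProductSpace.laplacian_eq_iteratedFDeriv_stdOrthonormalBasis]
  refine (Finset.abs_sum_le_sum_abs _ _).trans ?_
  have h : ∀ i, |iteratedFDeriv ℝ 2 g x ![(stdOrthonormalBasis ℝ R4) i,
      (stdOrthonormalBasis ℝ R4) i]| ≤ ‖iteratedFDeriv ℝ 2 g x‖ := by
    intro i
    refine ((iteratedFDeriv ℝ 2 g x).le_opNorm _).trans (le_of_eq ?_)
    simp [Fin.prod_univ_two]
  refine (Finset.sum_le_sum fun i _ => h i).trans (le_of_eq ?_)
  simp

/-- Dilations of one bump function by `n + 1 ≥ 1`, which do not increase derivatives. -/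
theorem exists_cutoff : ∃ (χ : ℕ → R4 → ℝ) (M : ℝ), 0 ≤ M ∧
    (∀ n, ContDiff ℝ ∞ (χ n)) ∧ (∀ n, HasCompactSupport (χ n)) ∧
    (∀ n, ∀ i ≤ 2, ∀ x, ‖iteratedFDeriv ℝ i (χ n) x‖ ≤ M) ∧
    ∀ x, ∀ᶠ n in atTop, χ n =ᶠ[𝓝 x] 1 := by
  let b : ContDiffBump (0 : R4) := ⟨1, 2, one_pos, one_lt_two⟩
  have hbound : ∀ i : ℕ, ∃ C, ∀ x, ‖iteratedFDeriv ℝ i b x‖ ≤ C := fun i =>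
    (b.contDiff.continuous_iteratedFDeriv (m := i) (n := ∞) (by exact_mod_cast le_top)).bounded_above_of_compact_support
      (b.hasCompactSupport.iteratedFDeriv i)
  choose C hC using hbound
  have hC0 : ∀ i, 0 ≤ C i := fun i => (norm_nonneg _).trans (hC i 0)
  have hpos : ∀ n : ℕ, (0 : ℝ) < ((n : ℝ) + 1)⁻¹ := fun n => by positivity
  refine ⟨fun n x => b (((n : ℝ) + 1)⁻¹ • x), C 0 + C 1 + C 2, ?_, ?_, ?_, ?_, ?_⟩
  · linarith [hC0 0, hC0 1, hC0 2]
  · exact fun n => b.contDiff.comp (contDiff_const_smul _)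
  · exact fun n => b.hasCompactSupport.comp_smul (hpos n).ne'
  · intro n i hi x
    rw [iteratedFDeriv_comp_const_smul (𝕜 := ℝ) (i := i) _ b.contDiff, norm_smul]
    have h1 : ‖(((n : ℝ) + 1)⁻¹) ^ i‖ ≤ 1 := by
      rw [Real.norm_of_nonneg (by positivity)]
      exact pow_le_one₀ (hpos n).le (inv_le_one_of_one_le₀ (by linarith [n.cast_nonneg (α := ℝ)]))
    have h2 : C i ≤ C 0 + C 1 + C 2 := by
      interval_cases i <;> linarith [hC0 0, hC0 1, hC0 2]
    calc _ ≤ 1 * C i := mul_le_mul h1 (hC _ _) (norm_nonneg _) zero_le_one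
      _ ≤ _ := by rwa [one_mul]
  · intro x
    obtain ⟨N, hN⟩ := exists_nat_gt ‖x‖
    filter_upwards [eventually_ge_atTop N] with n hn
    have hcont : Continuous fun y : R4 => ((n : ℝ) + 1)⁻¹ • y := continuous_const_smul _
    refine hcont.continuousAt.eventually
      (b.eventuallyEq_one_of_mem_ball (x := ((n : ℝ) + 1)⁻¹ • x) ?_)
    have hn' : (N : ℝ) ≤ n := by exact_mod_cast hn
    rw [mem_ball_zero_iff, norm_smul, Real.norm_of_nonneg (hpos n).le]
    change ((n : ℝ) + 1)⁻¹ * ‖x‖ < 1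
    rw [inv_mul_lt_one₀ (by positivity)]
    linarith

/-- The power `5` exceeds the `3` required for pairing with `L⁴`. -/
theorem exists_schwartz_bound (η : 𝓢(R4, ℝ)) :
    ∃ B : ℝ, 0 ≤ B ∧ ∀ i ≤ 2, ∀ x, ‖iteratedFDeriv ℝ i η x‖ ≤ B * bracket 5 x := by
  refine ⟨2 ^ 5 * (Finset.Iic (5, 2)).sup (fun m => SchwartzMap.seminorm ℝ m.1 m.2) η,
    by positivity, fun i hi x => ?_⟩
  have h := SchwartzMap.one_add_le_sup_seminorm_apply (𝕜 := ℝ) (m := (5, 2)) (k := 5) (n := i)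
    le_rfl hi η x
  have hp : (0 : ℝ) < (1 + ‖x‖) ^ 5 := by positivity
  have e : bracket 5 x = ((1 + ‖x‖) ^ 5)⁻¹ := by
    unfold bracket
    rw [Real.rpow_neg (by positivity)]
    congr 1
    exact Real.rpow_natCast _ 5
  rw [e, ← div_eq_mul_inv, le_div_iff₀ hp, mul_comm]
  exact h

theorem norm_iteratedFDeriv_mul_schwartz_le {χ : R4 → ℝ} {M B : ℝ} (hχ : ContDiff ℝ ∞ χ)
    (hM0 : 0 ≤ M) (hM : ∀ i ≤ 2, ∀ x, ‖iteratedFDeriv ℝ i χ x‖ ≤ M) (η : 𝓢(R4, ℝ))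
    (hB : ∀ i ≤ 2, ∀ x, ‖iteratedFDeriv ℝ i η x‖ ≤ B * bracket 5 x) {i : ℕ} (hi : i ≤ 2) (x : R4) :
    ‖iteratedFDeriv ℝ i (fun y => χ y * η y) x‖ ≤ 4 * M * B * bracket 5 x := by
  refine (norm_iteratedFDeriv_mul_le (N := ∞) hχ (η.smooth _) x (by exact_mod_cast le_top)).trans ?_
  have h : ∀ j ∈ Finset.range (i + 1), (i.choose j : ℝ) * ‖iteratedFDeriv ℝ j χ x‖ *
      ‖iteratedFDeriv ℝ (i - j) η x‖ ≤ (i.choose j : ℝ) * (M * (B * bracket 5 x)) := by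
    intro j hj
    rw [Finset.mem_range] at hj
    rw [mul_assoc]
    refine mul_le_mul_of_nonneg_left ?_ (by positivity)
    exact mul_le_mul (hM j (by omega) x) (hB _ (by omega) x) (norm_nonneg _) hM0
  refine (Finset.sum_le_sum h).trans ?_
  rw [← Finset.sum_mul]
  have hs : ∑ j ∈ Finset.range (i + 1), (i.choose j : ℝ) = 2 ^ i := by
    exact_mod_cast Nat.sum_range_choose i
  have hnn : 0 ≤ M * (B * bracket 5 x) :=
    mul_nonneg hM0 ((norm_nonneg _).trans (hB 0 (by norm_num) x))
  rw [hs]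
  have h4 : (2 : ℝ) ^ i ≤ 4 := by interval_cases i <;> norm_num
  calc (2 : ℝ) ^ i * (M * (B * bracket 5 x)) ≤ 4 * (M * (B * bracket 5 x)) := by gcongr
    _ = _ := by ring

theorem aestronglyMeasurable_laplacian {g : R4 → ℝ} (hg : ContDiff ℝ ∞ g) :
    AEStronglyMeasurable (Δ g) volume := by
  rw [InnerProductSpace.laplacian_eq_iteratedFDeriv_stdOrthonormalBasis]
  have hc' : ∀ k : ℕ, Continuous (iteratedFDeriv ℝ k g) := fun k =>
    hg.continuous_iteratedFDeriv (m := k) (n := ∞) (by exact_mod_cast le_top)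
  have hc := hc' 2
  refine Continuous.aestronglyMeasurable ?_
  refine continuous_finsetSum _ fun i _ => ?_
  fun_prop

/-- The solution of `(κ - Δ) η = g` need not have compact support even if `g` has, so the class of
test functions must be enlarged. Cutoffs and dominated convergence, with a majorant proportional to
`bracket 5 x * |f x|`, achieve this. -/
theorem IsZeroSolution.schwartz {m M₀ : ℝ} {v f : R4 → ℝ} (h : IsZeroSolution m v f)
    (hf : MemLp f 4 volume) (hv : AEStronglyMeasurable v volume) (hvM : ∀ᵐ x, |v x| ≤ M₀)
    (η : 𝓢(R4, ℝ)) :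
    ∫ x, f x * (-(1 / (2 * m)) * Δ (η : R4 → ℝ) x + v x * η x) = 0 := by
  obtain ⟨χ, M, hM0, hχ, hχc, hM, hχ1⟩ := exists_cutoff
  obtain ⟨B, hB0, hB⟩ := exists_schwartz_bound η
  have hsm : ∀ n, ContDiff ℝ ∞ fun y => χ n y * η y := fun n => (hχ n).mul (η.smooth ⊤)
  have h0 : ∀ n, ∫ x, f x * (-(1 / (2 * m)) * Δ (fun y => χ n y * η y) x +
      v x * (χ n x * η x)) = 0 := fun n => h _ (hsm n) (hχc n).mul_right
  have hlim := tendsto_integral_of_dominated_convergence (μ := volume)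
    (F := fun n x => f x * (-(1 / (2 * m)) * Δ (fun y => χ n y * η y) x + v x * (χ n x * η x)))
    (f := fun x => f x * (-(1 / (2 * m)) * Δ (η : R4 → ℝ) x + v x * η x))
    (fun x => (|1 / (2 * m)| * 4 + M₀) * (4 * M * B) * (bracket 5 x * |f x|)) ?_ ?_ ?_ ?_
  · simp only [h0] at hlim
    exact tendsto_nhds_unique hlim tendsto_const_nhds
  · intro n
    exact hf.1.mul (((aestronglyMeasurable_laplacian (hsm n)).const_mul _).add
      (hv.mul (hsm n).continuous.aestronglyMeasurable))
  · exact (integrable_bracket_mul_abs hf (by norm_num)).const_mul _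
  · intro n
    filter_upwards [hvM] with x hx
    have h2 := (abs_laplacian_le (fun y => χ n y * η y) x).trans
      (mul_le_mul_of_nonneg_left (norm_iteratedFDeriv_mul_schwartz_le (hχ n) hM0 (hM n) η hB
        le_rfl x) (by norm_num))
    have h1 := norm_iteratedFDeriv_mul_schwartz_le (hχ n) hM0 (hM n) η hB (Nat.zero_le 2) x
    rw [norm_iteratedFDeriv_zero, Real.norm_eq_abs] at h1
    set P := 4 * M * B * bracket 5 x with hP
    rw [norm_mul, Real.norm_eq_abs, Real.norm_eq_abs]
    calc |f x| * |-(1 / (2 * m)) * Δ (fun y => χ n y * η y) x + v x * (χ n x * η x)|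
        ≤ |f x| * (|1 / (2 * m)| * (4 * P) + M₀ * P) := by
          refine mul_le_mul_of_nonneg_left ((abs_add_le _ _).trans ?_) (abs_nonneg _)
          rw [abs_mul, abs_mul (v x), abs_neg]
          exact add_le_add (mul_le_mul_of_nonneg_left h2 (abs_nonneg _))
            (mul_le_mul hx h1 (abs_nonneg _) ((abs_nonneg _).trans hx))
      _ = _ := by rw [hP]; ring
  · refine ae_of_all _ fun x => tendsto_const_nhds.congr' ?_
    filter_upwards [hχ1 x] with n hn
    have he : (fun y => χ n y * η y) =ᶠ[𝓝 x] η := by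
      filter_upwards [hn] with y hy
      rw [hy, Pi.one_apply, one_mul]
    rw [(InnerProductSpace.laplacian_congr_nhds he).eq_of_nhds, hn.eq_of_nhds, Pi.one_apply,
      one_mul]

/-! ### Uniform bounds for the Green function -/

/-- The majorant `|x|⁻² (1 + |x|²)⁻¹` of `κ g_κ`, `0 < κ ≤ 1`. -/
def greenMajorant (x : R4) : ℝ := (‖x‖ ^ 2 * (1 + ‖x‖ ^ 2))⁻¹

theorem measurable_greenMajorant : Measurable greenMajorant := by
  unfold greenMajorant
  fun_prop

theorem greenMajorant_nonneg (x : R4) : 0 ≤ greenMajorant x := by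
  unfold greenMajorant
  positivity

theorem macdonald_zero_le_two_div {σ : ℝ} (hσ : 0 ≤ σ) : macdonald 0 σ ≤ 2 / (1 + σ) := by
  rw [le_div_iff₀ (by positivity)]
  rcases hσ.eq_or_lt with rfl | h
  · have := macdonald_zero_le_one le_rfl
    linarith
  · have h1 := macdonald_zero_le_one hσ
    have h2 := macdonald_zero_le_inv h
    rw [le_div_iff₀ h] at h2
    linarith

/-- The factor `κ` buys decay like `‖x‖⁻⁴` uniformly in `κ`, from `κ M(κr/4) ≤ 8 / (1 + r)` with `r
= ‖x‖²`; `4π² ≥ 8` absorbs the constant. -/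
theorem mul_green_le {κ : ℝ} (hκ : 0 < κ) (hκ1 : κ ≤ 1) (x : R4) :
    κ * green κ x ≤ greenMajorant x := by
  rcases eq_or_ne x 0 with rfl | hx
  · simp [green, greenMajorant]
  have hr : 0 < ‖x‖ ^ 2 := by have := norm_pos_iff.2 hx; positivity
  unfold green greenMajorant
  set r := ‖x‖ ^ 2 with hr_def
  have h1 := macdonald_zero_le_two_div (σ := κ * r / 4) (by positivity)
  have hpi : 8 ≤ 4 * Real.pi ^ 2 := by nlinarith [Real.pi_gt_three]
  have h2 : κ * macdonald 0 (κ * r / 4) ≤ 8 / (1 + r) := by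
    calc κ * macdonald 0 (κ * r / 4) ≤ κ * (2 / (1 + κ * r / 4)) := by gcongr
      _ ≤ 8 / (1 + r) := by
        rw [mul_div_assoc', div_le_div_iff₀ (by positivity) (by positivity)]
        nlinarith [mul_pos hκ hr]
  calc κ * (macdonald 0 (κ * r / 4) / (4 * Real.pi ^ 2 * r))
      = κ * macdonald 0 (κ * r / 4) / (4 * Real.pi ^ 2 * r) := by ring
    _ ≤ (8 / (1 + r)) / (8 * r) := by gcongr
    _ = (r * (1 + r))⁻¹ := by field_simp

/-- With `r = ‖x‖²`, this is `1/r = 1/(r(1+r)) + 1/(1+r)`: a part in `L^(4/3)` and a bounded part.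
-/
theorem green_zero_le (x : R4) : green 0 x ≤ greenMajorant x + 1 := by
  rw [green_zero]
  rcases eq_or_ne x 0 with rfl | hx
  · simp [greenMajorant]
  have hr : 0 < ‖x‖ ^ 2 := by have := norm_pos_iff.2 hx; positivity
  unfold greenMajorant
  set r := ‖x‖ ^ 2 with hr_def
  have hpi : 1 ≤ 4 * Real.pi ^ 2 := by nlinarith [Real.pi_gt_three]
  calc 1 / (4 * Real.pi ^ 2 * r) ≤ 1 / (1 * r) := by gcongr
    _ = (r * (1 + r))⁻¹ + 1 / (1 + r) := by field_simp
    _ ≤ (r * (1 + r))⁻¹ + 1 := by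
      gcongr
      rw [div_le_one (by positivity)]
      linarith

theorem greenMajorant_rpow_le_near (x : R4) :
    greenMajorant x ^ (4 / 3 : ℝ) ≤ ‖x‖ ^ (-(8 / 3) : ℝ) := by
  have h : greenMajorant x ≤ (‖x‖ ^ 2)⁻¹ := by
    rcases eq_or_ne x 0 with rfl | hx
    · simp [greenMajorant]
    have hr : 0 < ‖x‖ ^ 2 := by have := norm_pos_iff.2 hx; positivity
    exact inv_anti₀ hr (by nlinarith)
  refine (Real.rpow_le_rpow (greenMajorant_nonneg x) h (by norm_num)).trans (le_of_eq ?_)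
  rw [← Real.rpow_natCast, ← Real.rpow_neg (norm_nonneg x), ← Real.rpow_mul (norm_nonneg x)]
  norm_num

theorem greenMajorant_le_bracket {x : R4} (hx : 1 ≤ ‖x‖) :
    greenMajorant x ≤ 8 * bracket 4 x := by
  have e : bracket 4 x = ((1 + ‖x‖) ^ 4)⁻¹ := by
    unfold bracket
    rw [Real.rpow_neg (by positivity)]
    congr 1
    exact Real.rpow_natCast _ 4
  rw [e]
  unfold greenMajorant
  set t := ‖x‖
  have h1 : (1 + t) ^ 2 ≤ 4 * t ^ 2 := by nlinarith
  have h2 : (1 + t) ^ 2 ≤ 2 * (1 + t ^ 2) := by nlinarith [sq_nonneg (1 - t)]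
  rw [← div_eq_mul_inv, inv_eq_one_div, div_le_div_iff₀ (by positivity) (by positivity)]
  calc 1 * (1 + t) ^ 4 = (1 + t) ^ 2 * (1 + t) ^ 2 := by ring
    _ ≤ (4 * t ^ 2) * (2 * (1 + t ^ 2)) := by gcongr
    _ = _ := by ring

/-- The power behaves like `‖x‖^(-8/3)` at the origin and `‖x‖^(-16/3)` at infinity, and `8/3 < 4 <
16/3`. Hence the majorant pairs with `L⁴`. -/
theorem integrable_greenMajorant_rpow :
    Integrable fun x => greenMajorant x ^ (4 / 3 : ℝ) := by
  have hm : Measurable fun x => greenMajorant x ^ (4 / 3 : ℝ) := measurable_greenMajorant.pow_const _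
  rw [← integrableOn_univ, ← Set.union_compl_self (Metric.closedBall (0 : R4) 1)]
  refine IntegrableOn.union ?_ ?_
  · have hl : LocallyIntegrable (fun x : R4 => greenMajorant x ^ (4 / 3 : ℝ)) := by
      refine locallyIntegrable_of_norm_le_rpow (C := 1) (α := 8 / 3) (by simp) (by simp; norm_num)
        (ae_of_all _ fun x => ?_) hm.aestronglyMeasurable
      rw [one_mul, Real.norm_of_nonneg (Real.rpow_nonneg (greenMajorant_nonneg x) _)]
      exact greenMajorant_rpow_le_near x
    exact hl.integrableOn_isCompact (isCompact_closedBall 0 1)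
  · have hb : IntegrableOn (fun x => 8 ^ (4 / 3 : ℝ) * bracket (4 * (4 / 3)) x)
        (Metric.closedBall (0 : R4) 1)ᶜ :=
      ((integrable_bracket (by norm_num)).const_mul _).integrableOn
    refine hb.mono' hm.aestronglyMeasurable.restrict ?_
    refine (ae_restrict_iff' Metric.isClosed_closedBall.measurableSet.compl).2
      (ae_of_all _ fun x hx => ?_)
    have hx' : 1 ≤ ‖x‖ := by
      simp only [Set.mem_compl_iff, Metric.mem_closedBall, dist_zero_right, not_le] at hx
      exact hx.le
    rw [Real.norm_of_nonneg (Real.rpow_nonneg (greenMajorant_nonneg x) _), ← bracket_rpow,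
      ← Real.mul_rpow (by norm_num) (bracket_pos _ _).le]
    exact Real.rpow_le_rpow (greenMajorant_nonneg x) (greenMajorant_le_bracket hx') (by norm_num)

/-! ### Real solutions of the Helmholtz equation -/

theorem exists_real_solve {κ : ℝ} (hκ : 0 < κ) (ζ : 𝓢(R4, ℝ)) :
    ∃ η : 𝓢(R4, ℝ), (∀ x, Δ (η : R4 → ℝ) x = κ * η x - ζ x) ∧
      ∀ x, η x = ∫ y, green κ (x - y) * ζ y := by
  let ζ' : 𝓢(R4, ℂ) := ζ.postcompCLM Complex.ofRealCLM
  let η' : 𝓢(R4, ℂ) := solve κ ζ'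
  have hval : ∀ x, η' x = ((∫ y, green κ (x - y) * ζ y : ℝ) : ℂ) := by
    intro x
    rw [solve_apply hκ, ← integral_complex_ofReal]
    refine integral_congr_ae (ae_of_all _ fun y => ?_)
    simp [ζ']
  have hco : ∀ x, (η'.postcompCLM Complex.reCLM : 𝓢(R4, ℝ)) x = (η' x).re := fun x => by simp
  refine ⟨η'.postcompCLM Complex.reCLM, fun x => ?_, fun x => ?_⟩
  · have hcomp : ((η'.postcompCLM Complex.reCLM : 𝓢(R4, ℝ)) : R4 → ℝ) =
        Complex.reCLM ∘ (η' : R4 → ℂ) := by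
      ext x
      simp
    have hH := congrArg (fun ξ : 𝓢(R4, ℂ) => ξ x) (helmholtz_solve hκ ζ')
    simp only [_root_.sub_apply, _root_.smul_apply] at hH
    rw [hcomp, ContDiffAt.laplacian_CLM_comp_left ((η'.smooth 2).contDiffAt)]
    rw [SchwartzMap.laplacian_apply] at hH
    have hre := congrArg Complex.re hH
    have hz : (ζ' x).re = ζ x := by simp [ζ']
    rw [Complex.sub_re, hz, smul_eq_mul, Complex.re_ofReal_mul] at hre
    simp only [Function.comp_apply, Complex.reCLM_apply]
    change κ * (η' x).re - _ = _ at hre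
    change (Δ (η' : R4 → ℂ) x).re = _
    linarith
  · rw [hco, hval, Complex.ofReal_re]

/-! ### The integral equation for zero solutions -/

section Zero

variable {m A β : ℝ} {s v f : R4 → ℝ}

theorem IsWeight.sq_le (hs : IsWeight s A β) (x : R4) : s x ^ 2 ≤ A ^ 2 * bracket (2 * β) x := by
  rw [← bracket_sq, ← mul_pow]
  exact pow_le_pow_left₀ (hs.nonneg x) (hs.le x) 2

/-- A majorant of `g_κ (x - y) (κ + 2 m s(y)²)`, uniformly in `0 < κ ≤ 1`. -/
def sourceMajorant (m A : ℝ) (s : R4 → ℝ) (x y : R4) : ℝ :=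
  (1 + 2 * m * A ^ 2) * greenMajorant (x - y) + 2 * m * s y ^ 2

theorem IsWeight.sq_le_const (hs : IsWeight s A β) (x : R4) : s x ^ 2 ≤ A ^ 2 := by
  refine (hs.sq_le x).trans (mul_le_of_le_one_right (sq_nonneg A) (bracket_le_one ?_ x))
  linarith [hs.two_lt]

/-- The term with `κ` uses `mul_green_le`. In the other one the decay of `s²` compensates for the
bounded, nondecaying part of `green_zero_le`. -/
theorem green_mul_le (hm : 0 < m) (hs : IsWeight s A β) {κ : ℝ} (hκ : 0 < κ) (hκ1 : κ ≤ 1)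
    (x y : R4) : green κ (x - y) * (κ + 2 * m * s y ^ 2) ≤ sourceMajorant m A s x y := by
  have h1 := mul_green_le hκ hκ1 (x - y)
  have h2 := (green_le_green_zero hκ.le (x - y)).trans (green_zero_le (x - y))
  have h3 := hs.sq_le_const y
  have h4 := greenMajorant_nonneg (x - y)
  unfold sourceMajorant
  have h5 : green κ (x - y) * (2 * m * s y ^ 2) ≤
      (greenMajorant (x - y) + 1) * (2 * m * s y ^ 2) := by gcongr
  have h6 : greenMajorant (x - y) * (2 * m * s y ^ 2) ≤
      greenMajorant (x - y) * (2 * m * A ^ 2) := by gcongr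
  linarith

theorem integrable_sq_mul_abs (hs : IsWeight s A β) (hf : MemLp f 4 volume) :
    Integrable fun y => s y ^ 2 * |f y| := by
  have hb := (integrable_bracket_mul_abs hf (β := 2 * β) (by linarith [hs.two_lt])).const_mul (A ^ 2)
  refine hb.mono' ((hs.measurable.pow_const 2).aestronglyMeasurable.mul hf.1.norm)
    (ae_of_all _ fun y => ?_)
  rw [Real.norm_of_nonneg (by positivity), ← mul_assoc]
  exact mul_le_mul_of_nonneg_right (hs.sq_le y) (abs_nonneg _)

/-- The bound is independent of `x` because the norm of `greenMajorant` in `L^(4/3)` is translation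
invariant. -/
theorem exists_sourceMajorant_bound (hm : 0 < m) (hs : IsWeight s A β) (hf : MemLp f 4 volume) :
    ∃ N, ∀ x, Integrable (fun y => sourceMajorant m A s x y * |f y|) ∧
      ∫ y, sourceMajorant m A s x y * |f y| ≤ N := by
  refine ⟨(1 + 2 * m * A ^ 2) * ((∫ y, greenMajorant y ^ (4 / 3 : ℝ)) + ∫ y, |f y| ^ 4) +
    2 * m * ∫ y, s y ^ 2 * |f y|, fun x => ?_⟩
  obtain ⟨h1, h2⟩ := integrable_mul_abs_of_rpow (g := fun y => greenMajorant (x - y)) hf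
    (measurable_greenMajorant.comp (measurable_const.sub measurable_id) :
      Measurable fun y => greenMajorant (x - y)).aestronglyMeasurable
    (fun y => greenMajorant_nonneg _) (integrable_greenMajorant_rpow.comp_sub_left x)
  have e : (∫ y, greenMajorant (x - y) ^ (4 / 3 : ℝ)) = ∫ y, greenMajorant y ^ (4 / 3 : ℝ) :=
    integral_sub_left_eq_self (fun y => greenMajorant y ^ (4 / 3 : ℝ)) volume x
  rw [e] at h2
  have h3 := integrable_sq_mul_abs hs hf
  have h : (fun y => sourceMajorant m A s x y * |f y|) = fun y =>
      (1 + 2 * m * A ^ 2) * (greenMajorant (x - y) * |f y|) + 2 * m * (s y ^ 2 * |f y|) := by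
    ext y
    unfold sourceMajorant
    ring
  rw [h]
  refine ⟨(h1.const_mul _).add (h3.const_mul _), ?_⟩
  rw [integral_add (h1.const_mul _) (h3.const_mul _), integral_const_mul, integral_const_mul]
  gcongr

theorem abs_source_le (hm : 0 < m) (hs : IsWeight s A β) {κ : ℝ} (hκ : 0 < κ) (hκ1 : κ ≤ 1)
    (x y : R4) : ‖green κ (x - y) * ((κ + 2 * m * s y ^ 2) * f y)‖ ≤
      sourceMajorant m A s x y * |f y| := by
  rw [← mul_assoc, norm_mul, Real.norm_eq_abs (f y)]
  refine mul_le_mul_of_nonneg_right ?_ (abs_nonneg _)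
  rw [Real.norm_of_nonneg (mul_nonneg (green_nonneg _ _) (by positivity))]
  exact green_mul_le hm hs hκ hκ1 x y

theorem aestronglyMeasurable_source (hs : IsWeight s A β) (hf : MemLp f 4 volume) (κ : ℝ) :
    AEStronglyMeasurable (fun q : R4 × R4 =>
      green κ (q.1 - q.2) * ((κ + 2 * m * s q.2 ^ 2) * f q.2)) (volume.prod volume) := by
  have h1 : Measurable fun q : R4 × R4 => green κ (q.1 - q.2) :=
    (measurable_green κ).comp (measurable_fst.sub measurable_snd)
  have h2 : Measurable fun q : R4 × R4 => κ + 2 * m * s q.2 ^ 2 :=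
    (((hs.measurable.comp measurable_snd).pow_const 2).const_mul _).const_add _
  exact h1.aestronglyMeasurable.mul (h2.aestronglyMeasurable.mul
    (hf.1.comp_quasiMeasurePreserving Measure.quasiMeasurePreserving_snd))

/-- The equation reads `(κ - Δ) f = (κ + 2m s²) f`. It is inverted by duality: the weak equation is
tested with the solution `η` of `(κ - Δ) η = g`, and Fubini transfers the Green function from `g` to
the source. -/
theorem IsZeroSolution.ae_eq_green (hm : 0 < m) (hs : IsWeight s A β)
    (hv : ∀ᵐ x, v x = -(s x ^ 2)) (hf : MemLp f 4 volume) (h : IsZeroSolution m v f)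
    {κ : ℝ} (hκ : 0 < κ) (hκ1 : κ ≤ 1) :
    ∀ᵐ x, f x = ∫ y, green κ (x - y) * ((κ + 2 * m * s y ^ 2) * f y) := by
  obtain ⟨N, hN⟩ := exists_sourceMajorant_bound hm hs hf
  have hmeas := aestronglyMeasurable_source (m := m) hs hf κ
  have hint : ∀ x, Integrable fun y => green κ (x - y) * ((κ + 2 * m * s y ^ 2) * f y) := by
    intro x
    refine (hN x).1.mono' ?_ (ae_of_all _ fun y => abs_source_le hm hs hκ hκ1 x y)
    have h1 : Measurable fun y => green κ (x - y) :=
      (measurable_green κ).comp (measurable_const.sub measurable_id)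
    have h2 : Measurable fun y => κ + 2 * m * s y ^ 2 :=
      ((hs.measurable.pow_const 2).const_mul _).const_add _
    exact h1.aestronglyMeasurable.mul (h2.aestronglyMeasurable.mul hf.1)
  have hnorm : ∀ x, ∫ y, ‖green κ (x - y) * ((κ + 2 * m * s y ^ 2) * f y)‖ ≤ N := fun x =>
    (integral_mono (hint x).norm (hN x).1 fun y => abs_source_le hm hs hκ hκ1 x y).trans (hN x).2
  have hum := hmeas.integral_prod_right'
  have huloc : LocallyIntegrable
      (fun x => ∫ y, green κ (x - y) * ((κ + 2 * m * s y ^ 2) * f y)) volume :=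
    (memLp_top_of_bound hum N (ae_of_all _ fun x =>
      (norm_integral_le_integral_norm _).trans (hnorm x))).locallyIntegrable (by simp)
  have hfloc : LocallyIntegrable f volume := hf.locallyIntegrable (by norm_num)
  refine ae_eq_of_integral_contDiff_smul_eq hfloc huloc fun g hg hgc => ?_
  have hgi : Integrable g := hg.continuous.integrable_of_hasCompactSupport hgc
  obtain ⟨η, hηΔ, hη⟩ := exists_real_solve hκ (hgc.toSchwartzMap hg)
  have hζ : ∀ x, (hgc.toSchwartzMap hg) x = g x := fun x => rfl
  simp only [hζ] at hηΔ hη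
  have hprod : Integrable (fun q : R4 × R4 =>
      g q.1 * (green κ (q.1 - q.2) * ((κ + 2 * m * s q.2 ^ 2) * f q.2))) (volume.prod volume) := by
    refine (integrable_prod_iff ((hgi.1.comp_quasiMeasurePreserving
      Measure.quasiMeasurePreserving_fst).mul hmeas)).2 ⟨ae_of_all _ fun x => ?_, ?_⟩
    · exact (hint x).const_mul (g x)
    · refine (hgi.norm.mul_const N).mono' ?_ (ae_of_all _ fun x => ?_)
      · exact (((hgi.1.comp_quasiMeasurePreserving
          Measure.quasiMeasurePreserving_fst).mul hmeas).norm).integral_prod_right'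
      · have e : ∫ y, ‖g x * (green κ (x - y) * ((κ + 2 * m * s y ^ 2) * f y))‖ =
            ‖g x‖ * ∫ y, ‖green κ (x - y) * ((κ + 2 * m * s y ^ 2) * f y)‖ := by
          rw [← integral_const_mul]
          exact integral_congr_ae (ae_of_all _ fun y => norm_mul _ _)
        change ‖∫ y, ‖g x * (green κ (x - y) * ((κ + 2 * m * s y ^ 2) * f y))‖‖ ≤ ‖g x‖ * N
        rw [e, norm_mul, norm_norm, Real.norm_of_nonneg (integral_nonneg fun y => norm_nonneg _)]
        exact mul_le_mul_of_nonneg_left (hnorm x) (norm_nonneg _)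
  have hswap : ∀ y, ∫ x, g x * (green κ (x - y) * ((κ + 2 * m * s y ^ 2) * f y)) =
      (κ + 2 * m * s y ^ 2) * f y * η y := by
    intro y
    rw [hη, ← integral_const_mul]
    refine integral_congr_ae (ae_of_all _ fun x => ?_)
    simp only
    rw [green_sub_comm κ y x]
    ring
  have hηi : Integrable fun y => (κ + 2 * m * s y ^ 2) * f y * η y :=
    hprod.integral_prod_right.congr (ae_of_all _ fun y => hswap y)
  have hgf : Integrable fun x => g x * f x :=
    hfloc.integrable_smul_left_of_hasCompactSupport hg.continuous hgc
  have hvm : AEStronglyMeasurable v volume :=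
    ((hs.measurable.pow_const 2).neg.aestronglyMeasurable).congr (hv.mono fun x hx => hx.symm)
  have hvb : ∀ᵐ x, |v x| ≤ A ^ 2 := by
    filter_upwards [hv] with x hx
    rw [hx, abs_neg, abs_of_nonneg (sq_nonneg _)]
    exact hs.sq_le_const x
  have hweak := h.schwartz hf hvm hvb η
  have e : ∀ᵐ x, f x * (-(1 / (2 * m)) * Δ (η : R4 → ℝ) x + v x * η x) =
      1 / (2 * m) * (g x * f x - (κ + 2 * m * s x ^ 2) * f x * η x) := by
    filter_upwards [hv] with x hx
    rw [hx, hηΔ]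
    field_simp
    ring
  rw [integral_congr_ae e, integral_const_mul, integral_sub hgf hηi] at hweak
  have h2 : 1 / (2 * m) ≠ 0 := by positivity
  have h3 := (mul_eq_zero.1 hweak).resolve_left h2
  simp only [smul_eq_mul, ← integral_const_mul]
  rw [integral_integral_swap hprod]
  simp only [hswap]
  linarith

/-- The limit `κ = 1 / (n + 1) → 0` of the preceding equation, dominated by `sourceMajorant`. The
artificial term `κ g_κ ∗ f` disappears although `f` is known only to lie in `L⁴`. -/
theorem IsZeroSolution.ae_eq_riesz (hm : 0 < m) (hs : IsWeight s A β)
    (hv : ∀ᵐ x, v x = -(s x ^ 2)) (hf : MemLp f 4 volume) (h : IsZeroSolution m v f) :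
    ∀ᵐ x, f x = ∫ y, m / (2 * Real.pi ^ 2) * (‖x - y‖ ^ 2)⁻¹ * (s y ^ 2 * f y) := by
  obtain ⟨N, hN⟩ := exists_sourceMajorant_bound hm hs hf
  have hk : ∀ n : ℕ, (0 : ℝ) < 1 / ((n : ℝ) + 1) := fun n => by positivity
  have hk1 : ∀ n : ℕ, 1 / ((n : ℝ) + 1) ≤ 1 := fun n => by
    rw [div_le_one (by positivity)]
    linarith [n.cast_nonneg (α := ℝ)]
  have hae := ae_all_iff.2 fun n : ℕ => h.ae_eq_green hm hs hv hf (hk n) (hk1 n)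
  filter_upwards [hae] with x hx
  refine tendsto_nhds_unique (tendsto_const_nhds (x := f x) (f := atTop (α := ℕ))) ?_
  have hlim := tendsto_integral_of_dominated_convergence (μ := volume)
    (F := fun (n : ℕ) y => green (1 / ((n : ℝ) + 1)) (x - y) *
      ((1 / ((n : ℝ) + 1) + 2 * m * s y ^ 2) * f y))
    (f := fun y => m / (2 * Real.pi ^ 2) * (‖x - y‖ ^ 2)⁻¹ * (s y ^ 2 * f y))
    (fun y => sourceMajorant m A s x y * |f y|) ?_ (hN x).1
    (fun n => ae_of_all _ fun y => abs_source_le hm hs (hk n) (hk1 n) x y) ?_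
  · exact hlim.congr fun n => (hx n).symm
  · intro n
    have h1 : Measurable fun y => green (1 / ((n : ℝ) + 1)) (x - y) :=
      (measurable_green _).comp (measurable_const.sub measurable_id)
    have h2 : Measurable fun y => 1 / ((n : ℝ) + 1) + 2 * m * s y ^ 2 :=
      ((hs.measurable.pow_const 2).const_mul _).const_add _
    exact h1.aestronglyMeasurable.mul (h2.aestronglyMeasurable.mul hf.1)
  · refine ae_of_all _ fun y => ?_
    have h0 : Tendsto (fun n : ℕ => 1 / ((n : ℝ) + 1)) atTop (𝓝 0) :=
      tendsto_one_div_add_atTop_nhds_zero_nat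
    have hσ : Tendsto (fun n : ℕ => 1 / ((n : ℝ) + 1) * ‖x - y‖ ^ 2 / 4) atTop (𝓝[Set.Ici 0] 0) := by
      refine tendsto_nhdsWithin_iff.2 ⟨?_, Eventually.of_forall fun n => ?_⟩
      · simpa using (h0.mul_const (‖x - y‖ ^ 2)).div_const 4
      · exact div_nonneg (mul_nonneg (hk n).le (by positivity)) (by norm_num)
    have hmac := continuousWithinAt_macdonald_zero.tendsto.comp hσ
    rw [macdonald_zero_zero] at hmac
    -- This includes `y = x`, where both sides have the default value zero.
    have hg : Tendsto (fun n : ℕ => green (1 / ((n : ℝ) + 1)) (x - y)) atTop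
        (𝓝 (1 / (4 * Real.pi ^ 2 * ‖x - y‖ ^ 2))) := hmac.div_const _
    have := hg.mul ((h0.add_const (2 * m * s y ^ 2)).mul_const (f y))
    have e : 1 / (4 * Real.pi ^ 2 * ‖x - y‖ ^ 2) * ((0 + 2 * m * s y ^ 2) * f y) =
        m / (2 * Real.pi ^ 2) * (‖x - y‖ ^ 2)⁻¹ * (s y ^ 2 * f y) := by
      rw [one_div, mul_inv]
      field_simp
      ring
    rwa [e] at this

end Zero

/-! ### The eigenvalue `1` of a positive kernel -/

theorem inner_eq_integral_of_real {φ : L2} {a : R4 → ℝ} (ha : ∀ᵐ x, φ x = (a x : ℂ)) (ψ : L2) :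
    Integrable (fun x => (a x : ℂ) * ψ x) ∧ inner ℂ φ ψ = ∫ x, (a x : ℂ) * ψ x := by
  have e : (fun x => inner ℂ (φ x) (ψ x)) =ᵐ[volume] fun x => (a x : ℂ) * ψ x := by
    filter_upwards [ha] with x hx
    rw [hx, RCLike.inner_apply, Complex.conj_ofReal, mul_comm]
  exact ⟨(L2.integrable_inner φ ψ).congr e, by rw [L2.inner_def]; exact integral_congr_ae e⟩

theorem exists_unit_mul_eq_norm (w : ℂ) : ∃ u : ℂ, ‖u‖ = 1 ∧ u * w = ‖w‖ := by
  rcases eq_or_ne w 0 with rfl | hw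
  · exact ⟨1, by simp, by simp⟩
  · have hn : (‖w‖ : ℂ) ≠ 0 := by simpa using hw
    refine ⟨(‖w‖ : ℂ) / w, ?_, by field_simp⟩
    rw [norm_div, Complex.norm_real, norm_norm, div_self (by simpa using hw)]

theorem re_mul_le_norm {u : ℂ} (hu : ‖u‖ = 1) (w : ℂ) : (u * w).re ≤ ‖w‖ := by
  refine (Complex.re_le_norm _).trans ?_
  rw [norm_mul, hu, one_mul]

theorem memLp_ofReal_norm (ψ : L2) : MemLp (fun x => ((‖ψ x‖ : ℝ) : ℂ)) 2 volume :=
  (Lp.memLp ψ).norm.ofReal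

section Perron

variable {s : R4 → ℝ} {k : R4 → ℝ} {G : L2 →L[ℂ] L2} {φ : L2} {a : R4 → ℝ}

theorem eq_zero_of_fixed_of_weight_eq_zero (hG : IsIntegralOperator (weightKernel s k) G) {ψ : L2}
    (hψ : G ψ = ψ) : ∀ᵐ x, s x = 0 → ψ x = 0 := by
  filter_upwards [hG ψ] with x hx h0
  rw [hψ] at hx
  rw [hx.2]
  simp [weightKernel, h0]

/-- The norm of a fixed point of a positive integral operator is again a fixed point. -/
theorem integral_kernel_norm_eq (hG : IsIntegralOperator (weightKernel s k) G)
    (hsa : IsSelfAdjoint G) (hs : ∀ x, 0 ≤ s x) (hk : ∀ z, 0 ≤ k z)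
    (ha : ∀ᵐ x, φ x = (a x : ℂ)) (ha0 : ∀ᵐ x, 0 ≤ a x) (hφ : G φ = φ) {ψ : L2} (hψ : G ψ = ψ) :
    ∀ᵐ x, 0 < a x → ∫ y, weightKernel s k x y * ‖ψ y‖ = ‖ψ x‖ := by
  set N : L2 := (memLp_ofReal_norm ψ).toLp _ with hN
  have hNe : ∀ᵐ x, N x = ((‖ψ x‖ : ℝ) : ℂ) := (memLp_ofReal_norm ψ).coeFn_toLp
  have hK : ∀ x y, 0 ≤ weightKernel s k x y := fun x y =>
    mul_nonneg (mul_nonneg (hs x) (hk _)) (hs y)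
  have hGN : ∀ᵐ x, G N x = ((∫ y, weightKernel s k x y * ‖ψ y‖ : ℝ) : ℂ) := by
    filter_upwards [hG N] with x hx
    rw [hx.2, ← integral_complex_ofReal]
    refine integral_congr_ae ?_
    filter_upwards [hNe] with y hy
    rw [hy]
    push_cast
    rfl
  have hle : ∀ᵐ x, ‖ψ x‖ ≤ ∫ y, weightKernel s k x y * ‖ψ y‖ := by
    filter_upwards [hG ψ] with x hx
    rw [hψ] at hx
    rw [hx.2]
    refine (norm_integral_le_integral_norm _).trans (le_of_eq ?_)
    refine integral_congr_ae (ae_of_all _ fun y => ?_)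
    simp only
    rw [norm_mul, Complex.norm_real, Real.norm_of_nonneg (hK x y)]
  -- The triangle inequality gives `|ψ| ≤ G|ψ|`. Self-adjointness makes the nonnegative difference
  -- orthogonal to the nonnegative `φ`, so it vanishes where `φ` is positive.
  have hinner : inner ℂ φ (G N - N) = 0 := by
    have h1 : inner ℂ φ (G N) = inner ℂ (G φ) N := by
      rw [← ContinuousLinearMap.adjoint_inner_left, hsa.adjoint_eq]
    rw [inner_sub_right, h1, hφ, sub_self]
  obtain ⟨hi, he⟩ := inner_eq_integral_of_real ha (G N - N)
  have hcongr : (fun x => (a x : ℂ) * (G N - N : L2) x) =ᵐ[volume] fun x =>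
      ((a x * ((∫ y, weightKernel s k x y * ‖ψ y‖) - ‖ψ x‖) : ℝ) : ℂ) := by
    filter_upwards [hNe, hGN, Lp.coeFn_sub (G N) N] with x h1 h2 h3
    rw [h3, Pi.sub_apply, h1, h2]
    push_cast
    rfl
  rw [hinner, integral_congr_ae hcongr, integral_complex_ofReal] at he
  have h0 : ∫ x, a x * ((∫ y, weightKernel s k x y * ‖ψ y‖) - ‖ψ x‖) = 0 := by
    exact_mod_cast he.symm
  have hir : Integrable fun x => a x * ((∫ y, weightKernel s k x y * ‖ψ y‖) - ‖ψ x‖) := by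
    have := (hi.congr hcongr).re
    simpa using this
  have hnn : 0 ≤ᵐ[volume] fun x => a x * ((∫ y, weightKernel s k x y * ‖ψ y‖) - ‖ψ x‖) := by
    filter_upwards [ha0, hle] with x h1 h2
    exact mul_nonneg h1 (sub_nonneg.2 h2)
  filter_upwards [(integral_eq_zero_iff_of_nonneg_ae hnn hir).1 h0] with x hx hax
  have := (mul_eq_zero.1 hx).resolve_left hax.ne'
  linarith

/-- Perron–Frobenius: equality in the triangle inequality at a single point `x` with `s x > 0`
forces `ψ` to have constant phase, because the kernel is positive off the diagonal wherever `s` is.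
Orthogonality to `φ` then becomes `∫ a |ψ| = 0`. -/
theorem eq_zero_of_fixed_of_orthogonal (hG : IsIntegralOperator (weightKernel s k) G)
    (hsa : IsSelfAdjoint G) (hs : ∀ x, 0 ≤ s x) (hk : ∀ z, 0 ≤ k z) (hk' : ∀ z ≠ 0, 0 < k z)
    (ha : ∀ᵐ x, φ x = (a x : ℂ)) (ha0 : ∀ᵐ x, 0 ≤ a x) (has : ∀ᵐ x, 0 < s x → 0 < a x)
    (hφ : G φ = φ) (hsne : ¬ ∀ᵐ x, s x = 0) {ψ : L2} (hψ : G ψ = ψ) (horth : inner ℂ φ ψ = 0) :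
    ψ = 0 := by
  obtain ⟨x, hsx, hKx, hint, hGx⟩ : ∃ x, 0 < s x ∧
      ∫ y, weightKernel s k x y * ‖ψ y‖ = ‖ψ x‖ ∧
      Integrable (fun y => (weightKernel s k x y : ℂ) * ψ y) ∧
      ψ x = ∫ y, (weightKernel s k x y : ℂ) * ψ y := by
    by_contra! hne
    refine hsne ?_
    filter_upwards [integral_kernel_norm_eq hG hsa hs hk ha ha0 hφ hψ, has, hG ψ] with x h1 h2 h3
    rw [hψ] at h3
    by_contra h0
    have hpos : 0 < s x := lt_of_le_of_ne (hs x) (Ne.symm h0)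
    exact hne x hpos (h1 (h2 hpos)) h3.1 h3.2
  obtain ⟨u, hu, hux⟩ := exists_unit_mul_eq_norm (ψ x)
  have hK : ∀ y, 0 ≤ weightKernel s k x y := fun y => mul_nonneg (mul_nonneg (hs x) (hk _)) (hs y)
  have hi1 : Integrable fun y => weightKernel s k x y * ‖ψ y‖ := by
    refine hint.norm.congr (ae_of_all _ fun y => ?_)
    simp only
    rw [norm_mul, Complex.norm_real, Real.norm_of_nonneg (hK y)]
  have hi2 : Integrable fun y => u * ((weightKernel s k x y : ℂ) * ψ y) := hint.const_mul u
  have hi2re : Integrable fun y => (u * ((weightKernel s k x y : ℂ) * ψ y)).re := hi2.re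
  have hval : ∫ y, (u * ((weightKernel s k x y : ℂ) * ψ y)).re = ‖ψ x‖ := by
    have h1 : ∫ y, u * ((weightKernel s k x y : ℂ) * ψ y) = (‖ψ x‖ : ℂ) := by
      rw [integral_const_mul, ← hGx, hux]
    have h2 := integral_re hi2
    simp only [RCLike.re_to_complex] at h2
    rw [h2, h1, Complex.ofReal_re]
  have hre : ∀ y, (u * ((weightKernel s k x y : ℂ) * ψ y)).re =
      weightKernel s k x y * (u * ψ y).re := by
    intro y
    rw [mul_left_comm, Complex.re_ofReal_mul]
  have hzero : ∫ y, (weightKernel s k x y * ‖ψ y‖ -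
      (u * ((weightKernel s k x y : ℂ) * ψ y)).re) = 0 := by
    rw [integral_sub hi1 hi2re, hKx, hval, sub_self]
  have hnn : 0 ≤ᵐ[volume] fun y => weightKernel s k x y * ‖ψ y‖ -
      (u * ((weightKernel s k x y : ℂ) * ψ y)).re := by
    refine ae_of_all _ fun y => ?_
    simp only [Pi.zero_apply]
    rw [hre, ← mul_sub]
    exact mul_nonneg (hK y) (sub_nonneg.2 (re_mul_le_norm hu _))
  have hae := (integral_eq_zero_iff_of_nonneg_ae hnn (hi1.sub hi2re)).1 hzero
  have hx' : ∀ᵐ y : R4, y ≠ x := by simp [ae_iff]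
  have hz := eq_zero_of_fixed_of_weight_eq_zero hG hψ
  -- A nonnegative integrand with zero integral vanishes; where `s y = 0` the fixed point vanishes
  -- anyway.
  have hphase : ∀ᵐ y, (u * ψ y).re = ‖ψ y‖ := by
    filter_upwards [hae, hx', hz] with y h1 h2 h3
    rcases (hs y).eq_or_lt with h0 | hpos
    · rw [h3 h0.symm]
      simp
    · have hKpos : 0 < weightKernel s k x y :=
        mul_pos (mul_pos hsx (hk' _ (sub_ne_zero.2 h2.symm))) hpos
      simp only [Pi.zero_apply] at h1
      rw [hre, ← mul_sub] at h1
      have := (mul_eq_zero.1 h1).resolve_left hKpos.ne'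
      linarith
  obtain ⟨hi, he⟩ := inner_eq_integral_of_real ha ψ
  have hi3 : Integrable fun y => u * ((a y : ℂ) * ψ y) := hi.const_mul u
  have hcongr : (fun y => (u * ((a y : ℂ) * ψ y)).re) =ᵐ[volume] fun y => a y * ‖ψ y‖ := by
    filter_upwards [hphase] with y hy
    rw [mul_left_comm, Complex.re_ofReal_mul, hy]
  have hi4 : Integrable fun y => a y * ‖ψ y‖ := Integrable.congr hi3.re hcongr
  have h0 : ∫ y, a y * ‖ψ y‖ = 0 := by
    rw [← integral_congr_ae hcongr]
    have h2 := integral_re hi3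
    simp only [RCLike.re_to_complex] at h2
    rw [h2, integral_const_mul, ← he, horth, mul_zero, Complex.zero_re]
  have hnn2 : 0 ≤ᵐ[volume] fun y => a y * ‖ψ y‖ := by
    filter_upwards [ha0] with y hy
    exact mul_nonneg hy (norm_nonneg _)
  have hae2 := (integral_eq_zero_iff_of_nonneg_ae hnn2 hi4).1 h0
  apply Lp.ext
  filter_upwards [hae2, has, hz, Lp.coeFn_zero ℂ 2 (volume : Measure R4)] with y h1 h2 h3 h4
  rw [h4, Pi.zero_apply]
  rcases (hs y).eq_or_lt with h0 | hpos
  · exact h3 h0.symm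
  · exact norm_eq_zero.1 ((mul_eq_zero.1 h1).resolve_left (h2 hpos).ne')

theorem fixed_iff_smul (hG : IsIntegralOperator (weightKernel s k) G)
    (hsa : IsSelfAdjoint G) (hs : ∀ x, 0 ≤ s x) (hk : ∀ z, 0 ≤ k z) (hk' : ∀ z ≠ 0, 0 < k z)
    (ha : ∀ᵐ x, φ x = (a x : ℂ)) (ha0 : ∀ᵐ x, 0 ≤ a x) (has : ∀ᵐ x, 0 < s x → 0 < a x)
    (hφ : G φ = φ) (hφ0 : φ ≠ 0) (hsne : ¬ ∀ᵐ x, s x = 0) (ψ : L2) :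
    G ψ = ψ ↔ ∃ c : ℂ, ψ = c • φ := by
  constructor
  · intro hψ
    have hne : inner ℂ φ φ ≠ 0 := inner_self_ne_zero.2 hφ0
    refine ⟨inner ℂ φ ψ / inner ℂ φ φ, ?_⟩
    rw [← sub_eq_zero]
    refine eq_zero_of_fixed_of_orthogonal hG hsa hs hk hk' ha ha0 has hφ hsne ?_ ?_
    · rw [map_sub, map_smul, hψ, hφ]
    · rw [inner_sub_right, inner_smul_right, div_mul_cancel₀ _ hne, sub_self]
  · rintro ⟨c, rfl⟩
    rw [map_smul, hφ]

end Perron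

/-! ### The eigenfunction defined by a positive zero solution -/

section Eigenfunction

variable {m A β : ℝ} {s v f : R4 → ℝ}

theorem memLp_weight_mul (hs : IsWeight s A β) (hf : MemLp f 4 volume) :
    MemLp (fun x => s x * f x) 2 volume := by
  have hm : AEStronglyMeasurable (fun x => s x * f x) volume :=
    hs.measurable.aestronglyMeasurable.mul hf.1
  rw [memLp_two_iff_integrable_sq hm]
  have h1 : Integrable fun x => (A ^ 2) ^ 2 * bracket (4 * β) x :=
    (integrable_bracket (by linarith [hs.two_lt])).const_mul _
  refine (h1.add (integrable_pow_four hf)).mono' (hm.pow 2) (ae_of_all _ fun x => ?_)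
  have h2 := hs.sq_le x
  have h3 : (s x ^ 2) ^ 2 ≤ (A ^ 2) ^ 2 * bracket (4 * β) x := by
    have := pow_le_pow_left₀ (sq_nonneg (s x)) h2 2
    rwa [mul_pow, bracket_sq, ← mul_assoc, show (2 : ℝ) * 2 = 4 by norm_num] at this
  rw [Real.norm_of_nonneg (sq_nonneg _), Pi.add_apply]
  have h4 : |f x| ^ 4 = (f x ^ 2) ^ 2 := by rw [← sq_abs (f x)]; ring
  rw [h4]
  nlinarith [sq_nonneg (s x ^ 2 - f x ^ 2), sq_nonneg (s x ^ 2), sq_nonneg (f x ^ 2)]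

/-- Multiplying the Riesz representation of `f` by `s` shows that `s f` is fixed by `G`. The weight
is not null, as otherwise the representation would give `f = 0`; therefore `∫ s² f > 0` and the
normalization is possible. -/
theorem exists_eigenfunction (hm : 0 < m) (hs : IsWeight s A β)
    (hv : ∀ᵐ x, v x = -(s x ^ 2)) (hf : MemLp f 4 volume) (h : IsZeroSolution m v f)
    (hpos : ∀ᵐ x, 0 < f x) {G : L2 →L[ℂ] L2} (hsa : IsSelfAdjoint G)
    (hG : IsIntegralOperator (weightKernel s fun z => m / (2 * Real.pi ^ 2) * (‖z‖ ^ 2)⁻¹) G) :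
    ∃ φ : L2, φ ≠ 0 ∧ (∀ ψ : L2, G ψ = ψ ↔ ∃ c : ℂ, ψ = c • φ) ∧
      ∫ x, (s x : ℂ) * φ x = ((2 * Real.pi / m : ℝ) : ℂ) := by
  have hrep := h.ae_eq_riesz hm hs hv hf
  have hi := integrable_sq_mul_abs hs hf
  have hsne : ¬ ∀ᵐ x, s x = 0 := by
    intro h0
    have hfz : ∀ᵐ x, f x = 0 := by
      filter_upwards [hrep] with x hx
      rw [hx]
      refine integral_eq_zero_of_ae ?_
      filter_upwards [h0] with y hy
      simp [hy]
    obtain ⟨x, h1, h2⟩ := (hfz.and hpos).exists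
    exact h2.ne' h1
  have hi' : Integrable fun x => s x ^ 2 * f x := by
    refine hi.congr ?_
    filter_upwards [hpos] with x hx
    rw [abs_of_pos hx]
  have hnn : 0 ≤ᵐ[volume] fun x => s x ^ 2 * f x := by
    filter_upwards [hpos] with x hx
    exact mul_nonneg (sq_nonneg _) hx.le
  have hI : 0 < ∫ x, s x ^ 2 * f x := by
    refine lt_of_le_of_ne (integral_nonneg_of_ae hnn) fun h0 => hsne ?_
    filter_upwards [(integral_eq_zero_iff_of_nonneg_ae hnn hi').1 h0.symm, hpos] with x hx hfx
    have := (mul_eq_zero.1 hx).resolve_right hfx.ne'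
    exact pow_eq_zero_iff (two_ne_zero) |>.1 this
  set c : ℝ := 2 * Real.pi / m / ∫ x, s x ^ 2 * f x with hc
  have hcpos : 0 < c := by positivity
  have hmem : MemLp (fun x => ((c * (s x * f x) : ℝ) : ℂ)) 2 volume :=
    ((memLp_weight_mul hs hf).const_mul c).ofReal
  set φ : L2 := hmem.toLp _ with hφdef
  have ha : ∀ᵐ x, φ x = ((c * (s x * f x) : ℝ) : ℂ) := hmem.coeFn_toLp
  have hfix : G φ = φ := by
    apply Lp.ext
    filter_upwards [hG φ, ha, hrep] with x h1 h2 h3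
    rw [h1.2, h2]
    have e : (fun y => (weightKernel s (fun z => m / (2 * Real.pi ^ 2) * (‖z‖ ^ 2)⁻¹) x y : ℂ) * φ y)
        =ᵐ[volume] fun y => ((c * s x * (m / (2 * Real.pi ^ 2) * (‖x - y‖ ^ 2)⁻¹ *
          (s y ^ 2 * f y)) : ℝ) : ℂ) := by
      filter_upwards [ha] with y hy
      rw [hy, weightKernel]
      push_cast
      ring
    rw [integral_congr_ae e, integral_complex_ofReal, integral_const_mul, ← h3, mul_assoc]
  have hint : ∫ x, (s x : ℂ) * φ x = ((2 * Real.pi / m : ℝ) : ℂ) := by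
    have e : (fun x => (s x : ℂ) * φ x) =ᵐ[volume] fun x => ((c * (s x ^ 2 * f x) : ℝ) : ℂ) := by
      filter_upwards [ha] with x hx
      rw [hx]
      push_cast
      ring
    rw [integral_congr_ae e, integral_complex_ofReal, integral_const_mul, hc,
      div_mul_cancel₀ _ hI.ne']
  have hφ0 : φ ≠ 0 := by
    intro h0
    have : ∫ x, (s x : ℂ) * φ x = 0 := by
      refine integral_eq_zero_of_ae ?_
      rw [h0]
      filter_upwards [Lp.coeFn_zero ℂ 2 (volume : Measure R4)] with x hx
      simp
    rw [this] at hint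
    have hne : (2 * Real.pi / m : ℝ) ≠ 0 := by positivity
    exact hne (by exact_mod_cast hint.symm)
  refine ⟨φ, hφ0, fun ψ => ?_, hint⟩
  refine fixed_iff_smul hG hsa hs.nonneg (fun z => by positivity) (fun z hz => ?_) ha ?_ ?_ hfix hφ0
    hsne ψ
  · have := norm_pos_iff.2 hz
    positivity
  · filter_upwards [hpos] with x hx
    exact mul_nonneg hcpos.le (mul_nonneg (hs.nonneg x) hx.le)
  · filter_upwards [hpos] with x hx hsx
    exact mul_pos hcpos (mul_pos hsx hx)

end Eigenfunction

/-! ### Perturbation of a simple eigenvalue at the edge of invertibility -/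

section Perturbation

variable {H : Type*} [NormedAddCommGroup H] [InnerProductSpace ℂ H]

open InnerProductSpace in
-- On `φ` the operator `1 - G - M` acts as `-M`, so the singular term contributes `-⟨φ, ·⟩ χ`. The
-- factor `1 + rankOne ℂ χ φ` compensates for this. The reduced resolvent `S` inverts `1 - G` up to
-- the projection onto `φ`, and since `⟨φ, χ⟩ = -1 + e`, that projection annihilates the corrected
-- vector up to `e`.
theorem comp_approximate_inverse {G S M : H →L[ℂ] H} {φ χ : H} {l e : ℂ}
    (hG : G φ = φ) (hφ : φ ≠ 0) (hS : ∀ ψ, S ψ - G (S ψ) = ψ - (inner ℂ φ ψ / inner ℂ φ φ) • φ)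
    (hl : l ≠ 0) (hM : M φ = l • χ) (hχ : inner ℂ φ χ = -1 + e) :
    (1 - G - M) * (l⁻¹ • rankOne ℂ φ φ + S * (1 + rankOne ℂ χ φ)) =
      1 - ((e / inner ℂ φ φ) • rankOne ℂ φ φ + M * (S * (1 + rankOne ℂ χ φ))) := by
  have hne : inner ℂ φ φ ≠ 0 := inner_self_ne_zero.2 hφ
  ext ψ
  set c : ℂ := inner ℂ φ ψ with hc
  have h1 := hS (ψ + c • χ)
  have h2 : inner ℂ φ (ψ + c • χ) = c * e := by
    rw [inner_add_right, inner_smul_right, hχ, ← hc]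
    ring
  rw [h2] at h1
  have h3 : ψ + c • χ - (c * e / inner ℂ φ φ) • φ = ψ + c • χ - (e / inner ℂ φ φ) • (c • φ) := by
    rw [smul_smul]
    congr 2
    ring
  rw [h3] at h1
  simp only [mul_apply_eq_comp, _root_.sub_apply, _root_.add_apply, _root_.smul_apply,
    one_apply_eq_self, rankOne_apply, map_add, map_smul, hG, hM, ← hc] at h1 ⊢
  have h4 : l⁻¹ • c • (φ - φ - l • χ) = -(c • χ) := by
    rw [sub_self, zero_sub, smul_comm, smul_neg, smul_smul, inv_mul_cancel₀ hl, one_smul, smul_neg]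
  rw [h4]
  rw [← sub_eq_zero] at h1 ⊢
  rw [← h1]
  module

/-- With `P` the projection onto `φ`, take `S = (1 - G + P)⁻¹`. A fixed vector of the compact
operator `G - P` is orthogonal to `φ`, hence fixed by `G`, hence zero by simplicity; the Fredholm
alternative applies. -/
theorem exists_reducedResolvent [CompleteSpace H] {G : H →L[ℂ] H} (hGc : IsCompactOperator G)
    (hsa : IsSelfAdjoint G) {φ : H} (hφ : φ ≠ 0) (hG : G φ = φ)
    (hsimple : ∀ ψ, G ψ = ψ → ∃ c : ℂ, ψ = c • φ) :
    ∃ S : H →L[ℂ] H, ∀ ψ, S ψ - G (S ψ) = ψ - (inner ℂ φ ψ / inner ℂ φ φ) • φ := by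
  have hne : inner ℂ φ φ ≠ 0 := inner_self_ne_zero.2 hφ
  have hGinner : ∀ ψ, inner ℂ φ (G ψ) = inner ℂ φ ψ := by
    intro ψ
    rw [← ContinuousLinearMap.adjoint_inner_left, hsa.adjoint_eq, hG]
  set P : H →L[ℂ] H := (inner ℂ φ φ)⁻¹ • InnerProductSpace.rankOne ℂ φ φ with hP
  have hPapply : ∀ ψ, P ψ = (inner ℂ φ ψ / inner ℂ φ φ) • φ := by
    intro ψ
    rw [hP, _root_.smul_apply, InnerProductSpace.rankOne_apply, smul_smul, div_eq_inv_mul]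
  have hPinner : ∀ ψ, inner ℂ φ (P ψ) = inner ℂ φ ψ := by
    intro ψ
    rw [hPapply, inner_smul_right, div_mul_cancel₀ _ hne]
  have hPc : IsCompactOperator P := by
    have h1 : IsCompactOperator (ContinuousLinearMap.toSpanSingleton ℂ φ) :=
      (isCompactOperator_id (E := ℂ)).clm_comp _
    have h2 : (P : H → H) = fun ψ => (ContinuousLinearMap.toSpanSingleton ℂ φ)
        (((inner ℂ φ φ)⁻¹ • innerSL ℂ φ) ψ) := by
      ext ψ
      rw [hPapply]
      simp [div_eq_inv_mul]
    rw [h2]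
    exact h1.comp_clm _
  have hcomp : IsCompactOperator (G - P : H →L[ℂ] H) := hGc.sub hPc
  rcases hcomp.hasEigenvalue_or_mem_resolventSet one_ne_zero with h | h
  · exfalso
    obtain ⟨ψ, hψ, hψ0⟩ := h.exists_hasEigenvector
    rw [Module.End.mem_eigenspace_iff, one_smul] at hψ
    have h1 : G ψ - P ψ = ψ := hψ
    have h2 : inner ℂ φ ψ = 0 := by
      have := congrArg (inner ℂ φ) h1
      rw [inner_sub_right, hGinner, hPinner, sub_self] at this
      exact this.symm
    have h3 : P ψ = 0 := by rw [hPapply, h2, zero_div, zero_smul]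
    rw [h3, sub_zero] at h1
    obtain ⟨c, rfl⟩ := hsimple ψ h1
    rw [inner_smul_right] at h2
    have := (mul_eq_zero.1 h2).resolve_right hne
    exact hψ0 (by rw [this, zero_smul])
  · rw [spectrum.mem_resolventSet_iff, map_one] at h
    obtain ⟨u, hu⟩ := h
    refine ⟨(↑u⁻¹ : H →L[ℂ] H), fun ψ => ?_⟩
    have h1 : ((u : H →L[ℂ] H) * (↑u⁻¹ : H →L[ℂ] H)) ψ = ψ := by
      rw [Units.mul_inv]
      rfl
    rw [hu] at h1
    set χ := (↑u⁻¹ : H →L[ℂ] H) ψ with hχ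
    have h2 : χ - (G χ - P χ) = ψ := h1
    have h3 : inner ℂ φ ψ = inner ℂ φ χ := by
      rw [← h2, inner_sub_right, inner_sub_right, hGinner, hPinner, sub_self, sub_zero]
    rw [h3, ← hPapply, ← h2]
    abel

/-- A selfadjoint operator with an approximate right inverse `X` is invertible, and its inverse is
close to `X`. -/
theorem exists_inverse_of_approximate [CompleteSpace H] {A X Q : H →L[ℂ] H} (hA : IsSelfAdjoint A)
    (hX : A * X = 1 - Q) (hQ : ‖Q‖ ≤ 1 / 2) :
    ∃ W : H →L[ℂ] H, A * W = 1 ∧ W * A = 1 ∧ ‖W - X‖ ≤ 2 * ‖X‖ * ‖Q‖ := by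
  obtain ⟨u, hu⟩ := isUnit_one_sub_of_norm_lt_one (x := Q) (by linarith)
  set V : H →L[ℂ] H := (↑u⁻¹ : H →L[ℂ] H) with hV
  have huV : (1 - Q) * V = 1 := by rw [← hu, hV, Units.mul_inv]
  have hVQ : V = 1 + Q * V := by
    rw [sub_mul, one_mul] at huV
    rw [← huV]
    abel
  have hVn : ‖V‖ ≤ 2 := by
    have h1 : ‖V‖ ≤ 1 + ‖Q‖ * ‖V‖ := by
      calc ‖V‖ = ‖1 + Q * V‖ := by rw [← hVQ]
        _ ≤ ‖(1 : H →L[ℂ] H)‖ + ‖Q * V‖ := norm_add_le _ _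
        _ ≤ 1 + ‖Q‖ * ‖V‖ := add_le_add ContinuousLinearMap.norm_id_le (norm_mul_le _ _)
    nlinarith [norm_nonneg V]
  have hW : A * (X * V) = 1 := by rw [← mul_assoc, hX, huV]
  refine ⟨X * V, hW, ?_, ?_⟩
  · have h1 : star (X * V) * A = 1 := by
      have := congrArg star hW
      rwa [star_mul, hA.star_eq, star_one] at this
    have h2 : star (X * V) = X * V := by
      calc star (X * V) = star (X * V) * (A * (X * V)) := by rw [hW, mul_one]
        _ = X * V := by rw [← mul_assoc, h1, one_mul]
    rwa [h2] at h1
  · have h1 : X * V - X = X * (Q * V) := by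
      conv_lhs => rw [hVQ]
      noncomm_ring
    rw [h1]
    calc ‖X * (Q * V)‖ ≤ ‖X‖ * (‖Q‖ * ‖V‖) :=
          (norm_mul_le _ _).trans (mul_le_mul_of_nonneg_left (norm_mul_le _ _) (norm_nonneg _))
      _ ≤ ‖X‖ * (‖Q‖ * 2) := by gcongr
      _ = _ := by ring

/-- In the application `|z| / l` decays only like `1 / |ln|z||`, which is no power of `l`. The
condition `h₀` removes the contribution of `z D₀` to `⟨φ, χ⟩` and so keeps a power-law error. -/
theorem exists_inverse_expansion [CompleteSpace H] {G S G₂ D₀ : H →L[ℂ] H} {φ : H} (hG : G φ = φ)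
    (hφ : φ ≠ 0) (hS : ∀ ψ, S ψ - G (S ψ) = ψ - (inner ℂ φ ψ / inner ℂ φ φ) • φ)
    (h₂ : inner ℂ φ (G₂ φ) = -1) (h₀ : inner ℂ φ (D₀ φ) = 0) {C θ : ℝ} (hC : 0 ≤ C) (hθ : 0 < θ)
    (hθ1 : θ ≤ 1) :
    ∃ C' l₀ : ℝ, 0 < l₀ ∧ ∀ (z l : ℝ) (E A : H →L[ℂ] H), 0 < l → l < l₀ → |z| ≤ l →
      ‖E‖ ≤ C * l ^ (1 + θ) → A = 1 - G - ((l : ℂ) • G₂ + ((z : ℂ) • D₀ + E)) → IsSelfAdjoint A →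
      ∃ W : H →L[ℂ] H, A * W = 1 ∧ W * A = 1 ∧
        ‖W - ((l⁻¹ : ℝ) : ℂ) • InnerProductSpace.rankOne ℂ φ φ‖ ≤ C' * l ^ (-1 + θ) := by
  set n := ‖φ‖ * ‖φ‖ with hn
  set d := ‖G₂‖ + (‖D₀‖ + C) with hd
  set y := ‖S‖ * (1 + d * n) with hy
  set q := C * n + d * y with hq
  have hd0 : 0 ≤ d := by positivity
  have hy0 : 0 ≤ y := by positivity
  have hq0 : 0 ≤ q := by positivity
  obtain ⟨l₁, hl₁, hq1⟩ : ∃ l₁ : ℝ, 0 < l₁ ∧ ∀ l : ℝ, 0 < l → l < l₁ → q * l ^ θ ≤ 1 / 2 := by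
    have ht : Tendsto (fun l : ℝ => q * l ^ θ) (𝓝 0) (𝓝 (q * 0 ^ θ)) :=
      ((Real.continuous_rpow_const hθ.le).tendsto 0).const_mul q
    rw [Real.zero_rpow hθ.ne', mul_zero] at ht
    obtain ⟨l₁, hl₁, h⟩ := Metric.eventually_nhds_iff.1 (ht.eventually (gt_mem_nhds one_half_pos))
    refine ⟨l₁, hl₁, fun l hl hll => (h ?_).le⟩
    rwa [Real.dist_eq, sub_zero, abs_of_pos hl]
  refine ⟨y + 2 * (n + y) * q, min 1 l₁, lt_min one_pos hl₁, ?_⟩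
  intro z l E A hl hll hz hE hAeq hA
  have hl1 : l < 1 := hll.trans_le (min_le_left _ _)
  have hqs := hq1 l hl (hll.trans_le (min_le_right _ _))
  have hlc : (l : ℂ) ≠ 0 := by exact_mod_cast hl.ne'
  have hlθ : l ^ (1 + θ) = l * l ^ θ := by rw [Real.rpow_add hl, Real.rpow_one]
  have hlθ1 : l ^ θ ≤ 1 := Real.rpow_le_one hl.le hl1.le hθ.le
  have hlθ2 : l ≤ l ^ θ := by
    simpa using Real.rpow_le_rpow_of_exponent_ge hl hl1.le hθ1
  have hlθ3 : 1 ≤ l ^ (-1 + θ) :=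
    Real.one_le_rpow_of_pos_of_le_one_of_nonpos hl hl1.le (by linarith)
  have hlθ4 : l⁻¹ * l ^ θ = l ^ (-1 + θ) := by rw [Real.rpow_add hl, Real.rpow_neg_one]
  have hlθ0 : 0 < l ^ θ := Real.rpow_pos_of_pos hl θ
  set M : H →L[ℂ] H := (l : ℂ) • G₂ + ((z : ℂ) • D₀ + E) with hM
  have hMn : ‖M‖ ≤ d * l := by
    calc ‖M‖ ≤ ‖(l : ℂ) • G₂‖ + (‖(z : ℂ) • D₀‖ + ‖E‖) :=
          (norm_add_le _ _).trans (add_le_add le_rfl (norm_add_le _ _))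
      _ ≤ l * ‖G₂‖ + (l * ‖D₀‖ + C * l) := by
          refine add_le_add ?_ (add_le_add ?_ ?_)
          · rw [norm_smul, Complex.norm_real, Real.norm_of_nonneg hl.le]
          · rw [norm_smul, Complex.norm_real, Real.norm_eq_abs]
            gcongr
          · refine hE.trans ?_
            rw [hlθ]
            gcongr
            exact mul_le_of_le_one_right hl.le hlθ1
      _ = d * l := by rw [hd]; ring
  -- The first-order perturbation of `φ` per unit of `l`; only `E` contributes to the deviation `e`
  -- of `⟨φ, χ⟩` from `-1`.
  set χ : H := (l : ℂ)⁻¹ • M φ with hχ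
  have hMχ : M φ = (l : ℂ) • χ := by rw [hχ, smul_smul, mul_inv_cancel₀ hlc, one_smul]
  have hχn : ‖χ‖ ≤ d * ‖φ‖ := by
    rw [hχ, norm_smul, norm_inv, Complex.norm_real, Real.norm_of_nonneg hl.le]
    calc l⁻¹ * ‖M φ‖ ≤ l⁻¹ * (d * l * ‖φ‖) := by
          gcongr
          exact (M.le_opNorm φ).trans (mul_le_mul_of_nonneg_right hMn (norm_nonneg _))
      _ = d * ‖φ‖ := by field_simp
  set e : ℂ := (l : ℂ)⁻¹ * inner ℂ φ (E φ) with he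
  have hχi : inner ℂ φ χ = -1 + e := by
    rw [hχ, inner_smul_right, hM]
    simp only [_root_.add_apply, _root_.smul_apply, inner_add_right, inner_smul_right, h₂, h₀]
    rw [he]
    field_simp
    ring
  have hen : ‖e‖ ≤ C * n * l ^ θ := by
    rw [he, norm_mul, norm_inv, Complex.norm_real, Real.norm_of_nonneg hl.le]
    have h1 : ‖inner ℂ φ (E φ)‖ ≤ ‖φ‖ * (C * (l * l ^ θ) * ‖φ‖) := by
      refine (norm_inner_le_norm _ _).trans ?_
      gcongr
      rw [← hlθ]
      exact (E.le_opNorm φ).trans (mul_le_mul_of_nonneg_right hE (norm_nonneg _))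
    calc l⁻¹ * ‖inner ℂ φ (E φ)‖ ≤ l⁻¹ * (‖φ‖ * (C * (l * l ^ θ) * ‖φ‖)) := by gcongr
      _ = C * n * l ^ θ := by rw [hn]; field_simp
  set Y : H →L[ℂ] H := S * (1 + InnerProductSpace.rankOne ℂ χ φ) with hY
  have hYn : ‖Y‖ ≤ y := by
    rw [hY, hy]
    refine (norm_mul_le _ _).trans (mul_le_mul_of_nonneg_left ?_ (norm_nonneg _))
    refine (norm_add_le _ _).trans (add_le_add ContinuousLinearMap.norm_id_le ?_)
    rw [InnerProductSpace.norm_rankOne, hn, ← mul_assoc]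
    gcongr
  have key := comp_approximate_inverse hG hφ hS hlc hMχ hχi
  rw [← hY, ← hAeq] at key
  set Q : H →L[ℂ] H := (e / inner ℂ φ φ) • InnerProductSpace.rankOne ℂ φ φ + M * Y with hQ
  have hφn : ‖inner ℂ φ φ‖ = n := by
    rw [inner_self_eq_norm_sq_to_K, norm_pow, hn]
    simp [sq]
  have hn0 : 0 < n := by have := norm_pos_iff.2 hφ; positivity
  have hQn : ‖Q‖ ≤ q * l ^ θ := by
    have h1 : ‖(e / inner ℂ φ φ) • InnerProductSpace.rankOne ℂ φ φ‖ ≤ C * n * l ^ θ := by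
      rw [norm_smul, norm_div, hφn, InnerProductSpace.norm_rankOne, ← hn,
        div_mul_cancel₀ _ hn0.ne']
      exact hen
    have h2 : ‖M * Y‖ ≤ d * y * l ^ θ := by
      calc ‖M * Y‖ ≤ d * l * y :=
            (norm_mul_le _ _).trans (mul_le_mul hMn hYn (norm_nonneg _) (by positivity))
        _ ≤ d * l ^ θ * y := by gcongr
        _ = d * y * l ^ θ := by ring
    calc ‖Q‖ ≤ _ := norm_add_le _ _
      _ ≤ C * n * l ^ θ + d * y * l ^ θ := add_le_add h1 h2
      _ = q * l ^ θ := by rw [hq]; ring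
  obtain ⟨W, hAW, hWA, hWX⟩ := exists_inverse_of_approximate hA key (hQn.trans hqs)
  refine ⟨W, hAW, hWA, ?_⟩
  set X₀ : H →L[ℂ] H := (l : ℂ)⁻¹ • InnerProductSpace.rankOne ℂ φ φ with hX₀
  have hX₀n : ‖X₀‖ = l⁻¹ * n := by
    rw [hX₀, norm_smul, norm_inv, Complex.norm_real, Real.norm_of_nonneg hl.le,
      InnerProductSpace.norm_rankOne]
  have hX₀' : ((l⁻¹ : ℝ) : ℂ) • InnerProductSpace.rankOne ℂ φ φ = X₀ := by
    rw [hX₀, Complex.ofReal_inv]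
  have hlinv : 1 ≤ l⁻¹ := (one_le_inv₀ hl).2 hl1.le
  have hXn : ‖X₀ + Y‖ ≤ l⁻¹ * (n + y) := by
    refine (norm_add_le _ _).trans ?_
    rw [hX₀n, mul_add]
    gcongr
    exact hYn.trans (le_mul_of_one_le_left hy0 hlinv)
  rw [hX₀']
  calc ‖W - X₀‖ = ‖(W - (X₀ + Y)) + Y‖ := by congr 1; abel
    _ ≤ 2 * ‖X₀ + Y‖ * ‖Q‖ + ‖Y‖ := (norm_add_le _ _).trans (add_le_add_left hWX _)
    _ ≤ 2 * (l⁻¹ * (n + y)) * (q * l ^ θ) + y * 1 := by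
        rw [mul_one]
        gcongr
    _ ≤ 2 * (l⁻¹ * (n + y)) * (q * l ^ θ) + y * l ^ (-1 + θ) := by gcongr
    _ = (y + 2 * (n + y) * q) * l ^ (-1 + θ) := by rw [← hlθ4]; ring

end Perturbation

/-! ### The weight `|v|^(1/2)` -/

/-- The decay of `v` holds only almost everywhere; truncating a measurable representative makes the
bound hold at every point. The exponent `b / 2` exceeds `2`. -/
theorem exists_weight {v : R4 → ℝ} (hv : AEStronglyMeasurable v volume) {C b : ℝ} (hb : 4 < b)
    (hdecay : ∀ᵐ x, |v x| ≤ C * (1 + ‖x‖) ^ (-b)) :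
    ∃ (s : R4 → ℝ) (A β : ℝ), IsWeight s A β ∧ ∀ᵐ x, √|v x| = s x := by
  refine ⟨fun x => min (√|hv.mk v x|) (√|C| * (1 + ‖x‖) ^ (-(b / 2))), √|C|, b / 2, ?_, ?_⟩
  · refine ⟨?_, fun x => ?_, fun x => min_le_right _ _, by linarith, Real.sqrt_nonneg _⟩
    · have h1 : Measurable (hv.mk v) := hv.stronglyMeasurable_mk.measurable
      have h2 : Measurable fun x : R4 => √|C| * (1 + ‖x‖) ^ (-(b / 2)) := by fun_prop
      exact (h1.norm.sqrt).min h2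
    · positivity
  · filter_upwards [hdecay, hv.ae_eq_mk] with x hx he
    rw [← he, min_eq_left]
    have hp : (0 : ℝ) ≤ (1 + ‖x‖) ^ (-b) := by positivity
    have h1 : |v x| ≤ |C| * (1 + ‖x‖) ^ (-b) :=
      hx.trans (mul_le_mul_of_nonneg_right (le_abs_self C) hp)
    refine (Real.sqrt_le_sqrt h1).trans (le_of_eq ?_)
    rw [Real.sqrt_mul (abs_nonneg C), Real.sqrt_eq_rpow ((1 + ‖x‖) ^ (-b)),
      ← Real.rpow_mul (by positivity)]
    congr 2
    ring

section Weight

variable {m A β : ℝ} {s v : R4 → ℝ}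

theorem mulOp_apply_of_ae_eq (hs : IsWeight s A β) (hsv : ∀ᵐ x, √|v x| = s x) (ψ : L2) :
    ∀ᵐ x, mulOp (fun x => √|v x|) ψ x = (s x : ℂ) * ψ x := by
  have hae : (fun x => ((s x : ℝ) : ℂ)) =ᵐ[volume] fun x => ((√|v x| : ℝ) : ℂ) := by
    filter_upwards [hsv] with x hx
    rw [hx]
  have hmem : MemLp (fun x => ((√|v x| : ℝ) : ℂ)) ∞ volume := by
    refine (memLp_congr_ae hae).1 (memLp_top_of_bound
      (Complex.measurable_ofReal.comp hs.measurable).aestronglyMeasurable A (ae_of_all _ fun x => ?_))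
    rw [Complex.norm_real, Real.norm_of_nonneg (hs.nonneg x)]
    exact hs.le_const x
  filter_upwards [coeFn_mulOp hmem ψ, hsv] with x h1 h2
  rw [h1, h2]

theorem isSelfAdjoint_of_ae_mul {S : L2 →L[ℂ] L2}
    (hS : ∀ ψ, ∀ᵐ x, S ψ x = (s x : ℂ) * ψ x) : IsSelfAdjoint S := by
  rw [ContinuousLinearMap.isSelfAdjoint_iff_isSymmetric]
  intro ψ χ
  change inner ℂ (S ψ) χ = inner ℂ ψ (S χ)
  rw [L2.inner_def, L2.inner_def]
  refine integral_congr_ae ?_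
  filter_upwards [hS ψ, hS χ] with x h1 h2
  rw [h1, h2, RCLike.inner_apply, RCLike.inner_apply, map_mul, Complex.conj_ofReal]
  ring

theorem isMul_neg_sq {S : L2 →L[ℂ] L2} (hS : ∀ ψ, ∀ᵐ x, S ψ x = (s x : ℂ) * ψ x)
    (hv : ∀ᵐ x, v x = -(s x ^ 2)) (ψ : L2) : IsMul v ψ (-S (S ψ)) := by
  filter_upwards [hS ψ, hS (S ψ), hv, Lp.coeFn_neg (S (S ψ))] with x h1 h2 h3 h4
  rw [h4, Pi.neg_apply, h2, h1, h3]
  push_cast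
  ring

theorem IsIntegralOperator.of_weightKernel_riesz (hsv : ∀ᵐ x, √|v x| = s x) {G : L2 →L[ℂ] L2}
    (hG : IsIntegralOperator (weightKernel s fun z => m / (2 * Real.pi ^ 2) * (‖z‖ ^ 2)⁻¹) G) :
    IsIntegralOperator (kernelG m v) G := by
  refine hG.congr ?_
  filter_upwards [hsv] with x hx
  filter_upwards [hsv] with y hy
  rw [kernelG, weightKernel, hx, hy]
  ring

/-- `T` is the rank-one operator `ψ ↦ (∫ s ψ) s`. -/
theorem inner_const_kernel {T : L2 →L[ℂ] L2} (hT : IsIntegralOperator (weightKernel s fun _ => 1) T)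
    {φ : L2} {I : ℝ} (hφ : ∫ x, (s x : ℂ) * φ x = (I : ℂ)) : inner ℂ φ (T φ) = ((I * I : ℝ) : ℂ) := by
  have hTφ : ∀ᵐ x, T φ x = ((s x * I : ℝ) : ℂ) := by
    filter_upwards [hT φ] with x hx
    have e : ∀ y, (weightKernel s (fun _ => 1) x y : ℂ) * φ y = (s x : ℂ) * ((s y : ℂ) * φ y) := by
      intro y
      rw [weightKernel]
      push_cast
      ring
    rw [hx.2]
    simp only [e]
    rw [integral_const_mul, hφ, ← Complex.ofReal_mul]
  have h := (inner_eq_integral_of_real hTφ φ).2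
  have e : ∀ x, ((s x * I : ℝ) : ℂ) * φ x = (I : ℂ) * ((s x : ℂ) * φ x) := by
    intro x
    push_cast
    ring
  simp only [e] at h
  rw [integral_const_mul, hφ, ← Complex.ofReal_mul] at h
  rw [← inner_conj_symm, h, Complex.conj_ofReal]

end Weight

/-! ### The main theorem -/

theorem hsNorm_smul {H : Type*} [NormedAddCommGroup H] [InnerProductSpace ℂ H] [CompleteSpace H]
    (c : ℂ) (T : H →L[ℂ] H) : hsNorm (c • T) = ‖c‖ₑ * hsNorm T := by
  simp only [hsNorm, _root_.smul_apply, enorm_smul, mul_pow, ENNReal.tsum_mul_left]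
  rw [ENNReal.mul_rpow_of_nonneg _ _ (by norm_num), ← ENNReal.rpow_natCast, ← ENNReal.rpow_mul]
  norm_num

/-- Lets a remainder be defined by solving the expansion for it, so that only its size has to be
proved. -/
theorem eq_add_smul_inv_smul_sub {r : ℝ} (hr : r ≠ 0) (T X : L2 →L[ℂ] L2) :
    T = X + (r : ℂ) • ((r⁻¹ : ℝ) : ℂ) • (T - X) := by
  rw [smul_smul, ← Complex.ofReal_mul, mul_inv_cancel₀ hr, Complex.ofReal_one, one_smul]
  abel

/-- The upper bound holds because `z ln|z| - τz → 0`; the lower one says `ln|z| ≤ τ - 1`, whence the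
radius `exp (τ - 1)`. -/
theorem exists_small_interval (τ : ℝ) {l₀ : ℝ} (hl₀ : 0 < l₀) :
    ∃ z₀ : ℝ, 0 < z₀ ∧ ∀ z : ℝ, -z₀ < z → z < 0 →
      |z| ≤ z * (Real.log |z| - τ) ∧ z * (Real.log |z| - τ) < l₀ := by
  have h1 : Tendsto (fun z : ℝ => Real.log z * z - τ * z) (𝓝[<] 0) (𝓝 (0 - τ * 0)) :=
    tendsto_log_mul_self_nhdsLT_zero.sub
      ((tendsto_id.const_mul τ).mono_left nhdsWithin_le_nhds)
  rw [mul_zero, sub_zero] at h1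
  obtain ⟨a, ha, hsub⟩ := mem_nhdsLT_iff_exists_Ioo_subset.1 (h1.eventually (gt_mem_nhds hl₀))
  refine ⟨min (-a) (Real.exp (τ - 1)), lt_min (neg_pos.2 ha) (Real.exp_pos _), fun z hz hz0 => ?_⟩
  have hz1 : a < z := by linarith [min_le_left (-a) (Real.exp (τ - 1))]
  have hz2 : -z < Real.exp (τ - 1) := by linarith [min_le_right (-a) (Real.exp (τ - 1))]
  have habs : |z| = -z := abs_of_neg hz0
  constructor
  · have h2 : Real.log |z| ≤ τ - 1 := by
      rw [habs]
      exact ((Real.log_lt_iff_lt_exp (by linarith)).2 hz2).le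
    nlinarith
  · have h3 : Real.log z * z - τ * z < l₀ := hsub ⟨hz1, hz0⟩
    rw [Real.log_abs]
    linarith

end TwoBody

end

open TwoBody in
theorem mainTheorem6 (m : ℝ) (hm : 0 < m) (v : TwoBody.R4 → ℝ)
    (hv_meas : AEStronglyMeasurable v volume)
    (hv_nonpos : ∀ᵐ x, v x ≤ 0)
    (hv_decay : ∃ C b : ℝ, 4 < b ∧ ∀ᵐ x, |v x| ≤ C * (1 + ‖x‖) ^ (-b)) :
    ∃ G : TwoBody.L2 →L[ℂ] TwoBody.L2,
      TwoBody.IsIntegralOperator (TwoBody.kernelG m v) G ∧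
      (∃ G₁ G₂ : TwoBody.L2 →L[ℂ] TwoBody.L2, IsCompactOperator G₁ ∧ IsCompactOperator G₂ ∧
        ∃ (δ C z₀ : ℝ) (Gδ : ℝ → TwoBody.L2 →L[ℂ] TwoBody.L2), 0 < δ ∧ 0 < z₀ ∧
          ∀ z : ℝ, -z₀ < z → z < 0 →
            (z : ℂ) ∈ TwoBody.resolventSet (TwoBody.schrodinger m 0) ∧
            TwoBody.sandwich v (TwoBody.resolvent (TwoBody.schrodinger m 0) (z : ℂ)) =
              G + (z : ℂ) • G₁ + ((z * Real.log |z| : ℝ) : ℂ) • G₂ +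
                ((|z| ^ (1 + δ) : ℝ) : ℂ) • Gδ z ∧
            TwoBody.hsNorm (Gδ z) ≤ ENNReal.ofReal (C * |z| ^ δ)) ∧
      (TwoBody.HasResonance m v →
        ∃ φ : TwoBody.L2, φ ≠ 0 ∧ (∀ ψ : TwoBody.L2, G ψ = ψ ↔ ∃ c : ℂ, ψ = c • φ) ∧
          ∫ x, (√|v x| : ℂ) * φ x = ((2 * Real.pi / m : ℝ) : ℂ) ∧
          ∃ τ δ₀ : ℝ, 0 < δ₀ ∧ ∀ δ : ℝ, 0 < δ → δ < δ₀ →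
            ∃ (C z₀ : ℝ) (wδ : ℝ → TwoBody.L2 →L[ℂ] TwoBody.L2), 0 < z₀ ∧
              ∀ z : ℝ, -z₀ < z → z < 0 →
                (z : ℂ) ∈ TwoBody.resolventSet (TwoBody.schrodinger m v) ∧
                0 < z * (Real.log |z| - τ) ∧
                TwoBody.wOp m v z =
                  (((z * (Real.log |z| - τ))⁻¹ : ℝ) : ℂ) • InnerProductSpace.rankOne ℂ φ φ +
                    (((z * (Real.log |z| - τ)) ^ (-1 + δ) : ℝ) : ℂ) • wδ z ∧
                ‖wδ z‖ ≤ C) := by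
  obtain ⟨C₀, b, hb, hdecay⟩ := hv_decay
  obtain ⟨s, A, β, hs, hsv⟩ := exists_weight hv_meas hb hdecay
  have hvs : ∀ᵐ x, v x = -(s x ^ 2) := by
    filter_upwards [hsv, hv_nonpos] with x h1 h2
    rw [← h1, Real.sq_sqrt (abs_nonneg _), abs_of_nonpos h2, neg_neg]
  set S : L2 →L[ℂ] L2 := mulOp fun x => √|v x| with hSdef
  have hS : ∀ ψ, ∀ᵐ x, S ψ x = (s x : ℂ) * ψ x := mulOp_apply_of_ae_eq hs hsv
  have hSsa : IsSelfAdjoint S := isSelfAdjoint_of_ae_mul hS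
  obtain ⟨T, hT, hTc, hTsa, -⟩ := hs.exists_riesz
  obtain ⟨T₀, hT₀, hT₀c, hT₀sa⟩ := hs.exists_const
  obtain ⟨T₁, hT₁, hT₁c, hT₁sa⟩ := hs.exists_log
  have hreal : ∀ (r : ℝ) {B : L2 →L[ℂ] L2}, IsSelfAdjoint B → IsSelfAdjoint ((r : ℂ) • B) :=
    fun r B hB => IsSelfAdjoint.smul (Complex.conj_ofReal r) hB
  set G : L2 →L[ℂ] L2 := ((m / (2 * Real.pi ^ 2) : ℝ) : ℂ) • T with hGdef
  have hG := hT.weight_smul (m / (2 * Real.pi ^ 2))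
  rw [← hGdef] at hG
  have hGsa : IsSelfAdjoint G := hreal _ hTsa
  have hGc : IsCompactOperator G := by
    rw [hGdef]
    exact hTc.smul ((m / (2 * Real.pi ^ 2) : ℝ) : ℂ)
  obtain ⟨c, θ, C, hθ, hC, hexp⟩ := hs.exists_expansion hm
  replace hexp := hexp S G T₀ T₁ hS hG hT₀ hT₁
  set G₁ : L2 →L[ℂ] L2 := ((logCoeff m * c : ℝ) : ℂ) • T₀ + ((logCoeff m * 2 : ℝ) : ℂ) • T₁
    with hG₁
  set G₂ : L2 →L[ℂ] L2 := (logCoeff m : ℂ) • T₀ with hG₂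
  have hG₁c : IsCompactOperator G₁ := by
    rw [hG₁]
    exact (hT₀c.smul ((logCoeff m * c : ℝ) : ℂ)).add (hT₁c.smul ((logCoeff m * 2 : ℝ) : ℂ))
  have hG₂c : IsCompactOperator G₂ := by
    rw [hG₂]
    exact hT₀c.smul (logCoeff m : ℂ)
  -- The gain `|z|^θ` is shared equally: `θ / 2` goes to the prefactor and `θ / 2` to the
  -- Hilbert–Schmidt bound. The expansion holds for every `z < 0`, so `z₀ = 1` is arbitrary.
  refine ⟨G, hG.of_weightKernel_riesz hsv, ⟨G₁, G₂, hG₁c, hG₂c,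
    θ / 2, C, 1, fun z => (((|z| ^ (1 + θ / 2))⁻¹ : ℝ) : ℂ) •
      (sandwich v (resolvent (schrodinger m 0) (z : ℂ)) - (G + (z : ℂ) • G₁ +
        ((z * Real.log |z| : ℝ) : ℂ) • G₂)), by positivity, one_pos, ?_⟩, ?_⟩
  · intro z _ hz
    obtain ⟨R, hR, hRres, -⟩ := exists_freeResolvent hm hz
    have hsand : sandwich v (resolvent (schrodinger m 0) (z : ℂ)) = S ∘L R ∘L S := by
      rw [hRres.resolvent_eq]
      rfl
    have hz' : 0 < |z| := abs_pos.2 hz.ne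
    have hp : 0 < |z| ^ (1 + θ / 2) := Real.rpow_pos_of_pos hz' _
    refine ⟨⟨R, hRres⟩, ?_, ?_⟩
    · exact eq_add_smul_inv_smul_sub hp.ne' _ _
    · beta_reduce
      rw [hsand, hsNorm_smul, enorm_ofReal, Real.enorm_of_nonneg (by positivity)]
      refine (mul_le_mul_right (hexp z hz R hR) _).trans (le_of_eq ?_)
      rw [← ENNReal.ofReal_mul (by positivity)]
      congr 1
      have h1 : |z| ^ (1 + θ) = |z| ^ (1 + θ / 2) * |z| ^ (θ / 2) := by
        rw [← Real.rpow_add hz']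
        congr 1
        ring
      rw [h1]
      field_simp
  · rintro ⟨-, f, hfH, hfpos, hfsol, -⟩
    have hf4 := memLp_of_homogeneousSobolev hfH
    obtain ⟨φ, hφ0, hφiff, hφint⟩ := exists_eigenfunction hm hs hvs hf4 hfsol hfpos hGsa hG
    have hGφ : G φ = φ := (hφiff φ).2 ⟨1, (one_smul ℂ φ).symm⟩
    obtain ⟨S', hS'⟩ := exists_reducedResolvent hGc hGsa hφ0 hGφ fun ψ => (hφiff ψ).1
    have hG₁sa : IsSelfAdjoint G₁ := (hreal _ hT₀sa).add (hreal _ hT₁sa)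
    have hG₂sa : IsSelfAdjoint G₂ := hreal _ hT₀sa
    set τ : ℝ := (inner ℂ φ (G₁ φ)).re with hτ
    have hτ' : inner ℂ φ (G₁ φ) = (τ : ℂ) := by
      refine (Complex.conj_eq_iff_re.1 ?_).symm
      rw [inner_conj_symm, ← ContinuousLinearMap.adjoint_inner_right, hG₁sa.adjoint_eq]
    have h₂ : inner ℂ φ (G₂ φ) = -1 := by
      rw [hG₂, _root_.smul_apply, inner_smul_right, inner_const_kernel hT₀ hφint,
        ← Complex.ofReal_mul, logCoeff]
      -- The normalization `∫ s φ = 2π / m` is chosen for this cancellation.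
      have : -(m ^ 2 / (4 * Real.pi ^ 2)) * (2 * Real.pi / m * (2 * Real.pi / m)) = -1 := by
        field_simp
        norm_num
      rw [this]
      norm_num
    -- This orthogonality determines `τ`.
    have h₀ : inner ℂ φ ((G₁ + (τ : ℂ) • G₂) φ) = 0 := by
      rw [_root_.add_apply, _root_.smul_apply, inner_add_right, inner_smul_right, hτ', h₂]
      ring
    set θ' := min θ 1 with hθ'
    have hθ'0 : 0 < θ' := lt_min hθ one_pos
    obtain ⟨C', l₀, hl₀, hinv⟩ := exists_inverse_expansion hGφ hφ0 hS' h₂ h₀ hC hθ'0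
      (min_le_right _ _)
    have hφint' : ∫ x, (√|v x| : ℂ) * φ x = ((2 * Real.pi / m : ℝ) : ℂ) := by
      rw [← hφint]
      refine integral_congr_ae ?_
      filter_upwards [hsv] with x hx
      rw [hx]
    refine ⟨φ, hφ0, hφiff, hφint', τ, θ', hθ'0, fun δ hδ hδθ => ?_⟩
    obtain ⟨z₀, hz₀, hsmall⟩ := exists_small_interval τ (lt_min hl₀ one_pos)
    refine ⟨|C'|, z₀, fun z => ((((z * (Real.log |z| - τ)) ^ (-1 + δ))⁻¹ : ℝ) : ℂ) •
      (wOp m v z - (((z * (Real.log |z| - τ))⁻¹ : ℝ) : ℂ) • InnerProductSpace.rankOne ℂ φ φ),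
      hz₀, fun z hz hz0 => ?_⟩
    obtain ⟨hzl, hll⟩ := hsmall z hz hz0
    have hz' : 0 < |z| := abs_pos.2 hz0.ne
    have hl : 0 < z * (Real.log |z| - τ) := hz'.trans_le hzl
    obtain ⟨R, hR, hRres, hRsa⟩ := exists_freeResolvent hm hz0
    have hE := norm_le_of_hsNorm_le _ (by positivity) (hexp z hz0 R hR)
    have hE0 := sub_add_cancel (S ∘L R ∘L S)
      (G + (z : ℂ) • G₁ + ((z * Real.log |z| : ℝ) : ℂ) • G₂)
    set E : L2 →L[ℂ] L2 := S ∘L R ∘L S - (G + (z : ℂ) • G₁ + ((z * Real.log |z| : ℝ) : ℂ) • G₂)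
      with hEdef
    set l : ℝ := z * (Real.log |z| - τ) with hldef
    have hl1 : l < 1 := hll.trans_le (min_le_right _ _)
    have hE' : ‖E‖ ≤ C * l ^ (1 + θ') := by
      refine hE.trans (mul_le_mul_of_nonneg_left ?_ hC)
      refine (Real.rpow_le_rpow hz'.le hzl (by positivity)).trans ?_
      exact Real.rpow_le_rpow_of_exponent_ge hl hl1.le (by linarith [min_le_left θ 1])
    -- Regrouping `z G₁ + z ln|z| G₂ = l G₂ + z(G₁ + τG₂)`.
    have hAeq : 1 - S ∘L R ∘L S =
        1 - G - ((l : ℂ) • G₂ + ((z : ℂ) • (G₁ + (τ : ℂ) • G₂) + E)) := by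
      rw [← hE0, hldef]
      push_cast
      module
    have hAsa : IsSelfAdjoint (1 - S ∘L R ∘L S) := by
      have h1 : IsSelfAdjoint (S * R * star S) := hRsa.conjugate S
      rw [hSsa.star_eq] at h1
      exact (IsSelfAdjoint.one _).sub h1
    obtain ⟨W, hAW, hWA, hWn⟩ := hinv z l E _ hl (hll.trans_le (min_le_left _ _)) hzl hE' hAeq hAsa
    have hA : ∀ ψ, W ψ - S (R (S (W ψ))) = ψ := fun ψ => congrArg (fun B : L2 →L[ℂ] L2 => B ψ) hAW
    have hA' : ∀ ψ, W (ψ - S (R (S ψ))) = ψ := fun ψ => congrArg (fun B : L2 →L[ℂ] L2 => B ψ) hWA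
    have hres := isResolventAt_birmanSchwinger (isMul_neg_sq hS hvs) hRres hA hA'
    have hw : wOp m v z = W := by
      rw [wOp, hres.resolvent_eq]
      exact one_add_birmanSchwinger hA hA'
    have hp : 0 < l ^ (-1 + δ) := Real.rpow_pos_of_pos hl _
    refine ⟨⟨_, hres⟩, hl, ?_, ?_⟩
    · exact eq_add_smul_inv_smul_sub hp.ne' _ _
    · beta_reduce
      rw [hw, ← hldef, norm_smul, Complex.norm_real, Real.norm_of_nonneg (by positivity)]
      -- The quotient of the two powers is `l^(θ' - δ)`, bounded because `δ < θ'` and `l < 1`.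
      calc (l ^ (-1 + δ))⁻¹ * _ ≤ (l ^ (-1 + δ))⁻¹ * (C' * l ^ (-1 + θ')) := by gcongr
        _ = C' * l ^ (θ' - δ) := by
          have h1 : l ^ (-1 + θ') = l ^ (-1 + δ) * l ^ (θ' - δ) := by
            rw [← Real.rpow_add hl]
            congr 1
            ring
          rw [h1]
          field_simp
        _ ≤ |C'| * 1 := by
          refine mul_le_mul (le_abs_self _) ?_ (by positivity) (abs_nonneg _)
          exact Real.rpow_le_one hl.le hl1.le (by linarith)
        _ = |C'| := mul_one _
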